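/- **Theorem 3.4 (classical random walk algorithm).** *Model.* A randomized real RAM has finitely many registers and an unbounded random access memory whose cells hold real numbers (initially $0$ outside the input); assignments, exact additions, subtractions, multiplications and divisions of reals, drawing an independent uniform random number from $[0,1]$, a read or write at a computed address, and a comparison each take one time step. A matrix is output row by row in a block of memory, whose address is returned; cells that still hold $0$ need not be written. *Notation.* For $M\in\mathbb R^{r\times c}$ and $p,q\in[1,\infty]$ let $\|M\|_{p,q}=\big(\sum_{i}(\sum_{j}|M_{ij}|^p)^{q/p}\big)^{1/q}$ (with the usual meaning for $p=\infty$ or $q=\infty$), $\|M\|_{\max}=\|M\|_{\infty,\infty}$ and $\|M\|_F=\|M\|_{2,2}$, and let $|M|$ be the matrix of entry-wise absolute values. For $k\ge 1$, $n_0,\dots,n_k\ge 1$ and $A_\ell\in\mathbb R^{n_{\ell-1}\times n_\ell}$ put $P=A_1\cdots A_k$, $\overline P=|A_1|\cdots|A_k|$, $d=n_0n_k$ and $S=\sum_{\ell=1}^k n_{\ell-1}n_\ell$ (the size of the input). "Time $\widetilde O(g)$" means at most $C\,(1+g)\,\log(2+S+g)^c$ time steps. *Claim.* There are fixed programs and universal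 constants $C,c$ such that for all such $k$, $n_0,\dots,n_k$ and $A_1,\dots,A_k$ the following holds. A preprocessing program, which does not see $\varepsilon$ and $\delta$, halts after at most $C\,S\log(2+S)^c$ steps, with memory contents that do not depend on the random numbers. Started from this memory, for all $\varepsilon>0$ and $\delta\in(0,1)$: 1. (Max-norm.) A program with input $\varepsilon,\delta$ always halts, and with probability at least $1-\delta$ it halts within time $$\widetilde O\Big(k\cdot\frac{\max\{\|\overline P\|_{\infty,\infty},\varepsilon\}\cdot\|\overline P\|_{1,1}}{\varepsilon^2}\cdot\log\frac{2d}{\delta}\Big)$$ and outputs $\widetilde A$ with $\|\widetilde A-P\|_{\max}\le\varepsilon$. (For $\varepsilon\le\|\overline P\|_{\infty,\infty}$ the maximum is $\|\overline P\|_{\infty,\infty}$; for larger $\varepsilon$ the zero matrix is a valid answer.) 2. (Max-norm, given a bound.) If a number $b\ge\|\overline P\|_{\infty,\infty}$ is supplied as a further input, a program always outputs a matrix $\widetilde A$ within time $$\widetilde O\Big(k\cdot\frac{b\cdot\|\overline P\|_{1,1}}{\varepsilon^2}\cdot\log\frac{2d}{\delta}\Big),$$ and $\|\widetilde A-P\|_{\max}\le\varepsilon$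 with probability at least $1-\delta$. 3. (Frobenius norm.) A program with input $\varepsilon,\delta$ always outputs a matrix $\widetilde A$ within time $$\widetilde O\Big(k\cdot\frac{\|\overline P\|_{1,1}^2}{\varepsilon^2}\cdot\log\frac{2}{\delta}\Big),$$ and $\|\widetilde A-P\|_F\le\varepsilon$ with probability at least $1-\delta$. -/

import Mathlib

open MeasureTheory
open scoped ENNReal unitInterval

noncomputable section

/-! ### Matrices -/

/-- Element-wise matrix norm `‖B‖_{p,q}`: the `ℓ_q`-norm of the vector of `ℓ_p`-norms of the
rows. -/
def elemNorm {r c : ℕ} (p q : ℝ≥0∞) (B : Matrix (Fin r) (Fin c) ℝ) : ℝ :=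
  ‖(WithLp.toLp q fun i => ‖(WithLp.toLp p (B i) : PiLp p fun _ : Fin c => ℝ)‖ :
    PiLp q fun _ : Fin r => ℝ)‖

/-- The product `A 0 * A 1 * ⋯ * A (k - 1)` of the first `k` matrices of a sequence, where
`A ℓ` is of size `n ℓ × n (ℓ + 1)`. -/
def chainProd (n : ℕ → ℕ) (A : ∀ l : ℕ, Matrix (Fin (n l)) (Fin (n (l + 1))) ℝ) :
    ∀ k : ℕ, Matrix (Fin (n 0)) (Fin (n k)) ℝ
  | 0 => 1
  | k + 1 => chainProd n A k * A k

/-- The product of the entry-wise absolute values of the first `k` matrices. -/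
def absChainProd (n : ℕ → ℕ) (A : ∀ l : ℕ, Matrix (Fin (n l)) (Fin (n (l + 1))) ℝ) (k : ℕ) :
    Matrix (Fin (n 0)) (Fin (n k)) ℝ :=
  chainProd n (fun l => (A l).map fun x => |x|) k

/-- The size of the input: the total number of entries of the first `k` matrices. -/
def inputSize (n : ℕ → ℕ) (k : ℕ) : ℕ :=
  ∑ l ∈ Finset.range k, n l * n (l + 1)

/-! ### The randomized real RAM

A program works on finitely many registers and on an unbounded random access memory. Every
register and every memory cell holds a real number. Assignments, the four arithmetic operations,
a random number drawn uniformly from `[0, 1]`, one indirect read, one indirect write and one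
comparison take one time step each. -/

/-- The state of the machine: registers, memory, and the number of random numbers drawn so far. -/
structure RamState where
  reg : ℕ → ℝ
  mem : ℕ → ℝ
  coin : ℕ

/-- Assign a value to a register. -/
def RamState.setReg (s : RamState) (i : ℕ) (x : ℝ) : RamState :=
  { s with reg := Function.update s.reg i x }

/-- Assign a value to a memory cell. -/
def RamState.setMem (s : RamState) (a : ℕ) (x : ℝ) : RamState :=
  { s with mem := Function.update s.mem a x }

/-- Elementary instructions; the arguments are register numbers, except for the literal `c`. -/
inductive RamInstr where
  | const (i c : ℕ)
  | copy (i j : ℕ)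
  | add (i j l : ℕ)
  | sub (i j l : ℕ)
  | mul (i j l : ℕ)
  | div (i j l : ℕ)
  | rand (i : ℕ)
  | load (i j : ℕ)
  | store (i j : ℕ)

/-- Programs: an instruction; sequential composition; `ite i j P Q` runs `P` if register `i` is
less than register `j` and `Q` otherwise; `loop i j P` repeats `P` as long as register `i` is
less than register `j`. -/
inductive RamProg where
  | instr (c : RamInstr)
  | seq (P Q : RamProg)
  | ite (i j : ℕ) (P Q : RamProg)
  | loop (i j : ℕ) (P : RamProg)

/-- `RamInstr.Step ω c s s'`: with random numbers `ω 0, ω 1, …`, the instruction `c` leads from `s`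
to `s'`. A division by zero and a memory access at an address that is not a natural number have no
successor state. -/
inductive RamInstr.Step (ω : ℕ → I) : RamInstr → RamState → RamState → Prop
  | const (s : RamState) (i c : ℕ) : Step ω (.const i c) s (s.setReg i (c : ℝ))
  | copy (s : RamState) (i j : ℕ) : Step ω (.copy i j) s (s.setReg i (s.reg j))
  | add (s : RamState) (i j l : ℕ) : Step ω (.add i j l) s (s.setReg i (s.reg j + s.reg l))
  | sub (s : RamState) (i j l : ℕ) : Step ω (.sub i j l) s (s.setReg i (s.reg j - s.reg l))
  | mul (s : RamState) (i j l : ℕ) : Step ω (.mul i j l) s (s.setReg i (s.reg j * s.reg l))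
  | div (s : RamState) (i j l : ℕ) (h : s.reg l ≠ 0) :
      Step ω (.div i j l) s (s.setReg i (s.reg j / s.reg l))
  | rand (s : RamState) (i : ℕ) :
      Step ω (.rand i) s { s.setReg i (ω s.coin : ℝ) with coin := s.coin + 1 }
  | load (s : RamState) (i j a : ℕ) (h : s.reg j = (a : ℝ)) :
      Step ω (.load i j) s (s.setReg i (s.mem a))
  | store (s : RamState) (i j a : ℕ) (h : s.reg i = (a : ℝ)) :
      Step ω (.store i j) s (s.setMem a (s.reg j))

/-- `RamProg.Exec ω P s s' t`: with random numbers `ω 0, ω 1, …`, the program `P` started in the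
state `s` halts in the state `s'` after exactly `t` time steps. -/
inductive RamProg.Exec (ω : ℕ → I) : RamProg → RamState → RamState → ℕ → Prop
  | instr {c : RamInstr} {s s' : RamState} (h : RamInstr.Step ω c s s') :
      Exec ω (.instr c) s s' 1
  | seq {P Q : RamProg} {s s' s'' : RamState} {t t' : ℕ} (h : Exec ω P s s' t)
      (h' : Exec ω Q s' s'' t') : Exec ω (.seq P Q) s s'' (t + t')
  | iteTrue {i j : ℕ} {P Q : RamProg} {s s' : RamState} {t : ℕ} (hc : s.reg i < s.reg j)
      (h : Exec ω P s s' t) : Exec ω (.ite i j P Q) s s' (t + 1)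
  | iteFalse {i j : ℕ} {P Q : RamProg} {s s' : RamState} {t : ℕ} (hc : ¬ s.reg i < s.reg j)
      (h : Exec ω Q s s' t) : Exec ω (.ite i j P Q) s s' (t + 1)
  | loopTrue {i j : ℕ} {P : RamProg} {s s' s'' : RamState} {t t' : ℕ} (hc : s.reg i < s.reg j)
      (h : Exec ω P s s' t) (h' : Exec ω (.loop i j P) s' s'' t') :
      Exec ω (.loop i j P) s s'' (t + t' + 1)
  | loopFalse {i j : ℕ} {P : RamProg} {s : RamState} (hc : ¬ s.reg i < s.reg j) :
      Exec ω (.loop i j P) s s 1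

/-- The law of a sequence of independent random numbers, each uniform on `[0, 1]`. -/
def coinMeasure : Measure (ℕ → I) :=
  Measure.infinitePi fun _ : ℕ => (volume : Measure I)

/-! ### Input and output conventions -/

/-- The address of the first entry of `A l`: the cells `0, …, k` hold the dimensions, and the
matrices `A 0, …, A (k - 1)` follow one after the other, each one row by row. -/
def matrixAddr (n : ℕ → ℕ) (k l : ℕ) : ℕ :=
  k + 1 + inputSize n l

/-- The initial contents of the memory; the cells that are not used for the input hold `0`. -/
def inputMem (n : ℕ → ℕ) (A : ∀ l : ℕ, Matrix (Fin (n l)) (Fin (n (l + 1))) ℝ) (k : ℕ) :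
    ℕ → ℝ := fun a =>
  if a ≤ k then (n a : ℝ)
  else ∑ l ∈ Finset.range k, ∑ i : Fin (n l), ∑ j : Fin (n (l + 1)),
    if a = matrixAddr n k l + i * n (l + 1) + j then A l i j else 0

/-- The state in which the preprocessing starts: `k` in register `0`, the dimensions and the
matrices in memory. -/
def inputState (n : ℕ → ℕ) (A : ∀ l : ℕ, Matrix (Fin (n l)) (Fin (n (l + 1))) ℝ) (k : ℕ) :
    RamState where
  reg := fun i => if i = 0 then (k : ℝ) else 0
  mem := inputMem n A k
  coin := 0

/-- The state in which the main computation starts: the parameters in the first registers (all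
others hold `0`), the memory as the preprocessing has left it, no random number drawn so far. -/
def queryState (params : List ℝ) (mem : ℕ → ℝ) : RamState where
  reg := fun i => params.getD i 0
  mem := mem
  coin := 0

/-- The `r × c` matrix which is stored in memory row by row, from address `a` on. -/
def RamState.matrixAt (s : RamState) (a r c : ℕ) : Matrix (Fin r) (Fin c) ℝ :=
  Matrix.of fun i j => s.mem (a + i * c + j)

/-- The machine returns the `r × c` matrix `B`: register `0` holds the address of a block of memory
in which `B` is stored row by row. -/
def RamState.Returns {r c : ℕ} (s : RamState) (B : Matrix (Fin r) (Fin c) ℝ) : Prop :=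
  ∃ a : ℕ, s.reg 0 = (a : ℝ) ∧ s.matrixAt a r c = B

/-- `RamProg.HaltsIn ω P s T Q`: the run of `P` from `s` with random numbers `ω` halts after at most
`T` time steps, in a state that satisfies `Q`. -/
def RamProg.HaltsIn (ω : ℕ → I) (P : RamProg) (s : RamState) (T : ℝ) (Q : RamState → Prop) :
    Prop :=
  ∃ (s' : RamState) (t : ℕ), P.Exec ω s s' t ∧ (t : ℝ) ≤ T ∧ Q s'

/-- The bound `Õ(g)` on a running time, with explicit constants: `C (1 + g) log(2 + S + g) ^ c`
for an input of size `S`. -/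
def softO (C : ℝ) (c S : ℕ) (g : ℝ) : ℝ :=
  C * (1 + g) * Real.log (2 + S + g) ^ c

end

noncomputable section

set_option linter.unusedSimpArgs false

/-! ### A weakest precondition calculus for the randomized real RAM -/

infixr:60 " ⨟ " => RamProg.seq

namespace RamState

variable (s : RamState) (i j : ℕ) (x : ℝ)

@[simp] theorem reg_setReg : (s.setReg i x).reg j = if j = i then x else s.reg j := by
  simp [setReg, Function.update_apply]

@[simp] theorem mem_setReg : (s.setReg i x).mem = s.mem := rfl

@[simp] theorem coin_setReg : (s.setReg i x).coin = s.coin := rfl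

@[simp] theorem reg_setMem : (s.setMem i x).reg = s.reg := rfl

@[simp] theorem mem_setMem : (s.setMem i x).mem j = if j = i then x else s.mem j := by
  simp [setMem, Function.update_apply]

@[simp] theorem coin_setMem : (s.setMem i x).coin = s.coin := rfl

/-- Draw the random number `x` into register `i`. -/
def draw : RamState := { s.setReg i x with coin := s.coin + 1 }

@[simp] theorem reg_draw : (s.draw i x).reg j = if j = i then x else s.reg j := by
  simp [draw, setReg, Function.update_apply]

@[simp] theorem mem_draw : (s.draw i x).mem = s.mem := rfl

@[simp] theorem coin_draw : (s.draw i x).coin = s.coin + 1 := rfl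

end RamState

namespace RamProg

/-- The run of `P` from `s`, started at time `c`, halts in a state and at a time that satisfy
`Q`. -/
def Wp (ω : ℕ → I) (P : RamProg) (Q : RamState → ℕ → Prop) (s : RamState) (c : ℕ) : Prop :=
  ∃ s' t, P.Exec ω s s' t ∧ Q s' (c + t)

variable {ω : ℕ → I} {P R : RamProg} {Q Q' : RamState → ℕ → Prop} {s : RamState} {c : ℕ}
  {i j l : ℕ}

theorem wp_seq : (P ⨟ R).Wp ω Q s c ↔ P.Wp ω (fun s' c' => R.Wp ω Q s' c') s c := by
  constructor
  · rintro ⟨s', t, h, hQ⟩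
    cases h with
    | seq h h' => exact ⟨_, _, h, _, _, h', by rwa [add_assoc]⟩
  · rintro ⟨s', t, h, s'', t', h', hQ⟩
    exact ⟨_, _, .seq h h', by rwa [← add_assoc]⟩

theorem wp_instr {k : RamInstr} :
    (RamProg.instr k).Wp ω Q s c ↔ ∃ s', k.Step ω s s' ∧ Q s' (c + 1) := by
  constructor
  · rintro ⟨s', t, h, hQ⟩
    cases h with
    | instr h => exact ⟨_, h, hQ⟩
  · rintro ⟨s', h, hQ⟩
    exact ⟨_, _, .instr h, hQ⟩

@[simp] theorem wp_const {x : ℕ} :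
    (RamProg.instr (.const i x)).Wp ω Q s c ↔ Q (s.setReg i x) (c + 1) := by
  rw [wp_instr]
  exact ⟨fun ⟨_, h, hQ⟩ => by cases h; exact hQ, fun h => ⟨_, .const s i x, h⟩⟩

@[simp] theorem wp_copy :
    (RamProg.instr (.copy i j)).Wp ω Q s c ↔ Q (s.setReg i (s.reg j)) (c + 1) := by
  rw [wp_instr]
  exact ⟨fun ⟨_, h, hQ⟩ => by cases h; exact hQ, fun h => ⟨_, .copy s i j, h⟩⟩

@[simp] theorem wp_add :
    (RamProg.instr (.add i j l)).Wp ω Q s c ↔ Q (s.setReg i (s.reg j + s.reg l)) (c + 1) := by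
  rw [wp_instr]
  exact ⟨fun ⟨_, h, hQ⟩ => by cases h; exact hQ, fun h => ⟨_, .add s i j l, h⟩⟩

@[simp] theorem wp_sub :
    (RamProg.instr (.sub i j l)).Wp ω Q s c ↔ Q (s.setReg i (s.reg j - s.reg l)) (c + 1) := by
  rw [wp_instr]
  exact ⟨fun ⟨_, h, hQ⟩ => by cases h; exact hQ, fun h => ⟨_, .sub s i j l, h⟩⟩

@[simp] theorem wp_mul :
    (RamProg.instr (.mul i j l)).Wp ω Q s c ↔ Q (s.setReg i (s.reg j * s.reg l)) (c + 1) := by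
  rw [wp_instr]
  exact ⟨fun ⟨_, h, hQ⟩ => by cases h; exact hQ, fun h => ⟨_, .mul s i j l, h⟩⟩

@[simp] theorem wp_div :
    (RamProg.instr (.div i j l)).Wp ω Q s c ↔
      s.reg l ≠ 0 ∧ Q (s.setReg i (s.reg j / s.reg l)) (c + 1) := by
  rw [wp_instr]
  exact ⟨fun ⟨_, h, hQ⟩ => by cases h with | div _ _ _ _ h0 => exact ⟨h0, hQ⟩,
    fun h => ⟨_, .div s i j l h.1, h.2⟩⟩

@[simp] theorem wp_rand :
    (RamProg.instr (.rand i)).Wp ω Q s c ↔ Q (s.draw i (ω s.coin)) (c + 1) := by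
  rw [wp_instr]
  exact ⟨fun ⟨_, h, hQ⟩ => by cases h; exact hQ, fun h => ⟨_, .rand s i, h⟩⟩

@[simp] theorem wp_load :
    (RamProg.instr (.load i j)).Wp ω Q s c ↔
      ∃ a : ℕ, s.reg j = a ∧ Q (s.setReg i (s.mem a)) (c + 1) := by
  rw [wp_instr]
  exact ⟨fun ⟨_, h, hQ⟩ => by cases h with | load _ _ _ a h0 => exact ⟨a, h0, hQ⟩,
    fun ⟨a, h, hQ⟩ => ⟨_, .load s i j a h, hQ⟩⟩

@[simp] theorem wp_store :
    (RamProg.instr (.store i j)).Wp ω Q s c ↔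
      ∃ a : ℕ, s.reg i = a ∧ Q (s.setMem a (s.reg j)) (c + 1) := by
  rw [wp_instr]
  exact ⟨fun ⟨_, h, hQ⟩ => by cases h with | store _ _ _ a h0 => exact ⟨a, h0, hQ⟩,
    fun ⟨a, h, hQ⟩ => ⟨_, .store s i j a h, hQ⟩⟩

@[simp] theorem wp_seq_const {x : ℕ} :
    (RamProg.instr (.const i x) ⨟ P).Wp ω Q s c ↔ P.Wp ω Q (s.setReg i x) (c + 1) := by
  rw [wp_seq, wp_const]

@[simp] theorem wp_seq_copy :
    (RamProg.instr (.copy i j) ⨟ P).Wp ω Q s c ↔ P.Wp ω Q (s.setReg i (s.reg j)) (c + 1) := by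
  rw [wp_seq, wp_copy]

@[simp] theorem wp_seq_add :
    (RamProg.instr (.add i j l) ⨟ P).Wp ω Q s c ↔
      P.Wp ω Q (s.setReg i (s.reg j + s.reg l)) (c + 1) := by
  rw [wp_seq, wp_add]

@[simp] theorem wp_seq_sub :
    (RamProg.instr (.sub i j l) ⨟ P).Wp ω Q s c ↔
      P.Wp ω Q (s.setReg i (s.reg j - s.reg l)) (c + 1) := by
  rw [wp_seq, wp_sub]

@[simp] theorem wp_seq_mul :
    (RamProg.instr (.mul i j l) ⨟ P).Wp ω Q s c ↔
      P.Wp ω Q (s.setReg i (s.reg j * s.reg l)) (c + 1) := by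
  rw [wp_seq, wp_mul]

@[simp] theorem wp_seq_div :
    (RamProg.instr (.div i j l) ⨟ P).Wp ω Q s c ↔
      s.reg l ≠ 0 ∧ P.Wp ω Q (s.setReg i (s.reg j / s.reg l)) (c + 1) := by
  rw [wp_seq, wp_div]

@[simp] theorem wp_seq_rand :
    (RamProg.instr (.rand i) ⨟ P).Wp ω Q s c ↔ P.Wp ω Q (s.draw i (ω s.coin)) (c + 1) := by
  rw [wp_seq, wp_rand]

@[simp] theorem wp_seq_load :
    (RamProg.instr (.load i j) ⨟ P).Wp ω Q s c ↔
      ∃ a : ℕ, s.reg j = a ∧ P.Wp ω Q (s.setReg i (s.mem a)) (c + 1) := by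
  rw [wp_seq, wp_load]

@[simp] theorem wp_seq_store :
    (RamProg.instr (.store i j) ⨟ P).Wp ω Q s c ↔
      ∃ a : ℕ, s.reg i = a ∧ P.Wp ω Q (s.setMem a (s.reg j)) (c + 1) := by
  rw [wp_seq, wp_store]

theorem wp_ite (h1 : s.reg i < s.reg j → P.Wp ω Q s (c + 1))
    (h2 : ¬ s.reg i < s.reg j → R.Wp ω Q s (c + 1)) : (RamProg.ite i j P R).Wp ω Q s c := by
  by_cases h : s.reg i < s.reg j
  · obtain ⟨s', t, h', hQ⟩ := h1 h
    exact ⟨s', _, .iteTrue h h', by rwa [add_assoc, add_comm 1 t] at hQ⟩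
  · obtain ⟨s', t, h', hQ⟩ := h2 h
    exact ⟨s', _, .iteFalse h h', by rwa [add_assoc, add_comm 1 t] at hQ⟩

/-- A loop that is run through `N` times, with an invariant that may refer to the time. -/
theorem wp_loop (Inv : ℕ → RamState → ℕ → Prop) (N : ℕ) (h0 : Inv 0 s c)
    (hstep : ∀ t < N, ∀ s c, Inv t s c →
      s.reg i < s.reg j ∧ P.Wp ω (Inv (t + 1)) s (c + 1))
    (hend : ∀ s c, Inv N s c → ¬ s.reg i < s.reg j ∧ Q s (c + 1)) :
    (RamProg.loop i j P).Wp ω Q s c := by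
  suffices H : ∀ r t s c, t + r = N → Inv t s c → (RamProg.loop i j P).Wp ω Q s c from
    H N 0 s c (by simp) h0
  intro r
  induction r with
  | zero =>
    intro t s c ht hI
    obtain rfl : t = N := by omega
    obtain ⟨h1, h2⟩ := hend s c hI
    exact ⟨s, 1, .loopFalse h1, h2⟩
  | succ r ih =>
    intro t s c ht hI
    obtain ⟨h1, s', t', h2, h3⟩ := hstep t (by omega) s c hI
    obtain ⟨s'', t'', h4, h5⟩ := ih (t + 1) s' _ (by omega) h3
    refine ⟨s'', _, .loopTrue h1 h2 h4, ?_⟩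
    convert h5 using 1
    ring

/-- The program does not draw random numbers. -/
def RandFree : RamProg → Prop
  | .instr (.rand _) => False
  | .instr _ => True
  | .seq P Q => P.RandFree ∧ Q.RandFree
  | .ite _ _ P Q => P.RandFree ∧ Q.RandFree
  | .loop _ _ P => P.RandFree

theorem Exec.of_randFree {ω ω' : ℕ → I} {P : RamProg} {s s' : RamState} {t : ℕ}
    (h : P.Exec ω s s' t) (hP : P.RandFree) : P.Exec ω' s s' t := by
  induction h with
  | instr h =>
    refine .instr ?_
    cases h with
    | rand => exact hP.elim
    | const => constructor
    | copy => constructor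
    | add => constructor
    | sub => constructor
    | mul => constructor
    | div _ _ _ _ h => exact .div _ _ _ _ h
    | load _ _ _ _ h => exact .load _ _ _ _ h
    | store _ _ _ _ h => exact .store _ _ _ _ h
  | seq _ _ ih ih' => exact .seq (ih hP.1) (ih' hP.2)
  | iteTrue hc _ ih => exact .iteTrue hc (ih hP.1)
  | iteFalse hc _ ih => exact .iteFalse hc (ih hP.2)
  | loopTrue hc _ _ ih ih' => exact .loopTrue hc (ih hP) (ih' hP)
  | loopFalse hc => exact .loopFalse hc

end RamProg

namespace RamProg

/-- Perform the instructions of a list, then run `P`. -/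
def after : List RamInstr → RamProg → RamProg
  | [], P => P
  | c :: cs, P => .instr c ⨟ after cs P

/-- Perform the instruction `c`, then those of a list. -/
def block : RamInstr → List RamInstr → RamProg
  | c, [] => .instr c
  | c, d :: ds => .instr c ⨟ block d ds

@[simp] theorem after_nil (P : RamProg) : after [] P = P := rfl

@[simp] theorem after_cons (c : RamInstr) (cs : List RamInstr) (P : RamProg) :
    after (c :: cs) P = .instr c ⨟ after cs P := rfl

@[simp] theorem block_nil (c : RamInstr) : block c [] = .instr c := rfl

@[simp] theorem block_cons (c d : RamInstr) (cs : List RamInstr) :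
    block c (d :: cs) = .instr c ⨟ block d cs := rfl

end RamProg

open RamProg

/-- The largest `q < N` with `f q ≤ u`, or `0` if there is none. -/
def pick (f : ℕ → ℝ) (N : ℕ) (u : ℝ) : ℕ :=
  open Classical in Nat.findGreatest (fun q => f q ≤ u) (N - 1)

theorem pick_lt {f : ℕ → ℝ} {N : ℕ} (hN : 1 ≤ N) (u : ℝ) : pick f N u < N := by
  classical
  have := Nat.findGreatest_le (P := fun q => f q ≤ u) (N - 1)
  unfold pick
  omega

theorem le_pick {f : ℕ → ℝ} {N q : ℕ} {u : ℝ} (hq : q < N) (h : f q ≤ u) : q ≤ pick f N u := by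
  classical
  exact Nat.le_findGreatest (by omega) h

theorem pick_spec {f : ℕ → ℝ} {N : ℕ} {u : ℝ} (h : pick f N u ≠ 0) : f (pick f N u) ≤ u := by
  classical
  exact Nat.findGreatest_of_ne_zero (P := fun q => f q ≤ u) (n := N - 1) rfl h

theorem pick_lt_of_lt {f : ℕ → ℝ} {N q : ℕ} {u : ℝ} (hf : ∀ x y, x ≤ y → y < N → f x ≤ f y)
    (hN : 1 ≤ N) (hq : 1 ≤ q) (h : q < N → u < f q) : pick f N u < q := by
  by_contra! hle
  have h1 := pick_lt (f := f) hN u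
  have h2 := pick_spec (f := f) (N := N) (u := u) (by omega)
  have h3 := hf _ _ hle h1
  linarith [h (by omega)]

/-- Binary search: register `30` holds an address, `31` a stride, `32` the number of candidates,
`33` a scale and `20` a value. The result is placed in register `34`; the value that belongs to it
is subtracted from register `20`. -/
def selectProg : RamProg :=
  after [.load 38 30, .const 34 0, .const 35 1] (
    .loop 35 32 (.instr (.add 35 35 35)) ⨟
    .instr (.const 39 2) ⨟
    .loop 9 35 (
      after [.div 35 35 39, .add 36 34 35] (
        .ite 36 32
          (after [.mul 37 31 36, .add 37 30 37, .load 37 37, .sub 37 38 37, .mul 37 33 37]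
            (.ite 20 37 (.instr (.const 37 0)) (.instr (.copy 34 36))))
          (.instr (.const 37 0)))) ⨟
    block (.mul 37 31 34) [.add 37 30 37, .load 37 37, .sub 37 38 37, .mul 37 33 37,
      .sub 20 20 37])

theorem wp_selectProg {ω : ℕ → I} {Q : RamState → ℕ → Prop} {s : RamState} {c : ℕ}
    {base st N : ℕ} (sc : ℝ) (h9 : s.reg 9 = 1) (h30 : s.reg 30 = base) (h31 : s.reg 31 = st)
    (h32 : s.reg 32 = N) (h33 : s.reg 33 = sc) {u : ℝ}
    (h20 : s.reg 20 = u) (hN : 1 ≤ N)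
    (f : ℕ → ℝ) (hf : ∀ q < N, sc * (s.mem base - s.mem (base + st * q)) = f q)
    (hmono : ∀ x y, x ≤ y → y < N → f x ≤ f y)
    (hQ : ∀ (s' : RamState) c', (∀ r < 34, r ≠ 20 → s'.reg r = s.reg r) → s'.mem = s.mem → s'.coin = s.coin →
      s'.reg 34 = pick f N u →
      s'.reg 20 = u - f (pick f N u) →
      c' ≤ c + 14 * (Nat.clog 2 N + 1) → Q s' c') :
    selectProg.Wp ω Q s c := by
  set E := Nat.clog 2 N with hE
  have hEN : N ≤ 2 ^ E := Nat.le_pow_clog (by norm_num) N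
  simp only [selectProg, after_cons, after_nil, wp_seq_load]
  refine ⟨base, h30, ?_⟩
  simp only [wp_seq_const, Nat.cast_zero, Nat.cast_one]
  rw [wp_seq]
  refine wp_loop (fun t s' c' => (∀ r < 34, s'.reg r = s.reg r) ∧ s'.mem = s.mem ∧
    s'.coin = s.coin ∧ s'.reg 34 = 0 ∧ s'.reg 35 = 2 ^ t ∧ s'.reg 38 = s.mem base ∧
    c' = c + 3 + 2 * t) E ?_ ?_ ?_
  · refine ⟨fun r hr => ?_, rfl, rfl, ?_, ?_, ?_, rfl⟩
    · simp (disch := omega) only [RamState.reg_setReg, if_neg]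
    all_goals simp
  · rintro t ht s' c' ⟨hr, hm, hc, r34, r35, r38, rfl⟩
    refine ⟨?_, ?_⟩
    · rw [hr 32 (by norm_num), r35, h32]
      have : 2 ^ t < N := by
        by_contra! hle
        have := (Nat.clog_le_iff_le_pow (by norm_num)).2 hle
        omega
      exact_mod_cast this
    · rw [wp_add]
      refine ⟨fun r hr' => ?_, hm, hc, ?_, ?_, ?_, by ring⟩
      · rw [← hr r hr']
        simp (disch := omega) only [RamState.reg_setReg, if_neg]
      · simp [r34]
      · simp [r35]; ring
      · simp [r38]
  · rintro s1 c1 ⟨hr, hm, hc, r34, r35, r38, rfl⟩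
    refine ⟨?_, ?_⟩
    · rw [hr 32 (by norm_num), r35, h32, not_lt]
      exact_mod_cast hEN
    rw [wp_seq_const, wp_seq]
    have hrd : ∀ (s' : RamState), (∀ r < 34, s'.reg r = s.reg r) → s'.mem = s.mem →
        s'.reg 38 = s.mem base → ∀ q : ℕ, q < N →
        s'.reg 33 * (s'.reg 38 - s'.mem (base + st * q)) = f q := by
      intro s' h1 h2 h3 q hq
      rw [h1 33 (by norm_num), h3, h2, h33, hf q hq]
    set p := pick f N u with hp
    refine wp_loop (fun t s' c' => (∀ r < 34, s'.reg r = s.reg r) ∧ s'.mem = s.mem ∧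
      s'.coin = s.coin ∧ s'.reg 35 = 2 ^ (E - t) ∧ s'.reg 38 = s.mem base ∧ s'.reg 39 = 2 ∧
      (∃ x : ℕ, s'.reg 34 = x ∧ x ≤ p ∧ p < x + 2 ^ (E - t)) ∧
      c' ≤ c + 5 + 2 * E + 11 * t) E ?_ ?_ ?_
    · refine ⟨fun r hr' => ?_, hm, hc, ?_, ?_, ?_, ⟨0, ?_, by omega, ?_⟩, by omega⟩
      · rw [← hr r hr']
        simp (disch := omega) only [RamState.reg_setReg, if_neg]
      · simp [r35]
      · simp [r38]
      · simp
      · simp [r34]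
      · have := pick_lt (f := f) hN u
        rw [← hp] at this
        simp
        omega
    · rintro t ht s' c' ⟨hr, hm, hc, r35, r38, r39, ⟨x, r34, hx1, hx2⟩, hc'⟩
      obtain ⟨e, he⟩ : ∃ e, E - t = e + 1 := ⟨E - t - 1, by omega⟩
      have he' : E - (t + 1) = e := by omega
      rw [he] at r35 hx2
      rw [he']
      refine ⟨?_, ?_⟩
      · rw [hr 9 (by norm_num), h9, r35]
        exact_mod_cast Nat.one_lt_two_pow (by omega)
      simp only [wp_seq_div, wp_seq_add]
      refine ⟨by rw [r39]; norm_num, ?_⟩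
      have hq : (2 : ℝ) ^ (e + 1) / 2 = 2 ^ e := by rw [pow_succ]; field_simp
      simp only [RamState.reg_setReg, Nat.reduceEqDiff, if_false, if_true, r35, r39, r34, hq]
      refine wp_ite ?_ ?_
      · intro hlt
        have hlt : x + 2 ^ e < N := by
          simp [hr 32, h32] at hlt
          exact_mod_cast hlt
        simp only [wp_seq_mul, wp_seq_add, wp_seq_load]
        refine ⟨base + st * (x + 2 ^ e), ?_, ?_⟩
        · simp [hr 30, hr 31, h30, h31]
        simp only [wp_seq_mul, wp_seq_sub]
        have hv := hrd s' hr hm r38 _ hlt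
        simp only [RamState.reg_setReg, Nat.reduceEqDiff, if_false, if_true, RamState.mem_setReg, hv]
        refine wp_ite ?_ ?_
        · intro hu
          have hu : u < f (x + 2 ^ e) := by simpa [hr 20, h20] using hu
          rw [wp_const]
          refine ⟨fun r hr' => ?_, hm, hc, ?_, ?_, ?_, ⟨x, ?_, hx1, ?_⟩, by omega⟩
          · rw [← hr r hr']
            simp (disch := omega) only [RamState.reg_setReg, if_neg]
          · simp
          · simp [r38]
          · simp [r39]
          · simp [r34]
          · exact pick_lt_of_lt hmono hN (by have := Nat.one_le_two_pow (n := e); omega)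
              (fun _ => hu)
        · intro hu
          have hu : f (x + 2 ^ e) ≤ u := by simpa [hr 20, h20] using hu
          rw [wp_copy]
          refine ⟨fun r hr' => ?_, hm, hc, ?_, ?_, ?_, ⟨x + 2 ^ e, ?_, ?_, ?_⟩, by omega⟩
          · rw [← hr r hr']
            simp (disch := omega) only [RamState.reg_setReg, if_neg]
          · simp
          · simp [r38]
          · simp [r39]
          · simp
          · exact le_pick hlt hu
          · rw [pow_succ] at hx2
            omega
      · intro hlt
        have hlt : N ≤ x + 2 ^ e := by
          simp [hr 32, h32] at hlt
          exact_mod_cast hlt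
        rw [wp_const]
        refine ⟨fun r hr' => ?_, hm, hc, ?_, ?_, ?_, ⟨x, ?_, hx1, ?_⟩, by omega⟩
        · rw [← hr r hr']
          simp (disch := omega) only [RamState.reg_setReg, if_neg]
        · simp
        · simp [r38]
        · simp [r39]
        · simp [r34]
        · have := pick_lt (f := f) hN u
          omega
    · rintro s' c' ⟨hr, hm, hc, r35, r38, r39, ⟨x, r34, hx1, hx2⟩, hc'⟩
      obtain rfl : x = p := by simp at hx2; omega
      refine ⟨?_, ?_⟩
      · rw [hr 9 (by norm_num), h9, r35]
        simp
      simp only [block_cons, block_nil, wp_seq_mul, wp_seq_add, wp_seq_load]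
      refine ⟨base + st * p, ?_, ?_⟩
      · simp [hr 30, hr 31, h30, h31, r34]
      have hv := hrd s' hr hm r38 p (pick_lt hN _)
      simp only [wp_seq_sub, wp_seq_mul, wp_sub, RamState.reg_setReg, Nat.reduceEqDiff, if_false,
        if_true, RamState.mem_setReg, hv]
      refine hQ _ _ (fun r hr' h20 => ?_) hm hc ?_ ?_ (by omega)
      · rw [← hr r hr']
        simp (disch := omega) only [RamState.reg_setReg, if_neg]
      · simp [r34]
      · simp [hr 20, h20]

/-! ### Random walks -/

section Walk

variable (n : ℕ → ℕ) (a : ℕ → ℕ → ℕ → ℝ)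

/-- The sum of the absolute values of the weights of all paths of length `r` that start at the
vertex `i` of the layer `l`. -/
def pathWeight : ℕ → ℕ → ℕ → ℝ
  | 0, _, _ => 1
  | r + 1, l, i => ∑ j ∈ Finset.range (n (l + 1)), |a l i j| * pathWeight r (l + 1) j

/-- The part of `pathWeight n a (r + 1) l i` that belongs to the first `q` vertices of the next
layer. -/
def partialWeight (r l i q : ℕ) : ℝ :=
  ∑ j ∈ Finset.range q, |a l i j| * pathWeight n a r (l + 1) j

/-- The weight of all paths of length `r` that start at one of the first `q` vertices of the first
layer. -/
def startWeight (r q : ℕ) : ℝ := ∑ i ∈ Finset.range q, pathWeight n a r 0 i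

/-- The walk of length `r` that starts at the vertex `i` of the layer `l`, scaled by `α` and steered
by `u`: its last vertex, and the signed weight of its path. -/
def walk : ℕ → ℕ → ℕ → ℝ → ℝ → ℕ × ℝ
  | 0, _, i, α, _ => (i, α)
  | r + 1, l, i, α, u =>
    walk r (l + 1) (pick (fun q => |α| * partialWeight n a r l i q) (n (l + 1)) u)
      (α * a l i (pick (fun q => |α| * partialWeight n a r l i q) (n (l + 1)) u))
      (u - |α| * partialWeight n a r l i
        (pick (fun q => |α| * partialWeight n a r l i q) (n (l + 1)) u))

/-- A walk through all layers that is steered by `u`: first vertex, last vertex, signed weight. -/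
def sample (k : ℕ) (u : ℝ) : ℕ × ℕ × ℝ :=
  (pick (startWeight n a k) (n 0) u,
    walk n a k 0 (pick (startWeight n a k) (n 0) u) 1
      (u - startWeight n a k (pick (startWeight n a k) (n 0) u)))

variable {n a}

theorem pathWeight_nonneg (r l i : ℕ) : 0 ≤ pathWeight n a r l i := by
  induction r generalizing l i with
  | zero => simp [pathWeight]
  | succ r ih => exact Finset.sum_nonneg fun j _ => mul_nonneg (abs_nonneg _) (ih _ _)

theorem partialWeight_mono (r l i : ℕ) : Monotone (partialWeight n a r l i) := by
  intro x y h
  exact Finset.sum_le_sum_of_subset_of_nonneg (Finset.range_mono h)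
    fun j _ _ => mul_nonneg (abs_nonneg _) (pathWeight_nonneg _ _ _)

theorem startWeight_mono (r : ℕ) : Monotone (startWeight n a r) := by
  intro x y h
  exact Finset.sum_le_sum_of_subset_of_nonneg (Finset.range_mono h)
    fun j _ _ => pathWeight_nonneg _ _ _

theorem walk_fst_lt (r l i : ℕ) (α u : ℝ) (hn : ∀ x, l ≤ x → x ≤ l + r → 1 ≤ n x) (hi : i < n l) :
    (walk n a r l i α u).1 < n (l + r) := by
  induction r generalizing l i α u with
  | zero => simpa [walk]
  | succ r ih =>
    rw [walk, show l + (r + 1) = l + 1 + r by ring]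
    exact ih _ _ _ _ (fun x h1 h2 => hn x (by omega) (by omega))
      (pick_lt (hn _ (by omega) (by omega)) _)

end Walk

/-! ### The memory after the preprocessing -/

theorem inputSize_succ (n : ℕ → ℕ) (l : ℕ) :
    inputSize n (l + 1) = inputSize n l + n l * n (l + 1) :=
  Finset.sum_range_succ _ _

theorem inputSize_mono (n : ℕ → ℕ) : Monotone (inputSize n) :=
  monotone_nat_of_le_succ fun l => by rw [inputSize_succ]; omega

theorem inputSize_add_le {n : ℕ → ℕ} {k l i q : ℕ} (hl : l < k) (hi : i < n l)
    (hq : q ≤ n (l + 1)) : inputSize n l + i * n (l + 1) + q ≤ inputSize n k := by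
  have h1 := inputSize_mono n (show l + 1 ≤ k from hl)
  rw [inputSize_succ] at h1
  have h2 : (i + 1) * n (l + 1) ≤ n l * n (l + 1) := Nat.mul_le_mul_right _ hi
  rw [add_mul] at h2
  omega

/-- The cells `1, …, k` hold the dimensions, the matrices are in the same place as in the input, and
the following block of memory holds numbers whose differences are the partial sums of the weights
of paths. -/
structure Layout (n : ℕ → ℕ) (a : ℕ → ℕ → ℕ → ℝ) (k : ℕ) (mem : ℕ → ℝ) : Prop where
  dim : ∀ l, 1 ≤ l → l ≤ k → mem l = n l
  entry : ∀ l < k, ∀ i < n l, ∀ j < n (l + 1),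
    mem (k + 1 + (inputSize n l + i * n (l + 1) + j)) = a l i j
  sums : ∀ l < k, ∀ i < n l, ∀ q ≤ n (l + 1),
    mem (k + 1 + inputSize n k + (inputSize n l + i * n (l + 1))) -
      mem (k + 1 + inputSize n k + (inputSize n l + i * n (l + 1) + q)) =
        partialWeight n a (k - (l + 1)) l i q
  start : ∀ q ≤ n 0,
    mem (k + 1 + inputSize n k) - mem (k + 1 + inputSize n k + n 1 * q) = startWeight n a k q

theorem Layout.congr {n : ℕ → ℕ} {a : ℕ → ℕ → ℕ → ℝ} {k : ℕ} {m m' : ℕ → ℝ}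
    (h : Layout n a k m) (hk : 1 ≤ k)
    (hm : ∀ x ≤ k + 1 + inputSize n k + inputSize n k, m' x = m x) : Layout n a k m' where
  dim l h1 h2 := by rw [hm _ (by omega), h.dim l h1 h2]
  entry l hl i hi j hj := by
    have := inputSize_add_le (k := k) hl hi hj.le
    rw [hm _ (by omega), h.entry l hl i hi j hj]
  sums l hl i hi q hq := by
    have := inputSize_add_le (k := k) hl hi hq
    rw [hm _ (by omega), hm _ (by omega), h.sums l hl i hi q hq]
  start q hq := by
    have h1 := inputSize_mono n hk
    rw [inputSize_succ] at h1
    have : n 1 * q ≤ n 0 * n (0 + 1) := by rw [mul_comm]; exact Nat.mul_le_mul_right _ hq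
    rw [hm _ (by omega), hm _ (by omega), h.start q hq]

/-! ### Drawing a sample -/

/-- Replace register `i` by the absolute value of register `j`; register `z` holds `0`. -/
def absProg (z i j : ℕ) : RamProg :=
  .ite j z (.instr (.sub i z j)) (.instr (.copy i j))

theorem wp_absProg {ω : ℕ → I} {Q : RamState → ℕ → Prop} {s : RamState} {c z i j : ℕ}
    (hz : s.reg z = 0) (hQ : Q (s.setReg i |s.reg j|) (c + 2)) : (absProg z i j).Wp ω Q s c := by
  refine wp_ite (fun h => ?_) (fun h => ?_)
  · rw [wp_sub, hz, zero_sub, ← abs_of_neg (by rwa [hz] at h)]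
    exact hQ
  · rw [hz, not_lt] at h
    rw [wp_copy]
    rwa [abs_of_nonneg h] at hQ

/-- Draw a random walk. Registers: `4` holds the number of matrices, `5` the first dimension, `8`
the total weight, `9` the number `1`, `17` the number `0`, `18` and `19` the addresses of the
matrices and of the sums. The result is placed in the registers `26`, `25` and `21`. -/
def sampleProg : RamProg :=
  after [.rand 20, .mul 20 20 8, .copy 30 19, .load 31 9, .copy 32 5, .copy 33 9] (
    selectProg ⨟
    after [.copy 25 34, .copy 26 34, .copy 21 9, .const 22 0, .const 23 0, .copy 24 5] (
      .loop 22 4 (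
        after [.add 28 22 9, .load 27 28, .mul 28 25 27, .add 28 23 28, .add 30 19 28, .copy 31 9,
          .copy 32 27] (
          absProg 17 33 21 ⨟
          selectProg ⨟
          block (.add 37 18 28) [.add 37 37 34, .load 37 37, .mul 21 21 37, .mul 37 24 27,
            .add 23 23 37, .copy 24 27, .copy 25 34, .add 22 22 9]))))

theorem wp_sampleProg {n : ℕ → ℕ} {a : ℕ → ℕ → ℕ → ℝ} {k B : ℕ} {ω : ℕ → I}
    {Q : RamState → ℕ → Prop} {s : RamState} {c : ℕ} {u : ℝ} (hk : 1 ≤ k) (hn : ∀ l ≤ k, 1 ≤ n l)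
    (hB : ∀ l ≤ k, Nat.clog 2 (n l) ≤ B)
    (hs : Layout n a k s.mem) (h4 : s.reg 4 = k) (h5 : s.reg 5 = n 0) (h9 : s.reg 9 = 1)
    (h17 : s.reg 17 = 0) (h18 : s.reg 18 = (k + 1 : ℕ))
    (h19 : s.reg 19 = (k + 1 + inputSize n k : ℕ)) (hu : ω s.coin * s.reg 8 = u)
    (hQ : ∀ (s' : RamState) c', (∀ r < 20, s'.reg r = s.reg r) → s'.mem = s.mem → s'.coin = s.coin + 1 →
      s'.reg 26 = (sample n a k u).1 →
      s'.reg 25 = (sample n a k u).2.1 →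
      s'.reg 21 = (sample n a k u).2.2 → c' ≤ c + 40 * ((k + 1) * (B + 1)) → Q s' c') :
    sampleProg.Wp ω Q s c := by
  simp only [sampleProg, after, wp_seq_rand, wp_seq_mul, wp_seq_copy, wp_seq_load]
  refine ⟨1, by simp [h9], ?_⟩
  rw [wp_seq]
  set p := pick (startWeight n a k) (n 0) u with hp
  have hpn : p < n 0 := pick_lt (hn 0 (by omega)) _
  refine wp_selectProg (base := k + 1 + inputSize n k) (st := n 1) (N := n 0) (u := u) 1
    ?_ ?_ ?_ ?_ ?_ ?_ (hn 0 (by omega)) (startWeight n a k) ?_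
    (fun x y h _ => startWeight_mono k h) ?_
  · simp [h9]
  · simp [h19]
  · simp [hs.dim 1 le_rfl hk]
  · simp [h5]
  · simp [h9]
  · simp [hu]
  · intro q hq
    simpa using hs.start q hq.le
  intro s1 c1 hr hm hc r34 r20 hc1
  replace hr : ∀ r < 20, s1.reg r = s.reg r := fun r h => by
    rw [hr r (by omega) (by omega)]
    simp (disch := omega) only [RamState.reg_setReg, RamState.reg_draw, if_neg]
  replace hm : s1.mem = s.mem := hm
  replace hc : s1.coin = s.coin + 1 := hc
  have hB0 := hB 0 (by omega)
  simp only [after, wp_seq_copy, wp_seq_const]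
  set w := sample n a k u with hw
  refine wp_loop (fun t s' c' => (∀ r < 20, s'.reg r = s.reg r) ∧ s'.mem = s.mem ∧
    s'.coin = s.coin + 1 ∧ s'.reg 22 = t ∧ s'.reg 23 = inputSize n t ∧ s'.reg 24 = n t ∧
    s'.reg 26 = w.1 ∧ (∃ i : ℕ, i < n t ∧ s'.reg 25 = i ∧
      walk n a (k - t) t i (s'.reg 21) (s'.reg 20) = w.2) ∧
    c' ≤ c + 12 + 14 * (B + 1) + t * (19 + 14 * (B + 1))) k ?_ ?_ ?_
  · refine ⟨fun r h => ?_, hm, hc, ?_, ?_, ?_, ?_, ⟨p, hpn, ?_, ?_⟩, ?_⟩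
    · rw [← hr r h]
      simp (disch := omega) only [RamState.reg_setReg, if_neg]
    · simp
    · simp [inputSize]
    · simp [hr 5, h5]
    · simp [r34, hw, sample, hp]
    · simp [r34, hp]
    · simp [r20, hw, sample, hp, hr 9, h9]
    · omega
  · rintro t ht s2 c2 ⟨hr, hm, hc, r22, r23, r24, r26, ⟨i, hi, r25, hwalk⟩, hc2⟩
    refine ⟨by rw [r22, hr 4 (by norm_num), h4]; exact_mod_cast ht, ?_⟩
    simp only [after, wp_seq_add, wp_seq_load, RamState.reg_setReg, Nat.reduceEqDiff, if_false,
      if_true, r22, hr 9, h9, Nat.reduceLT]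
    refine ⟨t + 1, by push_cast; ring, ?_⟩
    rw [RamState.mem_setReg, hm, hs.dim (t + 1) (by omega) (by omega)]
    simp only [wp_seq_add, wp_seq_mul, wp_seq_copy, RamState.reg_setReg, Nat.reduceEqDiff,
      if_false, if_true, r22, hr 9, h9, Nat.reduceLT, r25, r23, hr 19, h19]
    rw [wp_seq]
    refine wp_absProg (by simp [hr 17, h17]) ?_
    rw [wp_seq]
    obtain ⟨r, hkr⟩ : ∃ r, k - t = r + 1 := ⟨k - t - 1, by omega⟩
    have hkr' : k - (t + 1) = r := by omega
    have hn1 := hn (t + 1) (by omega)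
    rw [hkr, walk] at hwalk
    set α := s2.reg 21 with hα
    set q := pick (fun q => |α| * partialWeight n a r t i q) (n (t + 1)) (s2.reg 20) with hq
    have hqn : q < n (t + 1) := pick_lt hn1 _
    refine wp_selectProg (base := k + 1 + inputSize n k + (inputSize n t + i * n (t + 1)))
      (st := 1) (N := n (t + 1)) (u := s2.reg 20) |α| ?_ ?_ ?_ ?_ ?_ ?_ hn1
      (fun q => |α| * partialWeight n a r t i q) ?_
      (fun x y h _ => mul_le_mul_of_nonneg_left (partialWeight_mono _ _ _ h) (abs_nonneg _)) ?_
    · simp [hr 9, h9]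
    · simp
    · simp
    · simp
    · simp [hα]
    · simp
    · intro x hx
      have := hs.sums t ht i hi x hx.le
      rw [hkr'] at this
      simp only [RamState.mem_setReg, hm, one_mul]
      rw [← this, add_assoc _ _ x]
    intro s3 c3 hr3 hm3 hc3 r34 r20 hc3'
    have hB1 := hB (t + 1) (by omega)
    have e21 : s3.reg 21 = α := by
      rw [hr3 21 (by norm_num) (by norm_num)]; simp [hα]
    have e22 : s3.reg 22 = t := by
      rw [hr3 22 (by norm_num) (by norm_num)]; simp [r22]
    have e23 : s3.reg 23 = inputSize n t := by
      rw [hr3 23 (by norm_num) (by norm_num)]; simp [r23]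
    have e24 : s3.reg 24 = n t := by
      rw [hr3 24 (by norm_num) (by norm_num)]; simp [r24]
    have e26 : s3.reg 26 = w.1 := by
      rw [hr3 26 (by norm_num) (by norm_num)]; simp [r26]
    have e27 : s3.reg 27 = n (t + 1) := by
      rw [hr3 27 (by norm_num) (by norm_num)]; simp
    have e28 : s3.reg 28 = (inputSize n t + i * n (t + 1) : ℕ) := by
      rw [hr3 28 (by norm_num) (by norm_num)]; simp
    replace hr3 : ∀ r < 20, s3.reg r = s.reg r := fun r h => by
      rw [hr3 r (by omega) (by omega), ← hr r h]
      simp (disch := omega) only [RamState.reg_setReg, if_neg]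
    replace hm3 : s3.mem = s.mem := hm3.trans hm
    replace hc3 : s3.coin = s.coin + 1 := hc3.trans hc
    simp only [block, wp_seq_add, wp_seq_load, RamState.reg_setReg, Nat.reduceEqDiff, if_false,
      if_true, e28, r34, hr3 18, h18, Nat.reduceLT]
    refine ⟨k + 1 + (inputSize n t + i * n (t + 1) + q), by push_cast; ring, ?_⟩
    simp only [wp_add, wp_seq_add, wp_seq_mul, wp_seq_copy, RamState.reg_setReg, Nat.reduceEqDiff,
      if_false, if_true, RamState.mem_setReg, hm3, hs.entry t ht i hi q hqn]
    refine ⟨fun r h => ?_, trivial, hc3, ?_, ?_, ?_, ?_, ⟨q, hqn, ?_, ?_⟩, ?_⟩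
    · rw [← hr3 r h]
      simp (disch := omega) only [RamState.reg_setReg, if_neg]
    · simp [e22, hr3 9, h9]
    · simp [e23, e24, e27, inputSize_succ]
    · simp [e27]
    · simp [e26]
    · simp [r34, hq]
    · rw [hkr']
      simpa [e21, r20] using hwalk
    · rw [add_mul]
      omega
  · rintro s2 c2 ⟨hr, hm, hc, r22, r23, r24, r26, ⟨i, hi, r25, hwalk⟩, hc2⟩
    refine ⟨by rw [r22, hr 4 (by norm_num), h4]; exact lt_irrefl _, ?_⟩
    rw [Nat.sub_self, walk] at hwalk
    refine hQ _ _ hr hm hc r26 ?_ ?_ ?_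
    · rw [r25, ← hwalk]
    · rw [← hwalk]
    · nlinarith [Nat.zero_le (k * B)]

/-! ### Averaging samples -/

section Tally

/-- The indicator of the samples that belong to the entry number `y` of a matrix with `c`
columns. -/
def hit (c y : ℕ) (w : ℕ × ℕ × ℝ) : ℝ := if w.1 * c + w.2.1 = y then 1 else 0

/-- The indicator with the sign of the weight of the path. -/
def signedHit (c y : ℕ) (w : ℕ × ℕ × ℝ) : ℝ :=
  if w.1 * c + w.2.1 = y then if w.2.2 < 0 then -1 else 1 else 0

/-- The largest number of samples, among the first `t` ones, that belong to one entry. -/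
def maxTally (c : ℕ) (x : ℕ → ℕ × ℕ × ℝ) : ℕ → ℝ
  | 0 => 0
  | t + 1 => max (maxTally c x t)
      (∑ t' ∈ Finset.range (t + 1), hit c ((x t).1 * c + (x t).2.1) (x t'))

end Tally

/-- Add the content of register `15`, with the sign of register `21`, to register `38`. -/
def addSignedProg : RamProg := .ite 21 17 (.instr (.sub 38 38 15)) (.instr (.add 38 38 15))

theorem wp_addSignedProg {ω : ℕ → I} {Q : RamState → ℕ → Prop} {s : RamState} {c : ℕ}
    (h17 : s.reg 17 = 0)
    (hQ : Q (s.setReg 38 (s.reg 38 + s.reg 15 * if s.reg 21 < 0 then -1 else 1)) (c + 2)) :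
    addSignedProg.Wp ω Q s c := by
  refine wp_ite (fun h => ?_) (fun h => ?_) <;> rw [h17] at h
  · rw [wp_sub]
    rwa [if_pos h, mul_neg_one, ← sub_eq_add_neg] at hQ
  · rw [wp_add]
    rwa [if_neg h, mul_one] at hQ

/-- Replace register `i` by the maximum of the registers `i` and `j`. -/
def maxRegProg (i j : ℕ) : RamProg := .ite i j (.instr (.copy i j)) (.instr (.copy i i))

theorem wp_maxRegProg {ω : ℕ → I} {Q : RamState → ℕ → Prop} {s : RamState} {c i j : ℕ}
    (hQ : Q (s.setReg i (max (s.reg i) (s.reg j))) (c + 2)) : (maxRegProg i j).Wp ω Q s c := by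
  refine wp_ite (fun h => ?_) (fun h => ?_)
  · rw [wp_copy]
    rwa [max_eq_right h.le] at hQ
  · rw [wp_copy]
    rwa [max_eq_left (not_lt.1 h)] at hQ

/-- Draw `⌈16 b W L / ε²⌉` samples and average them. Registers: `0` holds `ε`, `2` the bound `b`,
`4` to `9` and `17` to `19` as for `sampleProg`, `7` the last dimension, `10` the address of the
output, `11` the number of its entries, `12` the number `L`. The number of samples is placed in
register `14`, the maximum of the numbers of samples per entry in register `3`. -/
def averageProg : RamProg :=
  after [.const 13 16, .mul 13 13 2, .mul 13 13 8, .mul 13 13 12, .mul 14 0 0, .div 13 13 14,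
    .const 14 0] (
    .loop 14 13 (.instr (.add 14 14 9)) ⨟
    after [.div 15 8 14, .const 16 0, .const 3 0] (
      .loop 16 14 (
        sampleProg ⨟
        after [.mul 37 26 7, .add 37 37 25, .add 37 37 10, .load 38 37] (
          addSignedProg ⨟
          after [.store 37 38, .add 37 37 11, .load 38 37, .add 38 38 9, .store 37 38] (
            maxRegProg 3 38 ⨟
            .instr (.add 16 16 9))))))

/-- The registers hold the parameters of the input, as expected by `sampleProg` and
`averageProg`. -/
structure Params (n : ℕ → ℕ) (k : ℕ) (ε W : ℝ) (s : RamState) : Prop where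
  r0 : s.reg 0 = ε
  r4 : s.reg 4 = k
  r5 : s.reg 5 = n 0
  r7 : s.reg 7 = n k
  r8 : s.reg 8 = W
  r9 : s.reg 9 = 1
  r17 : s.reg 17 = 0
  r18 : s.reg 18 = (k + 1 : ℕ)
  r19 : s.reg 19 = (k + 1 + inputSize n k : ℕ)

theorem Params.congr {n : ℕ → ℕ} {k : ℕ} {ε W : ℝ} {s s' : RamState} (h : Params n k ε W s)
    (hs : ∀ r, r = 0 ∨ (4 ≤ r ∧ r ≤ 9) ∨ (17 ≤ r ∧ r ≤ 19) → s'.reg r = s.reg r) :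
    Params n k ε W s' where
  r0 := by rw [hs 0 (by norm_num), h.r0]
  r4 := by rw [hs 4 (by norm_num), h.r4]
  r5 := by rw [hs 5 (by norm_num), h.r5]
  r7 := by rw [hs 7 (by norm_num), h.r7]
  r8 := by rw [hs 8 (by norm_num), h.r8]
  r9 := by rw [hs 9 (by norm_num), h.r9]
  r17 := by rw [hs 17 (by norm_num), h.r17]
  r18 := by rw [hs 18 (by norm_num), h.r18]
  r19 := by rw [hs 19 (by norm_num), h.r19]

theorem sample_bounds {n : ℕ → ℕ} {a : ℕ → ℕ → ℕ → ℝ} {k : ℕ} (hn : ∀ l ≤ k, 1 ≤ n l) (u : ℝ) :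
    (sample n a k u).1 < n 0 ∧ (sample n a k u).2.1 < n k := by
  have h0 := pick_lt (f := startWeight n a k) (hn 0 (by omega)) u
  have h1 := walk_fst_lt (a := a) k 0 (pick (startWeight n a k) (n 0) u) 1
      (u - startWeight n a k (pick (startWeight n a k) (n 0) u))
      (fun x _ h => hn x (by omega)) h0
  rw [zero_add] at h1
  exact ⟨h0, h1⟩

theorem index_lt {i j r c : ℕ} (hi : i < r) (hj : j < c) : i * c + j < r * c := by
  have : (i + 1) * c ≤ r * c := Nat.mul_le_mul_right _ hi
  rw [add_mul] at this
  omega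

theorem wp_averageProg {n : ℕ → ℕ} {a : ℕ → ℕ → ℕ → ℝ} {k B : ℕ} {ω : ℕ → I}
    {Q : RamState → ℕ → Prop} {s : RamState} {c : ℕ} {ε W b : ℝ} {L Z m : ℕ}
    (hk : 1 ≤ k) (hn : ∀ l ≤ k, 1 ≤ n l)
    (hB : ∀ l ≤ k, Nat.clog 2 (n l) ≤ B)
    (hs : Layout n a k s.mem) (hp : Params n k ε W s) (h2 : s.reg 2 = b) (h12 : s.reg 12 = L)
    (h10 : s.reg 10 = Z) (h11 : s.reg 11 = (n 0 * n k : ℕ)) (hε : ε ≠ 0)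
    (hZ : k + 1 + inputSize n k + inputSize n k < Z)
    (hzero : ∀ y < 2 * (n 0 * n k), s.mem (Z + y) = 0)
    (hm : m = ⌈16 * b * W * L / (ε * ε)⌉₊) (hm0 : 1 ≤ m)
    {x : ℕ → ℕ × ℕ × ℝ} (hx : ∀ t, x t = sample n a k (ω (s.coin + t) * W))
    (hQ : ∀ (s' : RamState) c', (∀ r < 20, r ≠ 3 → (r < 13 ∨ 16 < r) → s'.reg r = s.reg r) →
      (∀ y, y < Z ∨ Z + 2 * (n 0 * n k) ≤ y → s'.mem y = s.mem y) →
      (∀ y < n 0 * n k, s'.mem (Z + y) = W / m * ∑ t ∈ Finset.range m, signedHit (n k) y (x t)) →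
      s'.coin = s.coin + m → s'.reg 3 = maxTally (n k) x m → s'.reg 14 = m →
      c' ≤ c + 60 * ((m + 1) * ((k + 1) * (B + 1))) → Q s' c') :
    averageProg.Wp ω Q s c := by
  set d := n 0 * n k with hd
  set M := 16 * b * W * L / (ε * ε) with hM
  simp only [averageProg, after, wp_seq_const, wp_seq_mul, wp_seq_div]
  refine ⟨by simp [hp.r0, hε], ?_⟩
  rw [wp_seq]
  refine wp_loop (fun t s' c' => (∀ r < 20, r ≠ 3 → (r < 13 ∨ 16 < r) → s'.reg r = s.reg r) ∧
    s'.mem = s.mem ∧ s'.coin = s.coin ∧ s'.reg 13 = M ∧ s'.reg 14 = t ∧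
    c' = c + 7 + 2 * t) m ?_ ?_ ?_
  · refine ⟨fun r h h3 h' => ?_, rfl, rfl, ?_, ?_, rfl⟩
    · simp (disch := omega) only [RamState.reg_setReg, if_neg]
    · simp [h2, hp.r0, hp.r8, h12, hM]
    · simp
  · rintro t ht s1 c1 ⟨hr, hmem, hc, r13, r14, rfl⟩
    refine ⟨?_, ?_⟩
    · rw [r13, r14]
      rw [hm] at ht
      exact Nat.lt_ceil.1 ht
    · rw [wp_add]
      refine ⟨fun r h h3 h' => ?_, hmem, hc, ?_, ?_, by ring⟩
      · rw [← hr r h h3 h']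
        simp (disch := omega) only [RamState.reg_setReg, if_neg]
      · simp [r13]
      · simp [r14, hr 9, hp.r9]
  rintro s1 c1 ⟨hr, hmem, hc, r13, r14, rfl⟩
  refine ⟨?_, ?_⟩
  · rw [r13, r14, not_lt, hm]
    exact Nat.le_ceil M
  simp only [after, wp_seq_const, wp_seq_div, wp_seq_copy]
  refine ⟨by rw [r14]; positivity, ?_⟩
  set v := W / m with hv
  refine wp_loop (fun t s' c' => (∀ r < 20, r ≠ 3 → (r < 13 ∨ 16 < r) → s'.reg r = s.reg r) ∧
    (∀ y, y < Z ∨ Z + 2 * d ≤ y → s'.mem y = s.mem y) ∧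
    (∀ y < d, s'.mem (Z + y) = v * ∑ t' ∈ Finset.range t, signedHit (n k) y (x t')) ∧
    (∀ y < d, s'.mem (Z + d + y) = ∑ t' ∈ Finset.range t, hit (n k) y (x t')) ∧
    s'.coin = s.coin + t ∧ s'.reg 3 = maxTally (n k) x t ∧ s'.reg 14 = m ∧ s'.reg 15 = v ∧
    s'.reg 16 = t ∧
    c' ≤ c + 11 + 2 * m + t * (16 + 40 * ((k + 1) * (B + 1)))) m ?_ ?_ ?_
  · refine ⟨fun r h h3 h' => ?_, ?_, ?_, ?_, hc, ?_, ?_, ?_, ?_, ?_⟩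
    · rw [← hr r h h3 h']
      simp (disch := omega) only [RamState.reg_setReg, if_neg]
    · intro y _
      simp [hmem]
    · intro y hy
      simpa [hmem] using hzero y (by omega)
    · intro y hy
      simpa [hmem, add_assoc] using hzero (d + y) (by omega)
    · simp [maxTally]
    · simp [r14]
    · simp [r14, hr 8, hp.r8, hv]
    · simp
    · omega
  · rintro t ht s2 c2 ⟨hr, hout, hsgn, hcnt, hc, r3, r14, r15, r16, hc2⟩
    refine ⟨by rw [r16, r14]; exact_mod_cast ht, ?_⟩
    rw [wp_seq]
    have hp2 := hp.congr fun r h => hr r (by omega) (by omega) (by omega)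
    have hxb := sample_bounds (a := a) hn (ω (s.coin + t) * W)
    rw [← hx t] at hxb
    refine wp_sampleProg (u := ω (s.coin + t) * W) hk hn hB
      (hs.congr hk fun y hy => hout y (by omega)) hp2.r4 hp2.r5 hp2.r9 hp2.r17 hp2.r18 hp2.r19
      (by rw [hp2.r8, hc]) ?_
    rw [← hx t]
    intro s3 c3 hr3 hm3 hc3 e26 e25 e21 hc3'
    set y0 := (x t).1 * n k + (x t).2.1 with hy0
    have hy0d : y0 < d := index_lt hxb.1 hxb.2
    have r7 : s3.reg 7 = n k := by rw [hr3 7 (by norm_num), hp2.r7]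
    have r10 : s3.reg 10 = Z := by
      rw [hr3 10 (by norm_num), hr 10 (by norm_num) (by norm_num) (by norm_num), h10]
    have r11 : s3.reg 11 = d := by
      rw [hr3 11 (by norm_num), hr 11 (by norm_num) (by norm_num) (by norm_num), h11]
    have r9 : s3.reg 9 = 1 := by rw [hr3 9 (by norm_num), hp2.r9]
    have r17 : s3.reg 17 = 0 := by rw [hr3 17 (by norm_num), hp2.r17]
    rw [← hr3 3 (by norm_num)] at r3
    rw [← hr3 14 (by norm_num)] at r14
    rw [← hr3 15 (by norm_num)] at r15
    rw [← hr3 16 (by norm_num)] at r16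
    simp only [after, wp_seq_mul, wp_seq_add, wp_seq_load, RamState.reg_setReg, Nat.reduceEqDiff,
      if_false, if_true, e26, e25, r7, r10]
    refine ⟨Z + y0, by rw [hy0]; push_cast; ring, ?_⟩
    rw [wp_seq]
    refine wp_addSignedProg (by simp [r17]) ?_
    simp only [wp_seq_store, wp_seq_add, wp_seq_load, RamState.reg_setReg, RamState.reg_setMem,
      RamState.mem_setReg, Nat.reduceEqDiff, if_false, if_true, e26, e25, e21, r7, r10, r11, r15]
    refine ⟨Z + y0, by rw [hy0]; push_cast; ring, Z + d + y0, by rw [hy0]; push_cast; ring, ?_⟩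
    refine ⟨Z + d + y0, by rw [hy0]; push_cast; ring, ?_⟩
    rw [wp_seq]
    refine wp_maxRegProg ?_
    simp only [wp_add, RamState.reg_setReg, RamState.reg_setMem, RamState.mem_setMem,
      RamState.mem_setReg, Nat.reduceEqDiff, if_false, if_true, hm3, r9, r3, r16]
    have hne : Z + d + y0 ≠ Z + y0 := by omega
    refine ⟨fun r h h3 h' => ?_, fun y hy => ?_, fun y hy => ?_, fun y hy => ?_, ?_, ?_, ?_, ?_,
      ?_, ?_⟩
    · rw [← hr r h h3 h', ← hr3 r h]
      simp (disch := omega) only [RamState.reg_setReg, RamState.reg_setMem, if_neg]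
    · rw [← hout y hy]
      simp (disch := omega) only [RamState.mem_setReg, RamState.mem_setMem, if_neg, hm3]
    · rw [Finset.sum_range_succ, mul_add, ← hsgn y hy, signedHit, ← hy0]
      simp (disch := omega) only [RamState.mem_setReg, RamState.mem_setMem, if_neg, hm3]
      by_cases hyy : y = y0
      · subst hyy
        simp
      · rw [if_neg (by omega), if_neg (Ne.symm hyy), mul_zero, add_zero]
    · rw [Finset.sum_range_succ, ← hcnt y hy, hit, ← hy0]
      simp (disch := omega) only [RamState.mem_setReg, RamState.mem_setMem, if_neg, hm3]
      by_cases hyy : y = y0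
      · subst hyy
        simp [hne]
      · rw [if_neg (by omega), if_neg (Ne.symm hyy), add_zero]
    · simp [hc3, hc]
      ring
    · rw [maxTally, ← hy0, Finset.sum_range_succ, ← hcnt y0 hy0d, hit, ← hy0, if_pos rfl]
      simp [show d ≠ 0 by omega]
    · simp [r14]
    · simp [r15]
    · simp
    · rw [add_mul]
      omega
  · rintro s2 c2 ⟨hr, hout, hsgn, hcnt, hc, r3, r14, r15, r16, hc2⟩
    refine ⟨by rw [r16, r14]; exact lt_irrefl _, ?_⟩
    exact hQ _ _ hr hout hsgn hc r3 r14 (by nlinarith [Nat.zero_le (k * B), Nat.zero_le (m * (k * B)), Nat.zero_le (m * k), Nat.zero_le (m * B), Nat.zero_le k, Nat.zero_le B])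

/-! ### The query programs -/

/-- The memory as the preprocessing leaves it: cell `0` points to a block `k, n 0, S` of parameters,
behind which all cells hold `0`. -/
structure Prepared (n : ℕ → ℕ) (a : ℕ → ℕ → ℕ → ℝ) (k F : ℕ) (mem : ℕ → ℝ) : Prop
    extends Layout n a k mem where
  lt : k + 1 + inputSize n k + inputSize n k < F
  ptr : mem 0 = F
  len : mem F = k
  dim_zero : mem (F + 1) = n 0
  size : mem (F + 2) = inputSize n k
  zero : ∀ y, F + 3 ≤ y → mem y = 0

/-- Load the parameters of the input into registers. -/
def setupProg : RamProg :=
  block (.const 9 1) [.const 17 0, .load 10 17, .load 4 10, .add 37 10 9, .load 5 37, .add 37 37 9,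
    .load 38 37, .load 7 4, .add 18 4 9, .add 19 18 38, .load 6 9, .mul 11 5 6, .add 37 19 11,
    .load 38 37, .load 8 19, .sub 8 8 38, .mul 11 5 7, .const 37 3, .add 10 10 37]

theorem wp_setupProg {n : ℕ → ℕ} {a : ℕ → ℕ → ℕ → ℝ} {k F : ℕ} {ω : ℕ → I}
    {Q : RamState → ℕ → Prop} {s : RamState} {c : ℕ} {ε δ b : ℝ} (hk : 1 ≤ k)
    (hs : Prepared n a k F s.mem) (h0 : s.reg 0 = ε) (h1 : s.reg 1 = δ) (h2 : s.reg 2 = b)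
    (hQ : ∀ s' : RamState, Params n k ε (startWeight n a k (n 0)) s' → s'.mem = s.mem → s'.coin = s.coin →
      s'.reg 1 = δ → s'.reg 2 = b → s'.reg 10 = (F + 3 : ℕ) → s'.reg 11 = (n 0 * n k : ℕ) →
      Q s' (c + 20)) :
    setupProg.Wp ω Q s c := by
  have hW := hs.start (n 0) le_rfl
  have hone := hs.dim 1 le_rfl hk
  simp only [setupProg, block, wp_seq_const, wp_seq_load]
  refine ⟨0, by simp, ?_⟩
  simp only [RamState.mem_setReg, hs.ptr]
  refine ⟨F, by simp, ?_⟩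
  simp only [RamState.mem_setReg, hs.len, wp_seq_add, wp_seq_load]
  refine ⟨F + 1, by simp, ?_⟩
  simp only [RamState.mem_setReg, hs.dim_zero, wp_seq_add, wp_seq_load]
  refine ⟨F + 2, by simp; ring, ?_⟩
  simp only [RamState.mem_setReg, hs.size]
  refine ⟨k, by simp, ?_⟩
  simp only [RamState.mem_setReg, hs.dim k hk le_rfl, wp_seq_add, wp_seq_load]
  refine ⟨1, by simp, ?_⟩
  simp only [RamState.mem_setReg, hone, wp_seq_add, wp_seq_mul, wp_seq_load]
  refine ⟨k + 1 + inputSize n k + n 1 * n 0, by simp; ring, ?_⟩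
  refine ⟨k + 1 + inputSize n k, by simp, ?_⟩
  simp only [RamState.mem_setReg, RamState.reg_setReg, wp_seq_sub, wp_seq_mul, wp_seq_const, wp_add,
    Nat.reduceEqDiff, if_false, if_true, hW]
  refine hQ _ ?_ rfl rfl ?_ ?_ ?_ ?_
  · constructor <;> simp [h0, hW]
  all_goals simp [h1, h2]

/-- Compute a number `L` with `4 x / δ ≤ 2 ^ L`, where register `16` holds `x` and register `1` holds
`δ`. The result is placed in register `12`. -/
def logProg : RamProg :=
  after [.const 12 0, .const 13 4, .mul 13 13 16, .div 13 13 1, .const 14 1] (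
    .loop 14 13 (block (.add 14 14 14) [.add 12 12 9]))

theorem wp_logProg {ω : ℕ → I} {Q : RamState → ℕ → Prop} {s : RamState} {c L : ℕ} {x δ : ℝ}
    (h1 : s.reg 1 = δ) (h9 : s.reg 9 = 1) (h16 : s.reg 16 = x) (hδ : δ ≠ 0)
    (hL : L = Nat.clog 2 ⌈4 * x / δ⌉₊)
    (hQ : ∀ (s' : RamState) c', (∀ r < 20, r ≠ 12 → (r < 13 ∨ 16 < r) → s'.reg r = s.reg r) →
      s'.mem = s.mem → s'.coin = s.coin → s'.reg 12 = L → c' ≤ c + 6 + 3 * L → Q s' c') :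
    logProg.Wp ω Q s c := by
  simp only [logProg, after, wp_seq_const, wp_seq_mul, wp_seq_div]
  refine ⟨by simp [h1, hδ], ?_⟩
  refine wp_loop (fun t s' c' => (∀ r < 20, r ≠ 12 → (r < 13 ∨ 16 < r) → s'.reg r = s.reg r) ∧
    s'.mem = s.mem ∧ s'.coin = s.coin ∧ s'.reg 13 = 4 * x / δ ∧ s'.reg 14 = 2 ^ t ∧
    s'.reg 12 = t ∧ c' ≤ c + 5 + 3 * t) L ?_ ?_ ?_
  · refine ⟨fun r h h3 h' => ?_, rfl, rfl, ?_, ?_, ?_, le_rfl⟩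
    · simp (disch := omega) only [RamState.reg_setReg, if_neg]
    · simp [h1, h16]
    · simp
    · simp
  · rintro t ht s1 c1 ⟨hr, hmem, hc, r13, r14, r12, hc1⟩
    refine ⟨?_, ?_⟩
    · rw [r13, r14]
      rw [hL, ← not_le, Nat.clog_le_iff_le_pow (by norm_num), not_le, Nat.lt_ceil] at ht
      exact_mod_cast ht
    · simp only [block, wp_seq_add, wp_add]
      refine ⟨fun r h h3 h' => ?_, hmem, hc, ?_, ?_, ?_, by omega⟩
      · rw [← hr r h h3 h']
        simp (disch := omega) only [RamState.reg_setReg, if_neg]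
      · simp [r13]
      · simp [r14, pow_succ]; ring
      · simp [r12, hr 9, h9]
  · rintro s1 c1 ⟨hr, hmem, hc, r13, r14, r12, hc1⟩
    refine ⟨?_, hQ _ _ hr hmem hc r12 (by omega)⟩
    rw [r13, r14, not_lt]
    have := Nat.le_pow_clog (b := 2) (by norm_num) ⌈4 * x / δ⌉₊
    rw [← hL] at this
    calc 4 * x / δ ≤ ⌈4 * x / δ⌉₊ := Nat.le_ceil _
      _ ≤ (2 ^ L : ℕ) := by exact_mod_cast this
      _ = 2 ^ L := by push_cast; rfl

/-- The average of the samples number `c, …, c + m - 1` for the entry number `y`. -/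
def estimate (n : ℕ → ℕ) (a : ℕ → ℕ → ℕ → ℝ) (k : ℕ) (W : ℝ) (ω : ℕ → I) (c m y : ℕ) : ℝ :=
  W / m * ∑ t ∈ Finset.range m, signedHit (n k) y (sample n a k (ω (c + t) * W))

theorem clog_pos_of_le {δ x : ℝ} (hδ : 0 < δ) (hx : δ ≤ x) : 1 ≤ Nat.clog 2 ⌈4 * x / δ⌉₊ := by
  refine Nat.clog_pos (by norm_num) ?_
  have : (1 : ℝ) < 4 * x / δ := by
    rw [lt_div_iff₀ hδ]; linarith
  exact Nat.lt_ceil.2 (by exact_mod_cast this)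

theorem wp_log_averageProg {n : ℕ → ℕ} {a : ℕ → ℕ → ℕ → ℝ} {k B F : ℕ} {ω : ℕ → I}
    {R : RamProg} {Q : RamState → ℕ → Prop} {s : RamState} {c : ℕ} {ε δ W b x : ℝ} {L m : ℕ}
    (hk : 1 ≤ k) (hn : ∀ l ≤ k, 1 ≤ n l) (hB : ∀ l ≤ k, Nat.clog 2 (n l) ≤ B)
    (hs : Prepared n a k F s.mem) (hp : Params n k ε W s) (h1 : s.reg 1 = δ) (h2 : s.reg 2 = b)
    (h10 : s.reg 10 = (F + 3 : ℕ)) (h11 : s.reg 11 = (n 0 * n k : ℕ)) (h16 : s.reg 16 = x)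
    (hc : s.coin = 0) (hε : 0 < ε) (hδ : 0 < δ) (hx : δ ≤ x) (hbW : ε * ε < b * W)
    (hL : L = Nat.clog 2 ⌈4 * x / δ⌉₊) (hm : m = ⌈16 * b * W * L / (ε * ε)⌉₊)
    (hQ : 1 ≤ m → ∀ (s' : RamState) c', Params n k ε W s' → s'.reg 10 = (F + 3 : ℕ) →
      s'.reg 11 = (n 0 * n k : ℕ) → s'.reg 12 = L → s'.reg 14 = m →
      s'.reg 3 = maxTally (n k) (fun t => sample n a k (ω (0 + t) * W)) m → s'.coin = m →
      (∀ y, y < F + 3 ∨ F + 3 + 2 * (n 0 * n k) ≤ y → s'.mem y = s.mem y) →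
      (∀ y < n 0 * n k, s'.mem (F + 3 + y) = estimate n a k W ω 0 m y) →
      c' ≤ c + 6 + 3 * L + 60 * ((m + 1) * ((k + 1) * (B + 1))) → R.Wp ω Q s' c') :
    (logProg ⨟ averageProg ⨟ R).Wp ω Q s c := by
  have hL1 : 1 ≤ L := hL ▸ clog_pos_of_le hδ hx
  rw [wp_seq]
  refine wp_logProg h1 hp.r9 h16 hδ.ne' hL ?_
  intro s1 c1 hr hmem hc1 r12 hc1'
  have hp1 : Params n k ε W s1 :=
    hp.congr fun r h => hr r (by omega) (by omega) (by omega)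
  have hpos : 0 < 16 * b * W * L / (ε * ε) := by
    have : 0 < b * W := lt_trans (by positivity) hbW
    rw [show 16 * b * W * L = 16 * (b * W) * L by ring]
    positivity
  have hm0 : 1 ≤ m := by
    rw [hm]
    exact Nat.one_le_iff_ne_zero.2 (Nat.ceil_pos.2 hpos).ne'
  have hF := hs.lt
  rw [wp_seq]
  refine wp_averageProg (b := b) (L := L) (Z := F + 3) (m := m) hk hn hB (hmem ▸ hs.toLayout)
    hp1 (by rw [hr 2 (by norm_num) (by norm_num) (by norm_num), h2]) r12
    (by rw [hr 10 (by norm_num) (by norm_num) (by norm_num), h10])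
    (by rw [hr 11 (by norm_num) (by norm_num) (by norm_num), h11]) hε.ne' (by omega)
    (fun y _ => by rw [hmem]; exact hs.zero _ (by omega)) hm hm0
    (x := fun t => sample n a k (ω (0 + t) * W)) (fun t => by rw [hc1, hc]) ?_
  intro s2 c2 hr2 hout hres hcoin h3 h14 hc2
  refine hQ hm0 _ _ (hp1.congr fun r h => hr2 r (by omega) (by omega) (by omega)) ?_ ?_ ?_ h14 h3 ?_ ?_ hres (by omega)
  · simp [hr2 10, hr 10, h10]
  · simp [hr2 11, hr 11, h11]
  · simp [hr2 12, r12]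
  · rw [hcoin, hc1, hc, zero_add]
  · rwa [hmem] at hout

/-- The common part of the programs for the max-norm with a given bound and for the Frobenius
norm. Register `2` holds the bound and register `16` the number of entries for which the error is to
be controlled. -/
def boundedProg : RamProg :=
  after [.mul 13 2 8, .mul 14 0 0] (
    .ite 14 13 (logProg ⨟ averageProg ⨟ .instr (.copy 0 10)) (.instr (.copy 0 10)))

theorem wp_boundedProg {n : ℕ → ℕ} {a : ℕ → ℕ → ℕ → ℝ} {k B F : ℕ} {ω : ℕ → I}
    {Q : RamState → ℕ → Prop} {s : RamState} {c : ℕ} {ε δ W b x : ℝ} {L m : ℕ}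
    (hk : 1 ≤ k) (hn : ∀ l ≤ k, 1 ≤ n l) (hB : ∀ l ≤ k, Nat.clog 2 (n l) ≤ B)
    (hs : Prepared n a k F s.mem) (hp : Params n k ε W s) (h1 : s.reg 1 = δ) (h2 : s.reg 2 = b)
    (h10 : s.reg 10 = (F + 3 : ℕ)) (h11 : s.reg 11 = (n 0 * n k : ℕ)) (h16 : s.reg 16 = x)
    (hc : s.coin = 0) (hε : 0 < ε) (hδ : 0 < δ) (hx : δ ≤ x)
    (hL : L = Nat.clog 2 ⌈4 * x / δ⌉₊) (hm : m = ⌈16 * b * W * L / (ε * ε)⌉₊)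
    (hQ0 : b * W ≤ ε * ε → ∀ s' : RamState, s'.reg 0 = (F + 3 : ℕ) → s'.mem = s.mem → Q s' (c + 4))
    (hQ1 : ε * ε < b * W → ∀ (s' : RamState) c', s'.reg 0 = (F + 3 : ℕ) →
      (∀ y < n 0 * n k, s'.mem (F + 3 + y) = estimate n a k W ω 0 m y) →
      c' ≤ c + 10 + 3 * L + 60 * ((m + 1) * ((k + 1) * (B + 1))) → Q s' c') :
    boundedProg.Wp ω Q s c := by
  simp only [boundedProg, after, wp_seq_mul]
  refine wp_ite ?_ ?_
  · intro h
    simp [hp.r0, h2, hp.r8] at h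
    refine wp_log_averageProg (b := b) (x := x) (δ := δ) hk hn hB hs
      (hp.congr fun r h => ?_) ?_ ?_ ?_ ?_ ?_ hc hε hδ hx h hL hm ?_
    · simp (disch := omega) only [RamState.reg_setReg, if_neg]
    · simp [h1]
    · simp [h2]
    · simp [h10]
    · simp [h11]
    · simp [h16]
    intro hm0 s2 c2 hp2 h10 h11 h12 h14 h3 hcoin hout hres hc2
    rw [wp_copy]
    refine hQ1 h _ _ (by simp [h10]) hres (by omega)
  · intro h
    simp [hp.r0, h2, hp.r8] at h
    rw [wp_copy]
    exact hQ0 h _ (by simp [h10]) rfl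

/-- The program for the max-norm with a given bound. -/
def givenBoundProg : RamProg :=
  setupProg ⨟ .ite 0 2 (.instr (.copy 16 11) ⨟ boundedProg) (.instr (.copy 0 10))

/-- The program for the Frobenius norm. -/
def frobeniusProg : RamProg := setupProg ⨟ after [.copy 2 8, .copy 16 9] boundedProg

/-- The program for the max-norm without a given bound: a first series of samples yields a bound,
with which a second series of samples is drawn. -/
def adaptiveProg : RamProg :=
  setupProg ⨟ after [.copy 16 11, .copy 2 0, .mul 13 2 8, .mul 14 0 0] (
    .ite 14 13
      (logProg ⨟ averageProg ⨟
        after [.mul 3 3 8, .div 3 3 14, .add 3 3 3, .add 2 3 0, .add 10 10 11, .add 10 10 11]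
          (averageProg ⨟ .instr (.copy 0 10)))
      (.instr (.copy 0 10)))

section Spec

variable {n : ℕ → ℕ} {a : ℕ → ℕ → ℕ → ℝ} {k B F : ℕ} {ω : ℕ → I} {Q : RamState → ℕ → Prop}
  {mem : ℕ → ℝ} {ε δ b W x : ℝ} {L m : ℕ}

theorem wp_givenBoundProg (hk : 1 ≤ k) (hn : ∀ l ≤ k, 1 ≤ n l)
    (hB : ∀ l ≤ k, Nat.clog 2 (n l) ≤ B) (hs : Prepared n a k F mem) (hε : 0 < ε) (hδ : 0 < δ)
    (hδ1 : δ ≤ 1) (hW : W = startWeight n a k (n 0))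
    (hL : L = Nat.clog 2 ⌈4 * (n 0 * n k : ℕ) / δ⌉₊) (hm : m = ⌈16 * b * W * L / (ε * ε)⌉₊)
    (hQ0 : b ≤ ε ∨ b * W ≤ ε * ε → ∀ (s' : RamState) c', s'.reg 0 = (F + 3 : ℕ) → s'.mem = mem →
      c' ≤ 26 → Q s' c')
    (hQ1 : ε < b → ε * ε < b * W → ∀ (s' : RamState) c', s'.reg 0 = (F + 3 : ℕ) →
      (∀ y < n 0 * n k, s'.mem (F + 3 + y) = estimate n a k W ω 0 m y) →
      c' ≤ 32 + 3 * L + 60 * ((m + 1) * ((k + 1) * (B + 1))) → Q s' c') :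
    givenBoundProg.Wp ω Q (queryState [ε, δ, b] mem) 0 := by
  subst hW
  have hd : δ ≤ (n 0 * n k : ℕ) :=
    hδ1.trans (by exact_mod_cast Nat.mul_pos (hn 0 (by omega)) (hn k le_rfl))
  rw [givenBoundProg, wp_seq]
  refine wp_setupProg (b := b) (ε := ε) (δ := δ) hk hs rfl rfl rfl ?_
  intro s1 hp hmem hcoin h1 h2 h10 h11
  replace hmem : s1.mem = mem := hmem
  refine wp_ite (fun h => ?_) fun h => ?_
  swap
  · rw [h2, hp.r0, not_lt] at h
    rw [wp_copy]
    exact hQ0 (Or.inl h) _ _ (by simp [h10]) hmem (by omega)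
  rw [h2, hp.r0] at h
  rw [wp_seq_copy]
  refine wp_boundedProg (δ := δ) (x := (n 0 * n k : ℕ)) hk hn hB (s := s1.setReg 16 (s1.reg 11))
    (hmem ▸ hs) (hp.congr fun r h => ?_) ?_ ?_ ?_ ?_ ?_ hcoin hε hδ hd hL hm ?_ ?_
  · simp (disch := omega) only [RamState.reg_setReg, if_neg]
  · simp [h1]
  · simp [h2]
  · simp [h10]
  · simp [h11]
  · simp [h11]
  · exact fun h' s' h0 hm' => hQ0 (Or.inr h') s' _ h0 (hm'.trans hmem) (by omega)
  · exact fun h' s' c' h0 hr hc' => hQ1 h h' s' c' h0 hr (by omega)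

theorem wp_frobeniusProg (hk : 1 ≤ k) (hn : ∀ l ≤ k, 1 ≤ n l)
    (hB : ∀ l ≤ k, Nat.clog 2 (n l) ≤ B) (hs : Prepared n a k F mem) (hε : 0 < ε) (hδ : 0 < δ)
    (hδ1 : δ ≤ 1) (hW : W = startWeight n a k (n 0))
    (hL : L = Nat.clog 2 ⌈4 * 1 / δ⌉₊) (hm : m = ⌈16 * W * W * L / (ε * ε)⌉₊)
    (hQ0 : W * W ≤ ε * ε → ∀ s' : RamState, s'.reg 0 = (F + 3 : ℕ) → s'.mem = mem → Q s' 26)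
    (hQ1 : ε * ε < W * W → ∀ (s' : RamState) c', s'.reg 0 = (F + 3 : ℕ) →
      (∀ y < n 0 * n k, s'.mem (F + 3 + y) = estimate n a k W ω 0 m y) →
      c' ≤ 32 + 3 * L + 60 * ((m + 1) * ((k + 1) * (B + 1))) → Q s' c') :
    frobeniusProg.Wp ω Q (queryState [ε, δ] mem) 0 := by
  subst hW
  rw [frobeniusProg, wp_seq]
  refine wp_setupProg (b := 0) (ε := ε) (δ := δ) hk hs rfl rfl rfl ?_
  intro s1 hp hmem hcoin h1 h2 h10 h11
  replace hmem : s1.mem = mem := hmem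
  simp only [after, wp_seq_copy]
  refine wp_boundedProg (δ := δ) (x := 1) hk hn hB (hmem ▸ hs)
    (hp.congr fun r h => ?_) ?_ ?_ ?_ ?_ ?_ hcoin hε hδ hδ1 hL hm ?_ ?_
  · simp (disch := omega) only [RamState.reg_setReg, if_neg]
  · simp [h1]
  · simp [hp.r8]
  · simp [h10]
  · simp [h11]
  · simp [hp.r9]
  · exact fun h s' h0 h' => hQ0 h s' h0 (h'.trans hmem)
  · exact fun h s' c' h0 h' hc' => hQ1 h s' c' h0 h' (by omega)

theorem wp_adaptiveProg (hk : 1 ≤ k) (hn : ∀ l ≤ k, 1 ≤ n l)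
    (hB : ∀ l ≤ k, Nat.clog 2 (n l) ≤ B) (hs : Prepared n a k F mem) (hε : 0 < ε) (hδ : 0 < δ)
    (hδ1 : δ ≤ 1) (hW : W = startWeight n a k (n 0))
    (hL : L = Nat.clog 2 ⌈4 * (n 0 * n k : ℕ) / δ⌉₊) (hm : m = ⌈16 * ε * W * L / (ε * ε)⌉₊)
    (hb : b = 2 * (maxTally (n k) (fun t => sample n a k (ω (0 + t) * W)) m * W / m) + ε)
    {m' : ℕ} (hm' : m' = ⌈16 * b * W * L / (ε * ε)⌉₊)
    (hQ0 : ε * W ≤ ε * ε → ∀ s' : RamState, s'.reg 0 = (F + 3 : ℕ) → s'.mem = mem → Q s' 26)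
    (hQ1 : ε * ε < ε * W → 1 ≤ m → 1 ≤ m' → ∀ (s' : RamState) c',
      s'.reg 0 = (F + 3 + (n 0 * n k + n 0 * n k) : ℕ) →
      (∀ y < n 0 * n k, s'.mem (F + 3 + (n 0 * n k + n 0 * n k) + y) =
        estimate n a k W ω m m' y) →
      c' ≤ 40 + 3 * L + 60 * ((m + 1) * ((k + 1) * (B + 1))) +
        60 * ((m' + 1) * ((k + 1) * (B + 1))) → Q s' c') :
    adaptiveProg.Wp ω Q (queryState [ε, δ] mem) 0 := by
  have hd : δ ≤ (n 0 * n k : ℕ) :=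
    hδ1.trans (by exact_mod_cast Nat.mul_pos (hn 0 (by omega)) (hn k le_rfl))
  rw [adaptiveProg, wp_seq]
  refine wp_setupProg (b := 0) (ε := ε) (δ := δ) hk hs rfl rfl rfl ?_
  rw [← hW]
  intro s1 hp hmem hcoin h1 h2 h10 h11
  replace hmem : s1.mem = mem := hmem
  simp only [after, wp_seq_copy, wp_seq_mul]
  refine wp_ite ?_ ?_
  · intro h
    simp only [RamState.reg_setReg, Nat.reduceEqDiff, if_false, if_true, hp.r0, hp.r8,
      OfNat.zero_ne_ofNat] at h
    refine wp_log_averageProg (b := ε) (x := (n 0 * n k : ℕ)) (δ := δ) (m := m) hk hn hB (hmem ▸ hs)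
      (hp.congr fun r h => ?_) ?_ ?_ ?_ ?_ ?_ hcoin hε hδ hd h hL hm ?_
    · simp (disch := omega) only [RamState.reg_setReg, if_neg]
    · simp [h1]
    · simp [hp.r0]
    · simp [h10]
    · simp [h11]
    · simp [h11]
    intro hm0 s2 c2 hp2 h10 h11 h12 h14 h3 hcoin2 hout hres hc2
    replace hout : ∀ y, y < F + 3 ∨ F + 3 + 2 * (n 0 * n k) ≤ y → s2.mem y = mem y :=
      fun y hy => (hout y hy).trans (congrFun hmem y)
    have hF := hs.lt
    have hpos : 0 < 16 * b * W * L / (ε * ε) := by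
      have hW0 : 0 < W := pos_of_mul_pos_right (lt_trans (by positivity) h) hε.le
      have hL0 : 1 ≤ L := hL ▸ clog_pos_of_le hδ hd
      have hmx : 0 ≤ maxTally (n k) (fun t => sample n a k (ω (0 + t) * W)) m := by
        cases m with
        | zero => simp [maxTally]
        | succ m =>
          exact le_max_of_le_right (Finset.sum_nonneg fun t _ => by unfold hit; split_ifs <;> simp)
      have hb0 : 0 < b := by rw [hb]; positivity
      positivity
    have hm0' : 1 ≤ m' := by
      rw [hm']
      exact Nat.one_le_iff_ne_zero.2 (Nat.ceil_pos.2 hpos).ne'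
    simp only [wp_seq_mul, wp_seq_div]
    refine ⟨by simp [h14]; omega, ?_⟩
    simp only [wp_seq_add]
    rw [wp_seq]
    refine wp_averageProg (b := b) (L := L) (Z := F + 3 + (n 0 * n k + n 0 * n k)) (m := m') hk hn hB
      ((hs.toLayout).congr hk fun y hy => hout y (by omega)) (hp2.congr fun r h => ?_) ?_ ?_ ?_ ?_
      hε.ne' (by omega) ?_ hm' hm0' (x := fun t => sample n a k (ω (m + t) * W)) ?_ ?_
    · simp (disch := omega) only [RamState.reg_setReg, if_neg]
    · simp [h3, h14, hp2.r0, hp2.r8, hb]; ring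
    · simp [h12]
    · simp [h10, h11]; ring
    · simp [h11]
    · intro y _
      exact (hout _ (by omega)).trans (hs.zero _ (by omega))
    · intro t
      simp [hcoin2]
    intro s3 c3 hr3 _ hres3 _ _ _ hc3
    rw [wp_copy]
    refine hQ1 h hm0 hm0' _ _ ?_ hres3 (by omega)
    rw [RamState.reg_setReg, if_pos rfl, hr3 10 (by norm_num) (by norm_num) (by norm_num)]
    simp [h10, h11]; ring
  · intro h
    simp only [RamState.reg_setReg, Nat.reduceEqDiff, if_false, if_true, hp.r0, hp.r8,
      OfNat.zero_ne_ofNat] at h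
    rw [wp_copy]
    exact hQ0 (not_lt.1 h) _ (by simp [h10]) hmem

end Spec

/-! ### The preprocessing -/

theorem index_injective {n : ℕ → ℕ} {l i j l' i' j' : ℕ} (hi : i < n l) (hj : j < n (l + 1))
    (hi' : i' < n l') (hj' : j' < n (l' + 1))
    (h : inputSize n l + i * n (l + 1) + j = inputSize n l' + i' * n (l' + 1) + j') :
    l = l' ∧ i = i' ∧ j = j' := by
  have key : ∀ {l i j l' i' j' : ℕ}, i < n l → j < n (l + 1) → i' < n l' → j' < n (l' + 1) →
      inputSize n l + i * n (l + 1) + j = inputSize n l' + i' * n (l' + 1) + j' → ¬ l < l' := by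
    intro l i j l' i' j' hi hj hi' hj' h hl
    have h1 := index_lt hi hj
    have h2 := inputSize_mono n (show l + 1 ≤ l' from hl)
    rw [inputSize_succ] at h2
    omega
  obtain rfl : l = l' :=
    le_antisymm (not_lt.1 (key hi' hj' hi hj h.symm)) (not_lt.1 (key hi hj hi' hj' h))
  have key' : ∀ {i j i' j' : ℕ}, j < n (l + 1) → j' < n (l + 1) →
      i * n (l + 1) + j = i' * n (l + 1) + j' → ¬ i < i' := by
    intro i j i' j' hj hj' h hlt
    have := index_lt (r := i') hlt hj
    omega
  have h' : i * n (l + 1) + j = i' * n (l + 1) + j' := by omega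
  obtain rfl : i = i' :=
    le_antisymm (not_lt.1 (key' hj' hj h'.symm)) (not_lt.1 (key' hj hj' h'))
  exact ⟨rfl, rfl, by omega⟩

/-- The entries of a sequence of matrices, as a function of natural numbers. -/
def entryFun (n : ℕ → ℕ) (A : ∀ l : ℕ, Matrix (Fin (n l)) (Fin (n (l + 1))) ℝ) (l i j : ℕ) : ℝ :=
  if h : i < n l ∧ j < n (l + 1) then A l ⟨i, h.1⟩ ⟨j, h.2⟩ else 0

theorem entryFun_fin {n : ℕ → ℕ} (A : ∀ l : ℕ, Matrix (Fin (n l)) (Fin (n (l + 1))) ℝ) (l : ℕ)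
    (i : Fin (n l)) (j : Fin (n (l + 1))) : entryFun n A l i j = A l i j := by
  simp [entryFun]

theorem inputMem_entry {n : ℕ → ℕ} {A : ∀ l : ℕ, Matrix (Fin (n l)) (Fin (n (l + 1))) ℝ}
    {k l i j : ℕ} (hl : l < k) (hi : i < n l) (hj : j < n (l + 1)) :
    inputMem n A k (k + 1 + (inputSize n l + i * n (l + 1) + j)) = entryFun n A l i j := by
  rw [inputMem, if_neg (by omega), Finset.sum_eq_single l, Finset.sum_eq_single ⟨i, hi⟩,
    Finset.sum_eq_single ⟨j, hj⟩]
  · rw [if_pos (by simp only [matrixAddr]; ring), entryFun, dif_pos ⟨hi, hj⟩]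
  · intro j' _ hne
    refine if_neg fun h => hne ?_
    simp only [matrixAddr] at h
    exact Fin.ext (index_injective (n := n) (l := l) (l' := l) hi j'.2 hi hj (by omega)).2.2
  · simp
  · intro i' _ hne
    refine Finset.sum_eq_zero fun j' _ => if_neg fun h => hne ?_
    simp only [matrixAddr] at h
    exact Fin.ext (index_injective (n := n) (l := l) (l' := l) i'.2 j'.2 hi hj (by omega)).2.1
  · simp
  · intro l' _ hne
    refine Finset.sum_eq_zero fun i' _ => Finset.sum_eq_zero fun j' _ => if_neg fun h => hne ?_
    simp only [matrixAddr] at h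
    exact (index_injective (n := n) (l := l') (l' := l) i'.2 j'.2 hi hj (by omega)).1
  · simp [hl]

theorem inputMem_zero {n : ℕ → ℕ} {A : ∀ l : ℕ, Matrix (Fin (n l)) (Fin (n (l + 1))) ℝ}
    {k y : ℕ} (hy : k + 1 + inputSize n k ≤ y) : inputMem n A k y = 0 := by
  rw [inputMem, if_neg (by omega)]
  refine Finset.sum_eq_zero fun l hl => Finset.sum_eq_zero fun i _ => Finset.sum_eq_zero fun j _ =>
    if_neg ?_
  have := inputSize_add_le (Finset.mem_range.1 hl) i.2 (q := j + 1) j.2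
  simp only [matrixAddr]
  omega

/-- The sums of the weights of all paths that start with a matrix entry whose index is at least
`cur` have been computed. -/
structure SuffixSums (n : ℕ → ℕ) (a : ℕ → ℕ → ℕ → ℝ) (k : ℕ) (mem₀ : ℕ → ℝ) (cur : ℕ) (h : ℝ)
    (mem : ℕ → ℝ) : Prop where
  input : ∀ y < k + 1 + inputSize n k, mem y = mem₀ y
  head : mem (k + 1 + inputSize n k + cur) = h
  diff : ∀ l < k, ∀ i < n l, ∀ j < n (l + 1), cur ≤ inputSize n l + i * n (l + 1) + j →
    mem (k + 1 + inputSize n k + (inputSize n l + i * n (l + 1) + j)) -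
      mem (k + 1 + inputSize n k + (inputSize n l + i * n (l + 1) + j + 1)) =
        |a l i j| * pathWeight n a (k - (l + 1)) (l + 1) j
  last : ∀ j ≤ n k, mem (k + 1 + inputSize n k + (inputSize n k + j)) = n k - j
  zero : ∀ y, k + 1 + inputSize n k + inputSize n k + n k < y → mem y = 0

namespace SuffixSums

variable {n : ℕ → ℕ} {a : ℕ → ℕ → ℕ → ℝ} {k cur : ℕ} {mem₀ mem : ℕ → ℝ} {h : ℝ}

theorem sums (H : SuffixSums n a k mem₀ cur h mem) {l i q : ℕ} (hl : l < k) (hi : i < n l)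
    (hq : q ≤ n (l + 1)) (hc : cur ≤ inputSize n l + i * n (l + 1)) :
    mem (k + 1 + inputSize n k + (inputSize n l + i * n (l + 1))) -
      mem (k + 1 + inputSize n k + (inputSize n l + i * n (l + 1) + q)) =
        partialWeight n a (k - (l + 1)) l i q := by
  induction q with
  | zero => simp [partialWeight]
  | succ q ih =>
    have h1 := ih (by omega)
    have h2 := H.diff l hl i hi q (by omega) (by omega)
    rw [partialWeight, Finset.sum_range_succ, ← h2]
    rw [partialWeight] at h1
    rw [← h1, ← add_assoc _ q 1]
    ring

theorem pathWeight_eq (H : SuffixSums n a k mem₀ cur h mem) {l j : ℕ} (hl : l ≤ k) (hj : j < n l)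
    (hc : cur ≤ inputSize n l) :
    mem (k + 1 + inputSize n k + (inputSize n l + j * (if l = k then 1 else n (l + 1)))) -
      mem (k + 1 + inputSize n k + (inputSize n l + j * (if l = k then 1 else n (l + 1)) +
        (if l = k then 1 else n (l + 1)))) =
        pathWeight n a (k - l) l j := by
  by_cases hlk : l = k
  · subst hlk
    simp only [if_true, mul_one]
    rw [add_assoc _ j 1, H.last j hj.le, H.last (j + 1) hj, Nat.sub_self, pathWeight]
    push_cast
    ring
  · simp only [if_neg hlk]
    rw [H.sums (by omega) hj le_rfl (by omega), show k - l = k - (l + 1) + 1 by omega]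
    rfl

theorem start (H : SuffixSums n a k mem₀ cur h mem) (hk : 1 ≤ k) (hc : cur = 0) {q : ℕ}
    (hq : q ≤ n 0) :
    mem (k + 1 + inputSize n k) - mem (k + 1 + inputSize n k + n 1 * q) = startWeight n a k q := by
  induction q with
  | zero => simp [startWeight]
  | succ q ih =>
    have h1 := ih (by omega)
    have h2 := H.sums (l := 0) (i := q) (by omega) (by omega) le_rfl (by omega)
    rw [startWeight, Finset.sum_range_succ, ← startWeight, ← h1]
    obtain ⟨r, rfl⟩ : ∃ r, k = r + 1 := ⟨k - 1, by omega⟩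
    rw [pathWeight, ← partialWeight]
    simp only [inputSize, Finset.range_zero, Finset.sum_empty, zero_add,
      Nat.add_sub_cancel] at h2 ⊢
    rw [← h2, mul_comm (n 1) q, mul_comm (n 1) (q + 1), add_mul, one_mul]
    ring

theorem step (H : SuffixSums n a k mem₀ (cur + 1) h mem) {l i j : ℕ} (hl : l < k) (hi : i < n l)
    (hj : j < n (l + 1)) (hcur : cur = inputSize n l + i * n (l + 1) + j) :
    SuffixSums n a k mem₀ cur (h + pathWeight n a (k - (l + 1)) (l + 1) j * |a l i j|)
      (fun y => if y = k + 1 + inputSize n k + cur then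
        h + pathWeight n a (k - (l + 1)) (l + 1) j * |a l i j| else mem y) where
  input y hy := by rw [if_neg (by omega), H.input y hy]
  head := by rw [if_pos rfl]
  diff l' hl' i' hi' j' hj' hc := by
    rcases hc.eq_or_lt with hc | hc
    · obtain ⟨rfl, rfl, rfl⟩ := index_injective hi hj hi' hj' (hcur.symm.trans hc)
      rw [← hcur, if_pos rfl, if_neg (by omega), H.head]
      ring
    · rw [if_neg (by omega), if_neg (by omega), H.diff l' hl' i' hi' j' hj' hc]
  last j' hj' := by
    have := inputSize_add_le (q := j + 1) hl hi hj
    rw [if_neg (by omega), H.last j' hj']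
  zero y hy := by
    have := inputSize_add_le (q := j + 1) hl hi hj
    rw [if_neg (by omega), H.zero y hy]

end SuffixSums

/-- Compute the size of the input in register `1`. -/
def sizeProg : RamProg :=
  after [.const 1 0, .const 2 0, .const 8 0, .const 9 1] (
    .loop 2 0 (block (.load 3 2) [.add 2 2 9, .load 4 2, .mul 4 3 4, .add 1 1 4]))

theorem wp_sizeProg {n : ℕ → ℕ} {k : ℕ} {ω : ℕ → I} {Q : RamState → ℕ → Prop} {s : RamState}
    {c : ℕ} (h0 : s.reg 0 = k) (hs : ∀ l ≤ k, s.mem l = n l)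
    (hQ : ∀ (s' : RamState) c', s'.mem = s.mem → s'.reg 0 = k → s'.reg 1 = inputSize n k →
      s'.reg 2 = k → s'.reg 8 = 0 → s'.reg 9 = 1 → c' ≤ c + 5 + 6 * k → Q s' c') :
    sizeProg.Wp ω Q s c := by
  simp only [sizeProg, after, wp_seq_const]
  refine wp_loop (fun t s' c' => s'.mem = s.mem ∧ s'.reg 0 = k ∧ s'.reg 1 = inputSize n t ∧
    s'.reg 2 = t ∧ s'.reg 8 = 0 ∧ s'.reg 9 = 1 ∧ c' ≤ c + 4 + 6 * t) k ?_ ?_ ?_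
  · refine ⟨rfl, ?_, ?_, ?_, ?_, ?_, by omega⟩ <;> simp [h0, inputSize]
  · rintro t ht s1 c1 ⟨hmem, r0, r1, r2, r8, r9, hc⟩
    refine ⟨by rw [r0, r2]; exact_mod_cast ht, ?_⟩
    simp only [block, wp_seq_load]
    refine ⟨t, r2, ?_⟩
    simp only [wp_seq_add, wp_seq_load]
    refine ⟨t + 1, by simp [r2, r9], ?_⟩
    simp only [wp_seq_mul, wp_add, RamState.mem_setReg, hmem, hs t ht.le, hs (t + 1) ht]
    refine ⟨trivial, ?_, ?_, ?_, ?_, ?_, by omega⟩ <;>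
      simp [r0, r1, r2, r8, r9, inputSize_succ]
  · rintro s1 c1 ⟨hmem, r0, r1, r2, r8, r9, hc⟩
    exact ⟨by rw [r0, r2]; exact lt_irrefl _, hQ _ _ hmem r0 r1 r2 r8 r9 (by omega)⟩

/-- Write the sums for the paths of length `0`. -/
def lastProg : RamProg :=
  after [.add 10 0 9, .add 11 10 1, .load 12 0, .add 14 11 1, .copy 15 12] (
    .loop 8 15 (block (.store 14 15) [.add 14 14 9, .sub 15 15 9]))

theorem wp_lastProg {n : ℕ → ℕ} {a : ℕ → ℕ → ℕ → ℝ} {k : ℕ} {ω : ℕ → I}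
    {Q : RamState → ℕ → Prop} {s : RamState} {c : ℕ} (h0 : s.reg 0 = k)
    (h1 : s.reg 1 = inputSize n k) (h2 : s.reg 2 = k) (h8 : s.reg 8 = 0) (h9 : s.reg 9 = 1)
    (hdim : ∀ l ≤ k, s.mem l = n l) (hzero : ∀ y, k + 1 + inputSize n k ≤ y → s.mem y = 0)
    (hQ : ∀ (s' : RamState) c', SuffixSums n a k s.mem (inputSize n k) (n k) s'.mem →
      s'.reg 0 = k → s'.reg 1 = inputSize n k → s'.reg 2 = k → s'.reg 8 = 0 → s'.reg 9 = 1 →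
      s'.reg 10 = (k + 1 : ℕ) → s'.reg 11 = (k + 1 + inputSize n k : ℕ) → s'.reg 12 = n k →
      s'.reg 14 = (k + 1 + inputSize n k + inputSize n k + n k : ℕ) →
      c' ≤ c + 6 + 4 * n k → Q s' c') :
    lastProg.Wp ω Q s c := by
  simp only [lastProg, after, wp_seq_add, wp_seq_load]
  refine ⟨k, by simp [h0], ?_⟩
  simp only [RamState.mem_setReg, hdim k le_rfl, wp_seq_add, wp_seq_copy]
  refine wp_loop (fun t s' c' => (∀ y, s'.mem y = if k + 1 + inputSize n k + inputSize n k ≤ y ∧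
      y < k + 1 + inputSize n k + inputSize n k + t then
        (n k : ℝ) - ((y - (k + 1 + inputSize n k + inputSize n k) : ℕ) : ℝ) else s.mem y) ∧
    s'.reg 0 = k ∧ s'.reg 1 = inputSize n k ∧ s'.reg 2 = k ∧ s'.reg 8 = 0 ∧ s'.reg 9 = 1 ∧
    s'.reg 10 = (k + 1 : ℕ) ∧ s'.reg 11 = (k + 1 + inputSize n k : ℕ) ∧ s'.reg 12 = n k ∧
    s'.reg 14 = (k + 1 + inputSize n k + inputSize n k + t : ℕ) ∧ s'.reg 15 = (n k : ℝ) - t ∧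
    c' ≤ c + 5 + 4 * t) (n k) ?_ ?_ ?_
  · refine ⟨fun y => ?_, ?_, ?_, ?_, ?_, ?_, ?_, ?_, ?_, ?_, ?_, by omega⟩
    · rw [if_neg (by omega)]
      rfl
    all_goals simp [h0, h1, h2, h8, h9]
  · rintro t ht s1 c1 ⟨hmem, r0, r1, r2, r8, r9, r10, r11, r12, r14, r15, hc⟩
    refine ⟨by rw [r8, r15]; exact sub_pos.2 (by exact_mod_cast ht), ?_⟩
    simp only [block, wp_seq_store]
    refine ⟨_, r14, ?_⟩
    simp only [wp_seq_add, wp_sub]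
    refine ⟨fun y => ?_, ?_, ?_, ?_, ?_, ?_, ?_, ?_, ?_, ?_, ?_, by omega⟩
    · simp only [RamState.mem_setReg, RamState.mem_setMem, hmem, r15]
      by_cases hy : y = k + 1 + inputSize n k + inputSize n k + t
      · rw [if_pos hy, if_pos (by omega), hy, Nat.add_sub_cancel_left]
      · rw [if_neg hy]
        by_cases hy' : k + 1 + inputSize n k + inputSize n k ≤ y ∧
          y < k + 1 + inputSize n k + inputSize n k + t
        · rw [if_pos hy', if_pos (by omega)]
        · rw [if_neg hy', if_neg (by omega)]
    all_goals simp [r0, r1, r2, r8, r9, r10, r11, r12, r14, r15]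
    all_goals ring
  · rintro s1 c1 ⟨hmem, r0, r1, r2, r8, r9, r10, r11, r12, r14, r15, hc⟩
    refine ⟨by rw [r8, r15]; simp, hQ _ _ ?_ r0 r1 r2 r8 r9 r10 r11 r12 r14 (by omega)⟩
    have hlast : ∀ j ≤ n k, s1.mem (k + 1 + inputSize n k + (inputSize n k + j)) = n k - j := by
      intro j hj
      rw [hmem]
      rcases hj.eq_or_lt with hj | hj
      · rw [if_neg (by omega), hzero _ (by omega), hj, sub_self]
      · rw [if_pos (by omega), ← add_assoc, Nat.add_sub_cancel_left]
    constructor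
    · intro y hy
      rw [hmem, if_neg (by omega)]
    · simpa using hlast 0 (by omega)
    · intro l hl i hi j hj hc
      have := inputSize_add_le (q := j + 1) hl hi hj
      omega
    · exact hlast
    · intro y hy
      rw [hmem, if_neg (by omega), hzero _ (by omega)]

/-- Extend the sums to one more row of a matrix. Registers: `16` holds the index of the first entry
for which the sums are known, `17` the sum at this place, `18` and `19` the row length of the next
matrix and the index of its first entry, `20` the length of the row. -/
def rowProg : RamProg :=
  .instr (.copy 22 20) ⨟
  .loop 8 22 (
    after [.sub 22 22 9, .mul 23 22 18, .add 23 23 19, .add 23 23 11, .load 24 23, .add 23 23 18,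
      .load 25 23, .sub 24 24 25, .sub 16 16 9, .add 23 10 16, .load 25 23] (
      absProg 8 25 25 ⨟
      block (.mul 24 24 25) [.add 17 17 24, .add 23 11 16, .store 23 17]))

section Pre

variable {n : ℕ → ℕ} {a : ℕ → ℕ → ℕ → ℝ} {k : ℕ} {ω : ℕ → I} {Q : RamState → ℕ → Prop}
  {s : RamState} {c : ℕ} {mem₀ : ℕ → ℝ}

theorem wp_rowProg {l i : ℕ} (hl : l < k) (hi : i < n l)
    (hentry : ∀ j < n (l + 1), mem₀ (k + 1 + (inputSize n l + i * n (l + 1) + j)) = a l i j)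
    (h8 : s.reg 8 = 0) (h9 : s.reg 9 = 1) (h10 : s.reg 10 = (k + 1 : ℕ))
    (h11 : s.reg 11 = (k + 1 + inputSize n k : ℕ))
    (h16 : s.reg 16 = (inputSize n l + (i + 1) * n (l + 1) : ℕ))
    (H : SuffixSums n a k mem₀ (inputSize n l + (i + 1) * n (l + 1)) (s.reg 17) s.mem)
    (h18 : s.reg 18 = (if l + 1 = k then 1 else n (l + 2) : ℕ))
    (h19 : s.reg 19 = inputSize n (l + 1)) (h20 : s.reg 20 = n (l + 1))
    (hQ : ∀ (s' : RamState) c', (∀ r < 22, r ≠ 16 → r ≠ 17 → s'.reg r = s.reg r) →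
      s'.reg 16 = (inputSize n l + i * n (l + 1) : ℕ) →
      SuffixSums n a k mem₀ (inputSize n l + i * n (l + 1)) (s'.reg 17) s'.mem →
      c' ≤ c + 2 + 18 * n (l + 1) → Q s' c') :
    rowProg.Wp ω Q s c := by
  simp only [rowProg, wp_seq_copy]
  refine wp_loop (fun t s' c' => (∀ r < 22, r ≠ 16 → r ≠ 17 → s'.reg r = s.reg r) ∧
    s'.reg 16 = (inputSize n l + i * n (l + 1) + (n (l + 1) - t) : ℕ) ∧
    s'.reg 22 = (n (l + 1) - t : ℕ) ∧
    SuffixSums n a k mem₀ (inputSize n l + i * n (l + 1) + (n (l + 1) - t)) (s'.reg 17) s'.mem ∧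
    c' ≤ c + 1 + 18 * t) (n (l + 1)) ?_ ?_ ?_
  · have e : inputSize n l + i * n (l + 1) + (n (l + 1) - 0) =
      inputSize n l + (i + 1) * n (l + 1) := by rw [Nat.sub_zero, add_mul]; ring
    refine ⟨fun r h h' h'' => ?_, ?_, ?_, ?_, by omega⟩
    · simp (disch := omega) only [RamState.reg_setReg, if_neg]
    · rw [e]; simp [h16]
    · simp [h20]
    · rw [e]
      simpa using H
  · rintro t ht s1 c1 ⟨hr, r16, r22, H1, hc⟩
    obtain ⟨j, hj⟩ : ∃ j, n (l + 1) - t = j + 1 := ⟨n (l + 1) - t - 1, by omega⟩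
    have hj' : n (l + 1) - (t + 1) = j := by omega
    have hjn : j < n (l + 1) := by omega
    rw [hj] at r16 r22 H1
    rw [hj']
    refine ⟨by rw [hr 8 (by norm_num) (by norm_num) (by norm_num), h8, r22]; positivity, ?_⟩
    have hw := H1.pathWeight_eq (l := l + 1) (j := j) hl hjn
      (by rw [inputSize_succ]; have := index_lt hi hjn; omega)
    set st : ℕ := if l + 1 = k then 1 else n (l + 2) with hst
    simp only [after, wp_seq_sub, wp_seq_mul, wp_seq_add, wp_seq_load]
    refine ⟨k + 1 + inputSize n k + (inputSize n (l + 1) + j * st), ?_, ?_⟩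
    · simp [hr 9, hr 18, hr 19, hr 11, h9, h18, h19, h11, r22]
      ring
    refine ⟨k + 1 + inputSize n k + (inputSize n (l + 1) + j * st + st), ?_, ?_⟩
    · simp [hr 9, hr 18, hr 19, hr 11, h9, h18, h19, h11, r22]
      ring
    refine ⟨k + 1 + (inputSize n l + i * n (l + 1) + j), ?_, ?_⟩
    · simp [hr 9, hr 10, h9, h10, r16]
      ring
    rw [wp_seq]
    refine wp_absProg (by simp [hr 8, h8]) ?_
    have hb := inputSize_add_le (k := k) hl hi (q := j + 1) hjn
    simp only [block, wp_seq_mul, wp_seq_add, wp_store, RamState.mem_setReg,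
      RamState.reg_setReg, Nat.reduceEqDiff, if_true, if_false, hw,
      H1.input (k + 1 + (inputSize n l + i * n (l + 1) + j)) (by omega), hentry j hjn]
    refine ⟨k + 1 + inputSize n k + (inputSize n l + i * n (l + 1) + j), ?_, ?_⟩
    · simp [hr 9, hr 11, h9, h11, r16]
      ring
    refine ⟨fun r h h' h'' => ?_, ?_, ?_, ?_, by omega⟩
    · rw [← hr r h h' h'']
      simp (disch := omega) only [RamState.reg_setReg, RamState.reg_setMem, if_neg]
    · simp [r16, hr 9, h9]
      ring
    · simp [r22, hr 9, h9]
    · have := H1.step (cur := inputSize n l + i * n (l + 1) + j) hl hi hjn rfl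
      convert this using 1
      · simp
      · funext y
        simp
  · rintro s1 c1 ⟨hr, r16, r22, H1, hc⟩
    rw [Nat.sub_self] at r16 r22 H1
    refine ⟨by rw [hr 8 (by norm_num) (by norm_num) (by norm_num), h8, r22]; simp, ?_⟩
    exact hQ _ _ hr r16 H1 (by omega)

/-- Extend the sums to one more matrix. -/
def levelProg : RamProg :=
  after [.copy 19 16, .load 20 2, .sub 2 2 9, .load 21 2] (
    .loop 8 21 (rowProg ⨟ .instr (.sub 21 21 9)) ⨟ .instr (.copy 18 20))

theorem wp_levelProg {l : ℕ} (hl : l < k) (hdim : ∀ l ≤ k, mem₀ l = n l)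
    (hentry : ∀ i < n l, ∀ j < n (l + 1),
      mem₀ (k + 1 + (inputSize n l + i * n (l + 1) + j)) = a l i j)
    (h2 : s.reg 2 = (l + 1 : ℕ)) (h8 : s.reg 8 = 0) (h9 : s.reg 9 = 1)
    (h10 : s.reg 10 = (k + 1 : ℕ)) (h11 : s.reg 11 = (k + 1 + inputSize n k : ℕ))
    (h16 : s.reg 16 = inputSize n (l + 1))
    (H : SuffixSums n a k mem₀ (inputSize n (l + 1)) (s.reg 17) s.mem)
    (h18 : s.reg 18 = (if l + 1 = k then 1 else n (l + 2) : ℕ))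
    (hQ : ∀ (s' : RamState) c', (∀ r < 16, r ≠ 2 → s'.reg r = s.reg r) → s'.reg 2 = l →
      s'.reg 16 = inputSize n l → SuffixSums n a k mem₀ (inputSize n l) (s'.reg 17) s'.mem →
      s'.reg 18 = n (l + 1) → c' ≤ c + 6 + n l * (4 + 18 * n (l + 1)) → Q s' c') :
    levelProg.Wp ω Q s c := by
  simp only [levelProg, after, wp_seq_copy, wp_seq_load]
  refine ⟨l + 1, by simp [h2], ?_⟩
  simp only [wp_seq_sub, wp_seq_load]
  refine ⟨l, by simp [h2, h9], ?_⟩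
  simp only [RamState.mem_setReg, H.input (l + 1) (by omega), H.input l (by omega),
    hdim l hl.le, hdim (l + 1) hl]
  rw [wp_seq]
  refine wp_loop (fun t s' c' => (∀ r < 16, r ≠ 2 → s'.reg r = s.reg r) ∧ s'.reg 2 = l ∧
    s'.reg 16 = (inputSize n l + (n l - t) * n (l + 1) : ℕ) ∧
    SuffixSums n a k mem₀ (inputSize n l + (n l - t) * n (l + 1)) (s'.reg 17) s'.mem ∧
    s'.reg 18 = (if l + 1 = k then 1 else n (l + 2) : ℕ) ∧
    s'.reg 19 = inputSize n (l + 1) ∧ s'.reg 20 = n (l + 1) ∧ s'.reg 21 = (n l - t : ℕ) ∧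
    c' ≤ c + 4 + t * (4 + 18 * n (l + 1))) (n l) ?_ ?_ ?_
  · refine ⟨fun r h h' => ?_, ?_, ?_, ?_, ?_, ?_, ?_, ?_, by omega⟩
    · simp (disch := omega) only [RamState.reg_setReg, if_neg]
    · simp [h2, h9]
    · simp [h16, inputSize_succ]
    · simpa [inputSize_succ] using H
    · simp only [RamState.reg_setReg, Nat.reduceEqDiff, if_false, h18]
    · simp [h16]
    · simp
    · simp
  · rintro t ht s1 c1 ⟨hr, r2, r16, H1, r18, r19, r20, r21, hc⟩
    obtain ⟨i, hi⟩ : ∃ i, n l - t = i + 1 := ⟨n l - t - 1, by omega⟩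
    have hi' : n l - (t + 1) = i := by omega
    rw [hi] at r16 r21 H1
    rw [hi']
    refine ⟨by rw [hr 8 (by norm_num) (by norm_num), h8, r21]; positivity, ?_⟩
    rw [wp_seq]
    refine wp_rowProg hl (i := i) (by omega) (hentry i (by omega))
      (by rw [hr 8 (by norm_num) (by norm_num), h8]) (by rw [hr 9 (by norm_num) (by norm_num), h9])
      (by rw [hr 10 (by norm_num) (by norm_num), h10])
      (by rw [hr 11 (by norm_num) (by norm_num), h11]) r16 H1 r18 r19 r20 ?_
    intro s2 c2 hr2 r16' H2 hc2
    rw [wp_sub]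
    refine ⟨fun r h h' => ?_, ?_, ?_, ?_, ?_, ?_, ?_, ?_, ?_⟩
    · rw [← hr r h h', ← hr2 r (by omega) (by omega) (by omega)]
      simp (disch := omega) only [RamState.reg_setReg, if_neg]
    · simp [hr2 2, r2]
    · simp [r16']
    · simpa using H2
    · simp only [RamState.reg_setReg, Nat.reduceEqDiff, if_false]
      rw [hr2 18 (by norm_num) (by norm_num) (by norm_num), r18]
    · simp [hr2 19, r19]
    · simp [hr2 20, r20]
    · simp [hr2 21, r21, hr2 9, hr 9, h9]
    · rw [add_mul]
      omega
  · rintro s1 c1 ⟨hr, r2, r16, H1, r18, r19, r20, r21, hc⟩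
    rw [Nat.sub_self] at r16 r21 H1
    rw [zero_mul, add_zero] at r16 H1
    refine ⟨by rw [hr 8 (by norm_num) (by norm_num), h8, r21]; simp, ?_⟩
    rw [wp_copy]
    refine hQ _ _ (fun r h h' => ?_) ?_ ?_ ?_ ?_ (by omega)
    · rw [← hr r h h']
      simp (disch := omega) only [RamState.reg_setReg, if_neg]
    · simp [r2]
    · simp [r16]
    · simpa using H1
    · simp [r20]

/-- Compute the sums for all matrices. -/
def sumsProg : RamProg :=
  after [.copy 16 1, .copy 17 12, .const 18 1] (.loop 8 2 levelProg)

theorem wp_sumsProg (hn : ∀ l ≤ k, 1 ≤ n l) (hdim : ∀ l ≤ k, mem₀ l = n l)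
    (hentry : ∀ l < k, ∀ i < n l, ∀ j < n (l + 1),
      mem₀ (k + 1 + (inputSize n l + i * n (l + 1) + j)) = a l i j)
    (h1 : s.reg 1 = inputSize n k) (h2 : s.reg 2 = k) (h8 : s.reg 8 = 0) (h9 : s.reg 9 = 1)
    (h10 : s.reg 10 = (k + 1 : ℕ)) (h11 : s.reg 11 = (k + 1 + inputSize n k : ℕ))
    (h12 : s.reg 12 = n k) (H : SuffixSums n a k mem₀ (inputSize n k) (n k) s.mem)
    (hQ : ∀ (s' : RamState) c', (∀ r < 16, r ≠ 2 → s'.reg r = s.reg r) →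
      (∃ h, SuffixSums n a k mem₀ 0 h s'.mem) → c' ≤ c + 4 + 30 * inputSize n k → Q s' c') :
    sumsProg.Wp ω Q s c := by
  simp only [sumsProg, after, wp_seq_copy, wp_seq_const]
  refine wp_loop (fun t s' c' => (∀ r < 16, r ≠ 2 → s'.reg r = s.reg r) ∧ s'.reg 2 = (k - t : ℕ) ∧
    s'.reg 16 = inputSize n (k - t) ∧
    SuffixSums n a k mem₀ (inputSize n (k - t)) (s'.reg 17) s'.mem ∧
    s'.reg 18 = (if k - t = k then 1 else n (k - t + 1) : ℕ) ∧
    c' + 30 * inputSize n (k - t) ≤ c + 3 + 30 * inputSize n k) k ?_ ?_ ?_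
  · refine ⟨fun r h h' => ?_, ?_, ?_, ?_, ?_, ?_⟩
    · simp (disch := omega) only [RamState.reg_setReg, if_neg]
    · simp [h2]
    · simp [h1]
    · simpa [h12] using H
    · simp
    · simp
  · rintro t ht s1 c1 ⟨hr, r2, r16, H1, r18, hc⟩
    obtain ⟨l, hl⟩ : ∃ l, k - t = l + 1 := ⟨k - t - 1, by omega⟩
    have hl' : k - (t + 1) = l := by omega
    rw [hl] at r2 r16 H1 r18 hc
    rw [hl']
    refine ⟨by rw [hr 8 (by norm_num) (by norm_num), h8, r2]; positivity, ?_⟩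
    refine wp_levelProg (l := l) (by omega) hdim (hentry l (by omega)) r2
      (by rw [hr 8 (by norm_num) (by norm_num), h8]) (by rw [hr 9 (by norm_num) (by norm_num), h9])
      (by rw [hr 10 (by norm_num) (by norm_num), h10])
      (by rw [hr 11 (by norm_num) (by norm_num), h11]) r16 H1 r18 ?_
    intro s2 c2 hr2 r2' r16' H2 r18' hc2
    refine ⟨fun r h h' => (hr2 r h h').trans (hr r h h'), r2', r16', H2, ?_, ?_⟩
    · rw [if_neg (by omega), r18']
    · rw [inputSize_succ] at hc
      have h3 := hn l (by omega)
      have h4 := hn (l + 1) (by omega)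
      have h5 : n l ≤ n l * n (l + 1) := Nat.le_mul_of_pos_right _ h4
      have h6 : n l * (4 + 18 * n (l + 1)) = 4 * n l + 18 * (n l * n (l + 1)) := by ring
      omega
  · rintro s1 c1 ⟨hr, r2, r16, H1, r18, hc⟩
    rw [Nat.sub_self] at r2 r16 H1 hc
    refine ⟨by rw [hr 8 (by norm_num) (by norm_num), h8, r2]; simp, ?_⟩
    have e : inputSize n 0 = 0 := rfl
    rw [e] at H1 hc
    exact hQ _ _ hr ⟨_, H1⟩ (by omega)

end Pre

/-- The preprocessing. -/
def preProg : RamProg :=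
  sizeProg ⨟ lastProg ⨟ sumsProg ⨟
    block (.add 14 14 9) [.store 14 0, .load 3 8, .add 15 14 9, .store 15 3, .add 15 15 9,
      .store 15 1, .store 8 14]

theorem wp_preProg {n : ℕ → ℕ} (A : ∀ l : ℕ, Matrix (Fin (n l)) (Fin (n (l + 1))) ℝ) {k : ℕ}
    {ω : ℕ → I} (hk : 1 ≤ k) (hn : ∀ l ≤ k, 1 ≤ n l) :
    preProg.Wp ω (fun s c => Prepared n (entryFun n A) k
      (k + 1 + inputSize n k + inputSize n k + n k + 1) s.mem ∧ c ≤ 100 * inputSize n k)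
      (inputState n A k) 0 := by
  have hdim : ∀ l ≤ k, inputMem n A k l = n l := fun l hl => by rw [inputMem, if_pos hl]
  have hentry : ∀ l < k, ∀ i < n l, ∀ j < n (l + 1),
      inputMem n A k (k + 1 + (inputSize n l + i * n (l + 1) + j)) = entryFun n A l i j :=
    fun l hl i hi j hj => inputMem_entry hl hi hj
  have hkS : ∀ l ≤ k, l ≤ inputSize n l := by
    intro l
    induction l with
    | zero => simp
    | succ l ih =>
      intro h
      rw [inputSize_succ]
      have := Nat.mul_pos (hn l (by omega)) (hn (l + 1) h)
      have := ih (by omega)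
      omega
  have hkS := hkS k le_rfl
  have hnk : n k ≤ inputSize n k := by
    obtain ⟨r, rfl⟩ : ∃ r, k = r + 1 := ⟨k - 1, by omega⟩
    rw [inputSize_succ]
    have : n (r + 1) ≤ n r * n (r + 1) := Nat.le_mul_of_pos_left _ (hn r (by omega))
    omega
  rw [preProg, wp_seq]
  refine wp_sizeProg (n := n) (k := k) (by simp [inputState]) hdim ?_
  intro s1 c1 hmem r0 r1 r2 r8 r9 hc1
  replace hmem : s1.mem = inputMem n A k := hmem
  rw [wp_seq]
  refine wp_lastProg (n := n) (a := entryFun n A) (k := k) r0 r1 r2 r8 r9 (by rwa [hmem])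
    (by rw [hmem]; exact fun y hy => inputMem_zero hy) ?_
  rw [hmem]
  intro s2 c2 H r0 r1 r2 r8 r9 r10 r11 r12 r14 hc2
  rw [wp_seq]
  refine wp_sumsProg hn hdim hentry r1 r2 r8 r9 r10 r11 r12 H ?_
  rintro s3 c3 hr ⟨h, H'⟩ hc3
  set F := k + 1 + inputSize n k + inputSize n k + n k + 1 with hF
  have e0 : s3.reg 0 = k := by rw [hr 0 (by norm_num) (by norm_num), r0]
  have e1 : s3.reg 1 = inputSize n k := by rw [hr 1 (by norm_num) (by norm_num), r1]
  have e8 : s3.reg 8 = 0 := by rw [hr 8 (by norm_num) (by norm_num), r8]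
  have e9 : s3.reg 9 = 1 := by rw [hr 9 (by norm_num) (by norm_num), r9]
  have e14 : s3.reg 14 + 1 = F := by
    rw [hr 14 (by norm_num) (by norm_num), r14, hF]; push_cast; ring
  simp only [block, wp_seq_add, wp_seq_store]
  refine ⟨F, by simp [e9, e14], ?_⟩
  simp only [wp_seq_load]
  refine ⟨0, by simp [e8], ?_⟩
  simp only [wp_seq_add, wp_seq_store]
  refine ⟨F + 1, by simp [e9, e14], F + 2, by simp [e9, e14]; ring, ?_⟩
  simp only [wp_store]
  refine ⟨0, by simp [e8], ?_, by omega⟩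
  have e3 : s3.mem 0 = n 0 := by rw [H'.input 0 (by omega), hdim 0 (by omega)]
  have key : ∀ m : ℕ → ℝ, (∀ y, m y = if y = 0 then (F : ℝ) else if y = F + 2 then
      (inputSize n k : ℝ) else if y = F + 1 then (n 0 : ℝ) else if y = F then (k : ℝ) else
      s3.mem y) → Prepared n (entryFun n A) k F m := by
    intro m hm
    have hm' : ∀ y, 1 ≤ y → y < F → m y = s3.mem y := fun y h1 h2 => by
      rw [hm, if_neg (by omega), if_neg (by omega), if_neg (by omega), if_neg (by omega)]
    constructor
    · constructor
      · intro l h1 h2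
        rw [hm' l h1 (by omega), H'.input l (by omega), hdim l h2]
      · intro l hl i hi j hj
        have := inputSize_add_le (k := k) hl hi (q := j + 1) hj
        rw [hm' _ (by omega) (by omega), H'.input _ (by omega), hentry l hl i hi j hj]
      · intro l hl i hi q hq
        have := inputSize_add_le (k := k) hl hi hq
        rw [hm' _ (by omega) (by omega), hm' _ (by omega) (by omega)]
        exact H'.sums hl hi hq (by omega)
      · intro q hq
        have h1 := inputSize_mono n hk
        rw [inputSize_succ] at h1
        have : n 1 * q ≤ n 0 * n (0 + 1) := by rw [mul_comm]; exact Nat.mul_le_mul_right _ hq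
        rw [hm' _ (by omega) (by omega), hm' _ (by omega) (by omega)]
        exact H'.start hk rfl hq
    · omega
    · rw [hm, if_pos rfl]
    · rw [hm, if_neg (by omega), if_neg (by omega), if_neg (by omega), if_pos rfl]
    · rw [hm, if_neg (by omega), if_neg (by omega), if_pos rfl]
    · rw [hm, if_neg (by omega), if_pos rfl]
    · intro y hy
      rw [hm, if_neg (by omega), if_neg (by omega), if_neg (by omega), if_neg (by omega),
        H'.zero y (by omega)]
  refine key _ fun y => ?_
  simp [e0, e1, e3, e9, e14, hF.symm.trans_ne (by omega : k + 1 + inputSize n k + inputSize n k + n k + 1 ≠ 0)]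

theorem preProg_randFree : preProg.RandFree := by
  simp [preProg, sizeProg, lastProg, sumsProg, levelProg, rowProg, absProg, after, block, RandFree]

/-! ### The law of the random walk -/

theorem measurable_pick (f : ℕ → ℝ) (N : ℕ) : Measurable (pick f N) := by
  classical
  exact measurable_findGreatest fun q _ => measurableSet_le measurable_const measurable_id

/-- The value of `g` at the selected place and at the offset from its left end point. -/
theorem measurable_comp_pick {β : Type*} [MeasurableSpace β] (f : ℕ → ℝ) (N : ℕ) {g : ℕ → ℝ → β}
    (hg : ∀ q, Measurable (g q)) :
    Measurable fun u => g (pick f N u) (u - f (pick f N u)) := by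
  have h : Measurable fun p : ℝ × ℕ => g p.2 (p.1 - f p.2) :=
    measurable_from_prod_countable_left fun q => (hg q).comp (measurable_id.sub_const (f q))
  exact h.comp (measurable_id.prodMk (measurable_pick f N))

theorem integral_comp_pick {f : ℕ → ℝ} {N : ℕ} (hf : Monotone f) (h0 : f 0 = 0) {g : ℕ → ℝ → ℝ}
    (hg : ∀ q < N, IntervalIntegrable (g q) volume 0 (f (q + 1) - f q)) :
    IntervalIntegrable (fun u => g (pick f N u) (u - f (pick f N u))) volume 0 (f N) ∧
      ∫ u in 0..f N, g (pick f N u) (u - f (pick f N u)) =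
        ∑ q ∈ Finset.range N, ∫ u in 0..(f (q + 1) - f q), g q u := by
  have heq : ∀ q < N, Set.EqOn (fun u => g q (u - f q))
      (fun u => g (pick f N u) (u - f (pick f N u))) (Set.uIoo (f q) (f (q + 1))) := by
    intro q hq u hu
    rw [Set.uIoo_of_le (hf (Nat.le_succ q))] at hu
    have h1 := le_pick (f := f) hq hu.1.le
    have h2 := pick_lt_of_lt (f := f) (q := q + 1) (fun x y h _ => hf h)
      (Nat.one_le_of_lt hq) (by omega) (fun _ => hu.2)
    have h3 : pick f N u = q := by omega
    simp only [h3]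
  have hint : ∀ q < N, IntervalIntegrable (fun u => g (pick f N u) (u - f (pick f N u))) volume
      (f q) (f (q + 1)) := by
    intro q hq
    have h1 := (hg q hq).comp_sub_right (f q)
    simp only [zero_add, sub_add_cancel] at h1
    exact h1.congr_uIoo (heq q hq)
  rw [← h0]
  refine ⟨IntervalIntegrable.trans_iterate hint, ?_⟩
  rw [← intervalIntegral.sum_integral_adjacent_intervals hint, h0]
  refine Finset.sum_congr rfl fun q hq => ?_
  rw [← intervalIntegral.integral_congr_uIoo (heq q (Finset.mem_range.1 hq)),
    intervalIntegral.integral_comp_sub_right, sub_self]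

section Law

variable (n : ℕ → ℕ) (a : ℕ → ℕ → ℕ → ℝ)

/-- The sum, over all paths of length `r` that start at the vertex `i` of the layer `l`, of the
product of the weights and of the value of `φ` at the last vertex. -/
def pathSum (φ : ℕ → ℝ) : ℕ → ℕ → ℕ → ℝ
  | 0, _, i => φ i
  | r + 1, l, i => ∑ q ∈ Finset.range (n (l + 1)), a l i q * pathSum φ r (l + 1) q

/-- The sum, over all paths, of a function of the last vertex and of the scaled weight. -/
def walkSum (F : ℕ → ℝ → ℝ) : ℕ → ℕ → ℕ → ℝ → ℝ
  | 0, _, i, α => |α| * F i α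
  | r + 1, l, i, α => ∑ q ∈ Finset.range (n (l + 1)), walkSum F r (l + 1) q (α * a l i q)

variable {n a}

theorem measurable_walk (r l i : ℕ) (α : ℝ) : Measurable (walk n a r l i α) := by
  induction r generalizing l i α with
  | zero => exact measurable_const
  | succ r ih =>
    exact measurable_comp_pick (fun q => |α| * partialWeight n a r l i q) (n (l + 1))
      (g := fun q => walk n a r (l + 1) q (α * a l i q)) fun q => ih _ _ _

theorem measurable_sample (k : ℕ) : Measurable (sample n a k) :=
  (measurable_pick _ _).prodMk (measurable_comp_pick (startWeight n a k) (n 0)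
    (g := fun i => walk n a k 0 i 1) fun _ => measurable_walk _ _ _ _)

theorem integral_walk (F : ℕ → ℝ → ℝ) (r l i : ℕ) (α : ℝ) :
    IntervalIntegrable (fun u => F (walk n a r l i α u).1 (walk n a r l i α u).2) volume 0
        (|α| * pathWeight n a r l i) ∧
      ∫ u in 0..|α| * pathWeight n a r l i, F (walk n a r l i α u).1 (walk n a r l i α u).2 =
        walkSum n a F r l i α := by
  induction r generalizing l i α with
  | zero => simp [walk, pathWeight, walkSum]
  | succ r ih =>
    have hd : ∀ q, |α| * partialWeight n a r l i (q + 1) - |α| * partialWeight n a r l i q =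
        |α * a l i q| * pathWeight n a r (l + 1) q := by
      intro q
      rw [partialWeight, partialWeight, Finset.sum_range_succ, abs_mul]
      ring
    have h := integral_comp_pick (f := fun q => |α| * partialWeight n a r l i q) (N := n (l + 1))
      (fun x y h => mul_le_mul_of_nonneg_left (partialWeight_mono _ _ _ h) (abs_nonneg _))
      (by simp [partialWeight])
      (g := fun q u => F (walk n a r (l + 1) q (α * a l i q) u).1
        (walk n a r (l + 1) q (α * a l i q) u).2)
      (fun q _ => by rw [hd]; exact (ih (l + 1) q (α * a l i q)).1)
    refine ⟨h.1, h.2.trans (Finset.sum_congr rfl fun q _ => ?_)⟩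
    rw [hd]
    exact (ih (l + 1) q (α * a l i q)).2

theorem integral_sample (G : ℕ × ℕ × ℝ → ℝ) (k : ℕ) :
    ∫ u in 0..startWeight n a k (n 0), G (sample n a k u) =
      ∑ i ∈ Finset.range (n 0), walkSum n a (fun j β => G (i, j, β)) k 0 i 1 := by
  have hd : ∀ q, startWeight n a k (q + 1) - startWeight n a k q =
      |(1 : ℝ)| * pathWeight n a k 0 q := by
    intro q
    rw [startWeight, startWeight, Finset.sum_range_succ]
    simp
  have h := integral_comp_pick (startWeight_mono (n := n) (a := a) k) (N := n 0)
    (by simp [startWeight])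
    (g := fun i u => G (i, (walk n a k 0 i 1 u).1, (walk n a k 0 i 1 u).2))
    (fun q _ => by rw [hd]; exact (integral_walk (fun j β => G (q, j, β)) k 0 q 1).1)
  refine h.2.trans (Finset.sum_congr rfl fun q _ => ?_)
  rw [hd]
  exact (integral_walk (fun j β => G (q, j, β)) k 0 q 1).2

theorem walkSum_unsigned (φ : ℕ → ℝ) (r l i : ℕ) (α : ℝ) :
    walkSum n a (fun j _ => φ j) r l i α =
      |α| * pathSum n (fun l i j => |a l i j|) φ r l i := by
  induction r generalizing l i α with
  | zero => rfl
  | succ r ih =>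
    simp only [walkSum, pathSum, ih, abs_mul, Finset.mul_sum, mul_assoc]

theorem walkSum_signed (φ : ℕ → ℝ) (r l i : ℕ) (α : ℝ) :
    walkSum n a (fun j β => (if β < 0 then -1 else 1) * φ j) r l i α =
      α * pathSum n a φ r l i := by
  induction r generalizing l i α with
  | zero =>
    simp only [walkSum, pathSum]
    split_ifs with h
    · rw [abs_of_neg h]; ring
    · rw [abs_of_nonneg (not_lt.1 h)]; ring
  | succ r ih =>
    simp only [walkSum, pathSum, ih, Finset.mul_sum, mul_assoc]

theorem pathWeight_eq_pathSum (r l i : ℕ) :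
    pathWeight n a r l i = pathSum n (fun l i j => |a l i j|) (fun _ => 1) r l i := by
  induction r generalizing l i with
  | zero => rfl
  | succ r ih => simp only [pathWeight, pathSum, ih]

theorem pathSum_succ (φ : ℕ → ℝ) (r l i : ℕ) :
    pathSum n a φ (r + 1) l i =
      pathSum n a (fun j => ∑ q ∈ Finset.range (n (l + r + 1)), a (l + r) j q * φ q) r l i := by
  induction r generalizing l i with
  | zero => rfl
  | succ r ih =>
    rw [pathSum, pathSum]
    refine Finset.sum_congr rfl fun q _ => ?_
    rw [ih, show l + 1 + r = l + (r + 1) by ring]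

theorem sum_chainProd (A : ∀ l : ℕ, Matrix (Fin (n l)) (Fin (n (l + 1))) ℝ)
    (ha : ∀ l (i : Fin (n l)) (j : Fin (n (l + 1))), a l i j = A l i j) (k : ℕ) (φ : ℕ → ℝ)
    (i : Fin (n 0)) : ∑ j : Fin (n k), chainProd n A k i j * φ j = pathSum n a φ k 0 i := by
  induction k generalizing φ with
  | zero => simp [chainProd, pathSum, Matrix.one_apply]
  | succ k ih =>
    rw [pathSum_succ, ← ih]
    simp only [chainProd, Matrix.mul_apply, Finset.sum_mul]
    rw [Finset.sum_comm]
    refine Finset.sum_congr rfl fun m _ => ?_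
    rw [Finset.mul_sum, zero_add, Finset.sum_range]
    simp [Finset.mul_sum, ha, mul_assoc]

theorem integral_unit_mul (G : ℝ → ℝ) {W : ℝ} (hW : W ≠ 0) :
    ∫ x : I, G (x * W) = (∫ u in 0..W, G u) / W := by
  have h : ∫ x : I, G (x * W) = ∫ x in Set.Icc (0 : ℝ) 1, G (x * W) :=
    integral_subtype measurableSet_Icc fun x : ℝ => G (x * W)
  rw [h, integral_Icc_eq_integral_Ioc, ← intervalIntegral.integral_of_le zero_le_one,
    intervalIntegral.integral_comp_mul_right _ hW, zero_mul, one_mul, smul_eq_mul]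
  ring

end Law

section Entries

variable {n : ℕ → ℕ} {A : ∀ l : ℕ, Matrix (Fin (n l)) (Fin (n (l + 1))) ℝ} {k : ℕ}

theorem sum_sum_index_eq {r c : ℕ} (B : Matrix (Fin r) (Fin c) ℝ) (i : Fin r) (j : Fin c) :
    ∑ i' : Fin r, ∑ j' : Fin c, B i' j' * (if (i' : ℕ) * c + j' = i * c + j then 1 else 0) =
      B i j := by
  have key : ∀ (i' : Fin r) (j' : Fin c), (i' : ℕ) * c + j' = i * c + j → i' = i ∧ j' = j := by
    intro i' j' h
    have hc : 0 < c := j.pos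
    have h1 := congrArg (· / c) h
    have h2 := congrArg (· % c) h
    simp only [mul_comm _ c, Nat.mul_add_div hc, Nat.div_eq_of_lt j'.2, Nat.div_eq_of_lt j.2,
      Nat.mul_add_mod, Nat.mod_eq_of_lt j'.2, Nat.mod_eq_of_lt j.2, add_zero] at h1 h2
    exact ⟨Fin.ext h1, Fin.ext h2⟩
  rw [Finset.sum_eq_single i, Finset.sum_eq_single j]
  · simp
  · intro j' _ hne
    rw [if_neg fun h => hne (key _ _ h).2, mul_zero]
  · simp
  · intro i' _ hne
    refine Finset.sum_eq_zero fun j' _ => ?_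
    rw [if_neg fun h => hne (key _ _ h).1, mul_zero]
  · simp

theorem absChainProd_nonneg (k : ℕ) (i : Fin (n 0)) (j : Fin (n k)) :
    0 ≤ absChainProd n A k i j := by
  unfold absChainProd
  induction k with
  | zero =>
    rw [chainProd, Matrix.one_apply]
    split_ifs <;> simp
  | succ k ih =>
    rw [chainProd, Matrix.mul_apply]
    exact Finset.sum_nonneg fun m _ => mul_nonneg (ih m) (abs_nonneg _)

theorem abs_chainProd_le (k : ℕ) (i : Fin (n 0)) (j : Fin (n k)) :
    |chainProd n A k i j| ≤ absChainProd n A k i j := by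
  unfold absChainProd
  induction k with
  | zero =>
    rw [chainProd, chainProd, Matrix.one_apply]
    split_ifs <;> simp
  | succ k ih =>
    rw [chainProd, chainProd, Matrix.mul_apply, Matrix.mul_apply]
    refine (Finset.abs_sum_le_sum_abs _ _).trans (Finset.sum_le_sum fun m _ => ?_)
    rw [abs_mul]
    exact mul_le_mul_of_nonneg_right (ih m) (abs_nonneg _)

theorem sum_absChainProd_mul (φ : ℕ → ℝ) (i : Fin (n 0)) :
    ∑ j : Fin (n k), absChainProd n A k i j * φ j =
      pathSum n (fun l i j => |entryFun n A l i j|) φ k 0 i :=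
  sum_chainProd (a := fun l i j => |entryFun n A l i j|) (fun l => (A l).map fun x => |x|)
    (fun l i j => by simp [entryFun_fin]) k φ i

theorem startWeight_eq :
    startWeight n (entryFun n A) k (n 0) = ∑ i, ∑ j, absChainProd n A k i j := by
  rw [startWeight, Finset.sum_range]
  refine Finset.sum_congr rfl fun i _ => ?_
  rw [pathWeight_eq_pathSum, ← sum_absChainProd_mul]
  simp

theorem integral_hit {W : ℝ} (hW : W = startWeight n (entryFun n A) k (n 0)) (hW0 : W ≠ 0)
    (i : Fin (n 0)) (j : Fin (n k)) :
    ∫ x : I, hit (n k) (i * n k + j) (sample n (entryFun n A) k (x * W)) =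
      absChainProd n A k i j / W := by
  rw [integral_unit_mul (fun u => hit (n k) (i * n k + j) (sample n (entryFun n A) k u)) hW0]
  congr 1
  rw [hW, integral_sample, ← sum_sum_index_eq (absChainProd n A k) i j, Finset.sum_range]
  refine Finset.sum_congr rfl fun i' _ => ?_
  have := walkSum_unsigned (n := n) (a := entryFun n A)
    (fun j' => if (i' : ℕ) * n k + j' = i * n k + j then 1 else 0) k 0 i' 1
  rw [abs_one, one_mul, ← sum_absChainProd_mul] at this
  exact this

theorem integral_signedHit {W : ℝ} (hW : W = startWeight n (entryFun n A) k (n 0)) (hW0 : W ≠ 0)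
    (i : Fin (n 0)) (j : Fin (n k)) :
    ∫ x : I, signedHit (n k) (i * n k + j) (sample n (entryFun n A) k (x * W)) =
      chainProd n A k i j / W := by
  rw [integral_unit_mul (fun u => signedHit (n k) (i * n k + j) (sample n (entryFun n A) k u)) hW0]
  congr 1
  rw [hW, integral_sample, ← sum_sum_index_eq (chainProd n A k) i j, Finset.sum_range]
  refine Finset.sum_congr rfl fun i' _ => ?_
  have := walkSum_signed (n := n) (a := entryFun n A)
    (fun j' => if (i' : ℕ) * n k + j' = i * n k + j then 1 else 0) k 0 i' 1
  rw [one_mul, ← sum_chainProd A (fun l i j => entryFun_fin A l i j)] at this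
  rw [← this]
  congr 1
  funext j' β
  unfold signedHit
  split_ifs <;> simp

theorem signedHit_sq (c y : ℕ) (w : ℕ × ℕ × ℝ) : signedHit c y w ^ 2 = hit c y w := by
  unfold signedHit hit
  split_ifs <;> simp

theorem hit_sq (c y : ℕ) (w : ℕ × ℕ × ℝ) : hit c y w ^ 2 = hit c y w := by
  unfold hit
  split_ifs <;> simp

theorem abs_signedHit_le (c y : ℕ) (w : ℕ × ℕ × ℝ) : |signedHit c y w| ≤ 1 := by
  unfold signedHit
  split_ifs <;> simp

theorem abs_hit_le (c y : ℕ) (w : ℕ × ℕ × ℝ) : |hit c y w| ≤ 1 := by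
  unfold hit
  split_ifs <;> simp

theorem measurable_hit (c y : ℕ) : Measurable (hit c y) := by
  unfold hit
  refine Measurable.ite (measurableSet_eq_fun ?_ measurable_const) measurable_const measurable_const
  fun_prop

theorem measurable_signedHit (c y : ℕ) : Measurable (signedHit c y) := by
  unfold signedHit
  refine Measurable.ite (measurableSet_eq_fun ?_ measurable_const)
    (Measurable.ite (measurableSet_lt ?_ measurable_const) measurable_const measurable_const)
    measurable_const
  · fun_prop
  · fun_prop

end Entries

/-! ### Norms -/

theorem elemNorm_top_le_iff {r c : ℕ} {B : Matrix (Fin r) (Fin c) ℝ} {x : ℝ} (hx : 0 ≤ x) :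
    elemNorm ∞ ∞ B ≤ x ↔ ∀ i j, |B i j| ≤ x := by
  have h1 : elemNorm ∞ ∞ B = ⨆ i, abs (⨆ j, |B i j|) := by
    simp [elemNorm, PiLp.norm_eq_ciSup]
  have h2 : ∀ i, 0 ≤ ⨆ j, abs (B i j) := fun i => Real.iSup_nonneg fun j => abs_nonneg _
  rw [h1]
  simp only [abs_of_nonneg (h2 _)]
  constructor
  · intro h i j
    exact (le_ciSup (Set.finite_range fun j => |B i j|).bddAbove j).trans
      ((le_ciSup (Set.finite_range fun i => ⨆ j, |B i j|).bddAbove i).trans h)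
  · exact fun h => Real.iSup_le (fun i => Real.iSup_le (h i) hx) hx

theorem elemNorm_top_nonneg {r c : ℕ} (B : Matrix (Fin r) (Fin c) ℝ) : 0 ≤ elemNorm ∞ ∞ B :=
  norm_nonneg _

theorem elemNorm_one {r c : ℕ} (B : Matrix (Fin r) (Fin c) ℝ) :
    elemNorm 1 1 B = ∑ i, ∑ j, |B i j| := by
  simp only [elemNorm, PiLp.norm_eq_of_L1, Real.norm_eq_abs]
  refine Finset.sum_congr rfl fun i _ => abs_of_nonneg (Finset.sum_nonneg fun j _ => abs_nonneg _)

theorem elemNorm_two_sq {r c : ℕ} (B : Matrix (Fin r) (Fin c) ℝ) :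
    elemNorm 2 2 B ^ 2 = ∑ i, ∑ j, B i j ^ 2 := by
  simp only [elemNorm, PiLp.norm_sq_eq_of_L2, Real.norm_eq_abs, sq_abs]

/-! ### Concentration -/

section Concentration

open ProbabilityTheory

instance : IsProbabilityMeasure coinMeasure := by
  unfold coinMeasure
  infer_instance

theorem measurePreserving_coin (i : ℕ) :
    MeasurePreserving (fun ω : ℕ → I => ω i) coinMeasure volume :=
  measurePreserving_eval_infinitePi (fun _ : ℕ => (volume : Measure I)) i

theorem iIndepFun_coin {β : Type*} [MeasurableSpace β] {φ : I → β} (hφ : Measurable φ) (c : ℕ) :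
    iIndepFun (fun t (ω : ℕ → I) => φ (ω (c + t))) coinMeasure :=
  (iIndepFun_infinitePi (P := fun _ : ℕ => (volume : Measure I)) (X := fun _ => φ)
    fun _ => hφ).precomp (g := fun t => c + t) fun _ _ h => Nat.add_left_cancel h

theorem measurable_comp_coin {β : Type*} [MeasurableSpace β] {φ : I → β} (hφ : Measurable φ)
    (i : ℕ) : Measurable fun ω : ℕ → I => φ (ω i) :=
  hφ.comp (measurable_pi_apply i)

theorem mgf_le_of_abs_le {φ : I → ℝ} (hφ : Measurable φ) (h1 : ∀ x, |φ x| ≤ 1) {q s : ℝ}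
    (h0 : 0 ≤ s) (hs : s ≤ 1) (hq : ∫ x, φ x ^ 2 ≤ q) :
    mgf φ volume s ≤ Real.exp (s * (∫ x, φ x) + s ^ 2 * q) := by
  have hi : Integrable φ volume :=
    Integrable.of_bound hφ.aestronglyMeasurable 1 (Filter.Eventually.of_forall h1)
  have hi2 : Integrable (fun x => φ x ^ 2) volume :=
    Integrable.of_bound (hφ.pow_const 2).aestronglyMeasurable 1 (Filter.Eventually.of_forall
      fun x => by
        rw [Real.norm_eq_abs, abs_pow]
        exact pow_le_one₀ (abs_nonneg _) (h1 x))
  calc mgf φ volume s ≤ ∫ x, (1 + s * φ x + s ^ 2 * φ x ^ 2) := by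
        refine integral_mono (integrable_exp_mul_of_mem_Icc (a := -1) (b := 1) hφ.aemeasurable
          (Filter.Eventually.of_forall fun x => abs_le.1 (h1 x)))
          (((integrable_const _).add (hi.const_mul s)).add (hi2.const_mul _)) fun x => ?_
        have h := Real.abs_exp_sub_one_sub_id_le (x := s * φ x) (by
          rw [abs_mul, abs_of_nonneg h0]
          exact mul_le_one₀ hs (abs_nonneg _) (h1 x))
        have := (abs_le.1 h).2
        simp only
        linarith [mul_pow s (φ x) 2]
    _ = 1 + s * (∫ x, φ x) + s ^ 2 * ∫ x, φ x ^ 2 := by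
        have h1 : Integrable (fun x => 1 + s * φ x) volume :=
          (integrable_const _).add (hi.const_mul s)
        rw [integral_add h1 (hi2.const_mul _), integral_add (integrable_const _) (hi.const_mul s),
          integral_const_mul, integral_const_mul]
        simp
    _ ≤ s * (∫ x, φ x) + s ^ 2 * q + 1 := by
        linarith [mul_le_mul_of_nonneg_left hq (sq_nonneg s)]
    _ ≤ _ := Real.add_one_le_exp _

/-- An exponential tail bound for sums of independent bounded random variables with a small second
moment. -/
theorem measure_sum_ge_le {φ : I → ℝ} (hφ : Measurable φ) (h1 : ∀ x, |φ x| ≤ 1) {q s : ℝ}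
    (h0 : 0 ≤ s) (hs : s ≤ 1) (hq : ∫ x, φ x ^ 2 ≤ q) (τ : ℝ) (c m : ℕ) :
    coinMeasure.real {ω | m * (∫ x, φ x) + τ ≤ ∑ t ∈ Finset.range m, φ (ω (c + t))} ≤
      Real.exp (-(s * τ) + m * (s ^ 2 * q)) := by
  have hm := fun t => measurable_comp_coin hφ (c + t)
  have hsum : (fun ω : ℕ → I => ∑ t ∈ Finset.range m, φ (ω (c + t))) =
      ∑ t ∈ Finset.range m, fun ω : ℕ → I => φ (ω (c + t)) := by
    funext ω
    simp
  have hmgf : mgf (fun ω : ℕ → I => ∑ t ∈ Finset.range m, φ (ω (c + t))) coinMeasure s =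
      mgf φ volume s ^ m := by
    rw [hsum, (iIndepFun_coin hφ c).mgf_sum hm, Finset.prod_eq_pow_card (b := mgf φ volume s)]
    · simp
    · intro t _
      rw [mgf, mgf, ← (measurePreserving_coin (c + t)).map_eq, integral_map
        (measurePreserving_coin _).measurable.aemeasurable
        (by fun_prop)]
  refine (measure_ge_le_exp_mul_mgf _ h0 (integrable_exp_mul_of_mem_Icc (a := -m) (b := m)
    (Finset.measurable_sum _ fun t _ => hm t).aemeasurable
    (Filter.Eventually.of_forall fun ω => abs_le.1 ?_))).trans ?_
  · refine (Finset.abs_sum_le_sum_abs _ _).trans ((Finset.sum_le_sum fun t _ => h1 _).trans ?_)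
    simp
  · rw [hmgf]
    refine (mul_le_mul_of_nonneg_left (pow_le_pow_left₀ mgf_nonneg
      (mgf_le_of_abs_le hφ h1 h0 hs hq) m) (Real.exp_nonneg _)).trans_eq ?_
    rw [← Real.exp_nat_mul, ← Real.exp_add]
    congr 1
    ring

/-- A two-sided version of `measure_sum_ge_le`. -/
theorem measure_abs_sum_sub_ge_le {φ : I → ℝ} (hφ : Measurable φ) (h1 : ∀ x, |φ x| ≤ 1) {q s : ℝ}
    (h0 : 0 ≤ s) (hs : s ≤ 1) (hq : ∫ x, φ x ^ 2 ≤ q) (τ : ℝ) (c m : ℕ) :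
    coinMeasure.real {ω | τ ≤ |∑ t ∈ Finset.range m, φ (ω (c + t)) - m * (∫ x, φ x)|} ≤
      2 * Real.exp (-(s * τ) + m * (s ^ 2 * q)) := by
  have hneg := measure_sum_ge_le (φ := fun x => -φ x) hφ.neg (fun x => by rw [abs_neg]; exact h1 x)
    h0 hs (by simpa only [neg_sq] using hq) τ c m
  rw [integral_neg] at hneg
  refine (measureReal_mono (s₂ := _ ∪ _) ?_ (measure_ne_top _ _)).trans
    ((measureReal_union_le _ _).trans
      ((add_le_add (measure_sum_ge_le hφ h1 h0 hs hq τ c m) hneg).trans_eq (two_mul _).symm))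
  intro ω h
  rcases le_abs.1 (Set.mem_ofPred_eq ▸ h) with h | h
  · exact Or.inl (by rw [Set.mem_ofPred_eq]; linarith)
  · refine Or.inr ?_
    rw [Set.mem_ofPred_eq, Finset.sum_neg_distrib]
    linarith

/-- Two events that depend on disjoint blocks of coins are independent. -/
theorem measure_inter_of_blocks {m : ℕ} {E F : Set (ℕ → I)} (hE : MeasurableSet E)
    (hF : MeasurableSet F) (hE' : ∀ ω ω' : ℕ → I, (∀ t < m, ω t = ω' t) → (ω ∈ E ↔ ω' ∈ E))
    {m' : ℕ}
    (hF' : ∀ ω ω' : ℕ → I, (∀ t < m', ω (m + t) = ω' (m + t)) → (ω ∈ F ↔ ω' ∈ F)) :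
    coinMeasure.real (E ∩ F) = coinMeasure.real E * coinMeasure.real F := by
  classical
  have hind := (iIndepFun_coin (φ := (id : I → I)) measurable_id 0).indepFun_finset
    (Finset.range m) (Finset.Ico m (m + m'))
    (by
      rw [Finset.disjoint_left]
      intro x hx hx'
      rw [Finset.mem_range] at hx
      rw [Finset.mem_Ico] at hx'
      omega) fun t => measurable_comp_coin measurable_id _
  simp only [id, zero_add] at hind
  have hmeas : ∀ T : Finset ℕ, Measurable fun (x : T → I) (t : ℕ) =>
      if h : t ∈ T then x ⟨t, h⟩ else (0 : I) := by
    intro T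
    refine measurable_pi_lambda _ fun t => ?_
    by_cases h : t ∈ T
    · simpa only [h, dif_pos] using measurable_pi_apply _
    · simpa only [h, dif_neg, not_false_iff] using measurable_const
  have h := hind.measure_inter_preimage_eq_mul _ _ (hmeas _ hE) (hmeas _ hF)
  have hEq : (fun (ω : ℕ → I) (i : Finset.range m) => ω i) ⁻¹'
      ((fun x t => if h : t ∈ Finset.range m then x ⟨t, h⟩ else (0 : I)) ⁻¹' E) = E := by
    ext ω
    refine hE' _ _ fun t ht => ?_
    simp [ht]
  have hFq : (fun (ω : ℕ → I) (i : Finset.Ico m (m + m')) => ω i) ⁻¹'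
      ((fun x t => if h : t ∈ Finset.Ico m (m + m') then x ⟨t, h⟩ else (0 : I)) ⁻¹' F) = F := by
    ext ω
    refine hF' _ _ fun t ht => ?_
    simp [ht]
  rw [hEq, hFq] at h
  rw [measureReal_def, h, ENNReal.toReal_mul, measureReal_def, measureReal_def]

/-! #### Sums of random vectors -/

section Vector

variable {E : Type*} [NormedAddCommGroup E] [InnerProductSpace ℝ E] [FiniteDimensional ℝ E]
  [MeasurableSpace E] [BorelSpace E]

theorem lintegral_exp_sq_norm_add_le {X : I → E} (hX : Measurable X) {b : ℝ}
    (hb : ∀ x, ‖X x‖ ≤ b) (hmean : ∀ s : E, ∫ x, inner ℝ s (X x) = 0) {c : ℝ} (hc : 0 ≤ c) (s : E) :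
    ∫⁻ x, ENNReal.ofReal (Real.exp (c * ‖s + X x‖ ^ 2)) ≤
      ENNReal.ofReal (Real.exp (c * b ^ 2)) *
        ENNReal.ofReal (Real.exp (c * (1 + 2 * c * b ^ 2) * ‖s‖ ^ 2)) := by
  have hb0 : 0 ≤ b := (norm_nonneg _).trans (hb 0)
  have hin : Measurable fun x => inner ℝ s (X x) := by fun_prop
  have hbd : ∀ x, inner ℝ s (X x) ∈ Set.Icc (-(‖s‖ * b)) (‖s‖ * b) := fun x =>
    abs_le.1 ((abs_real_inner_le_norm _ _).trans (mul_le_mul_of_nonneg_left (hb x) (norm_nonneg _)))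
  have hint : Integrable (fun x => Real.exp (2 * c * inner ℝ s (X x))) (volume : Measure I) :=
    integrable_exp_mul_of_mem_Icc hin.aemeasurable (Filter.Eventually.of_forall hbd)
  have hsub := (hasSubgaussianMGF_of_mem_Icc_of_integral_eq_zero (μ := (volume : Measure I))
    hin.aemeasurable (Filter.Eventually.of_forall hbd) (hmean s)).mgf_le (2 * c)
  rw [mgf] at hsub
  calc ∫⁻ x, ENNReal.ofReal (Real.exp (c * ‖s + X x‖ ^ 2))
      ≤ ∫⁻ x, ENNReal.ofReal (Real.exp (c * ‖s‖ ^ 2 + c * b ^ 2)) *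
          ENNReal.ofReal (Real.exp (2 * c * inner ℝ s (X x))) := by
        refine lintegral_mono fun x => ?_
        rw [← ENNReal.ofReal_mul (Real.exp_nonneg _), ← Real.exp_add]
        refine ENNReal.ofReal_le_ofReal (Real.exp_le_exp.2 ?_)
        rw [norm_add_sq_real]
        have := mul_le_mul_of_nonneg_left (pow_le_pow_left₀ (norm_nonneg _) (hb x) 2) hc
        linarith
    _ = ENNReal.ofReal (Real.exp (c * ‖s‖ ^ 2 + c * b ^ 2)) *
          ENNReal.ofReal (∫ x, Real.exp (2 * c * inner ℝ s (X x))) := by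
        rw [lintegral_const_mul _ (by fun_prop),
          ofReal_integral_eq_lintegral_ofReal hint
            (Filter.Eventually.of_forall fun x => Real.exp_nonneg _)]
    _ ≤ ENNReal.ofReal (Real.exp (c * ‖s‖ ^ 2 + c * b ^ 2)) *
          ENNReal.ofReal (Real.exp (2 * c ^ 2 * b ^ 2 * ‖s‖ ^ 2)) := by
        gcongr
        refine hsub.trans (Real.exp_le_exp.2 (le_of_eq ?_))
        have : ‖‖s‖ * b - -(‖s‖ * b)‖ = 2 * (‖s‖ * b) := by
          rw [Real.norm_eq_abs, abs_of_nonneg] <;> nlinarith [norm_nonneg s]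
        push_cast
        rw [this]
        ring
    _ = _ := by
        rw [← ENNReal.ofReal_mul (Real.exp_nonneg _), ← ENNReal.ofReal_mul (Real.exp_nonneg _),
          ← Real.exp_add, ← Real.exp_add]
        congr 2
        ring

theorem lintegral_exp_sq_norm_sum_le {X : I → E} (hX : Measurable X) {b : ℝ}
    (hb : ∀ x, ‖X x‖ ≤ b) (hmean : ∀ s : E, ∫ x, inner ℝ s (X x) = 0) (m : ℕ) {c : ℝ} (hc : 0 ≤ c)
    (hcm : 4 * b ^ 2 * c * m ≤ 1) :
    ∫⁻ ω, ENNReal.ofReal (Real.exp (c * ‖∑ t ∈ Finset.range m, X (ω (0 + t))‖ ^ 2)) ∂coinMeasure ≤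
      ENNReal.ofReal (Real.exp (2 * m * c * b ^ 2)) := by
  induction m generalizing c with
  | zero => simp
  | succ m ih =>
    have hb2 := sq_nonneg b
    have hu : 0 ≤ 4 * b ^ 2 * c := by positivity
    push_cast at hcm
    have hm : ∀ t, Measurable fun ω : ℕ → I => X (ω (0 + t)) := fun t => measurable_comp_coin hX _
    have hS : Measurable (∑ t ∈ Finset.range m, fun ω : ℕ → I => X (ω (0 + t))) := by
      have h := Finset.measurable_sum (Finset.range m) fun t _ => hm t
      convert h using 1
      ext ω
      simp
    have hind := (iIndepFun_coin hX 0).indepFun_finsetSum_of_notMem hm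
      (s := Finset.range m) (i := m) (by simp)
    rw [indepFun_iff_map_prod_eq_prod_map_map hS.aemeasurable (hm m).aemeasurable] at hind
    have hG : Measurable fun p : E × E => ENNReal.ofReal (Real.exp (c * ‖p.1 + p.2‖ ^ 2)) := by
      fun_prop
    calc ∫⁻ ω, ENNReal.ofReal (Real.exp (c * ‖∑ t ∈ Finset.range (m + 1), X (ω (0 + t))‖ ^ 2))
          ∂coinMeasure
        = ∫⁻ ω, (fun p : E × E => ENNReal.ofReal (Real.exp (c * ‖p.1 + p.2‖ ^ 2)))
            ((∑ t ∈ Finset.range m, fun ω : ℕ → I => X (ω (0 + t))) ω, X (ω (0 + m)))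
            ∂coinMeasure := by
          simp only [Finset.sum_range_succ, Finset.sum_apply]
      _ = ∫⁻ ω, (∫⁻ x, ENNReal.ofReal (Real.exp (c *
            ‖∑ t ∈ Finset.range m, X (ω (0 + t)) + X x‖ ^ 2))) ∂coinMeasure := by
          rw [← lintegral_map hG (hS.prodMk (hm m)), hind, lintegral_prod _ hG.aemeasurable,
            lintegral_map hG.lintegral_prod_right' hS]
          refine lintegral_congr fun ω => ?_
          rw [lintegral_map (by fun_prop) (hm m),
            ← (measurePreserving_coin (0 + m)).map_eq, lintegral_map (by fun_prop)
              (measurePreserving_coin (0 + m)).measurable]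
          simp
      _ ≤ ∫⁻ ω, ENNReal.ofReal (Real.exp (c * b ^ 2)) *
            ENNReal.ofReal (Real.exp (c * (1 + 2 * c * b ^ 2) *
              ‖∑ t ∈ Finset.range m, X (ω (0 + t))‖ ^ 2)) ∂coinMeasure :=
          lintegral_mono fun ω => lintegral_exp_sq_norm_add_le hX hb hmean hc _
      _ ≤ ENNReal.ofReal (Real.exp (c * b ^ 2)) *
            ENNReal.ofReal (Real.exp (2 * m * (c * (1 + 2 * c * b ^ 2)) * b ^ 2)) := by
          rw [lintegral_const_mul _ (by fun_prop)]
          gcongr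
          refine ih (by positivity) ?_
          nlinarith [mul_le_mul_of_nonneg_left hcm hu]
      _ ≤ _ := by
          rw [← ENNReal.ofReal_mul (Real.exp_nonneg _), ← Real.exp_add]
          refine ENNReal.ofReal_le_ofReal (Real.exp_le_exp.2 ?_)
          push_cast
          have : 4 * b ^ 2 * c * m ≤ 1 := by nlinarith
          nlinarith [mul_le_mul_of_nonneg_left this (mul_nonneg hc hb2)]

/-- A Gaussian tail bound, without dependence on the dimension, for sums of independent bounded
centered random vectors. -/
theorem measure_norm_sum_ge_le {X : I → E} (hX : Measurable X) {b : ℝ} (hb0 : 0 < b)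
    (hb : ∀ x, ‖X x‖ ≤ b) (hmean : ∀ s : E, ∫ x, inner ℝ s (X x) = 0) {m : ℕ} (hm : 0 < m) {τ : ℝ}
    (hτ : 0 ≤ τ) :
    coinMeasure.real {ω | τ ≤ ‖∑ t ∈ Finset.range m, X (ω (0 + t))‖} ≤
      Real.exp (1 / 2 - τ ^ 2 / (4 * b ^ 2 * m)) := by
  have hm' : (0 : ℝ) < m := by exact_mod_cast hm
  obtain ⟨c, hc⟩ : ∃ c : ℝ, c = 1 / (4 * b ^ 2 * m) := ⟨_, rfl⟩
  have hc0 : 0 ≤ c := by rw [hc]; positivity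
  have hcm : 4 * b ^ 2 * c * m = 1 := by rw [hc]; field_simp
  have hle := lintegral_exp_sq_norm_sum_le hX hb hmean m hc0 hcm.le
  have hS : Measurable fun ω : ℕ → I => ∑ t ∈ Finset.range m, X (ω (0 + t)) :=
    Finset.measurable_sum _ fun t _ => measurable_comp_coin hX _
  have hmk := meas_ge_le_lintegral_div (μ := coinMeasure)
    (f := fun ω => ENNReal.ofReal (Real.exp (c * ‖∑ t ∈ Finset.range m, X (ω (0 + t))‖ ^ 2)))
    ((hS.norm.pow_const 2).const_mul c).exp.ennreal_ofReal.aemeasurable (ε := ENNReal.ofReal (Real.exp (c * τ ^ 2)))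
    (by simpa using Real.exp_pos _) ENNReal.ofReal_ne_top
  have hfin : coinMeasure {ω | τ ≤ ‖∑ t ∈ Finset.range m, X (ω (0 + t))‖} ≤
      ENNReal.ofReal (Real.exp (1 / 2 - τ ^ 2 / (4 * b ^ 2 * m))) := by
    refine (measure_mono fun ω h => ?_).trans (hmk.trans ?_)
    · refine ENNReal.ofReal_le_ofReal (Real.exp_le_exp.2 (mul_le_mul_of_nonneg_left ?_ hc0))
      exact pow_le_pow_left₀ hτ h 2
    · refine (ENNReal.div_le_div_right hle _).trans_eq ?_
      rw [← ENNReal.ofReal_div_of_pos (Real.exp_pos _), ← Real.exp_sub]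
      congr 2
      have : 2 * m * c * b ^ 2 = 1 / 2 := by linarith
      rw [this, hc]
      ring
  exact ENNReal.toReal_le_of_le_ofReal (Real.exp_nonneg _) hfin

end Vector

end Concentration

/-! ### The error of the estimates -/

theorem exp_neg_clog_le {δ x : ℝ} (hδ : 0 < δ) (hx : 0 < x) :
    Real.exp (-(Nat.clog 2 ⌈4 * x / δ⌉₊ : ℝ)) ≤ δ / (4 * x) := by
  have h : 4 * x / δ ≤ Real.exp (Nat.clog 2 ⌈4 * x / δ⌉₊ : ℝ) :=
    calc 4 * x / δ ≤ ⌈4 * x / δ⌉₊ := Nat.le_ceil _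
      _ ≤ (2 ^ Nat.clog 2 ⌈4 * x / δ⌉₊ : ℕ) := by
        exact_mod_cast Nat.le_pow_clog (by norm_num) _
      _ = 2 ^ Nat.clog 2 ⌈4 * x / δ⌉₊ := by push_cast; rfl
      _ ≤ Real.exp 1 ^ Nat.clog 2 ⌈4 * x / δ⌉₊ :=
        pow_le_pow_left₀ (by norm_num) (by linarith [Real.add_one_le_exp (1 : ℝ)]) _
      _ = _ := by rw [← Real.exp_nat_mul, mul_one]
  rw [Real.exp_neg, show δ / (4 * x) = (4 * x / δ)⁻¹ by rw [inv_div]]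
  exact inv_anti₀ (by positivity) h

theorem measureReal_exists_exists_le {Ω : Type*} [MeasurableSpace Ω] (μ : Measure Ω)
    [IsProbabilityMeasure μ] {r c : ℕ} {p : Fin r → Fin c → Ω → Prop} {K : ℝ}
    (h : ∀ i j, μ.real {ω | p i j ω} ≤ K) : μ.real {ω | ∃ i j, p i j ω} ≤ (r * c : ℕ) * K := by
  have hE : {ω | ∃ i j, p i j ω} = ⋃ q : Fin r × Fin c, {ω | p q.1 q.2 ω} := by
    ext ω
    simp
  rw [hE]
  refine (measureReal_iUnion_fintype_le _).trans ((Finset.sum_le_sum fun q _ => h q.1 q.2).trans ?_)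
  simp

theorem sum_hit_le_maxTally (c : ℕ) (x : ℕ → ℕ × ℕ × ℝ) (m y : ℕ) :
    ∑ t ∈ Finset.range m, hit c y (x t) ≤ maxTally c x m := by
  induction m with
  | zero => simp [maxTally]
  | succ m ih =>
    by_cases h : (x m).1 * c + (x m).2.1 = y
    · rw [← h]
      exact le_max_right _ _
    · rw [Finset.sum_range_succ, hit, if_neg h, add_zero]
      exact ih.trans (le_max_left _ _)

theorem hit_nonneg (c y : ℕ) (w : ℕ × ℕ × ℝ) : 0 ≤ hit c y w := by
  unfold hit
  split_ifs <;> simp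

theorem maxTally_le {c : ℕ} {x : ℕ → ℕ × ℕ × ℝ} {m : ℕ} {K : ℝ} (h0 : 0 ≤ K)
    (h : ∀ t < m, ∑ t' ∈ Finset.range m, hit c ((x t).1 * c + (x t).2.1) (x t') ≤ K) :
    maxTally c x m ≤ K := by
  induction m with
  | zero => exact h0
  | succ m ih =>
    refine max_le (ih fun t ht => (Finset.sum_le_sum_of_subset_of_nonneg
      (Finset.range_mono (Nat.le_succ m)) fun _ _ _ => hit_nonneg _ _ _).trans (h t (by omega)))
      (h m (by omega))

theorem exists_maxTally_eq (c : ℕ) (x : ℕ → ℕ × ℕ × ℝ) (m : ℕ) :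
    ∃ N < m + 1, maxTally c x m = (N : ℕ) := by
  induction m with
  | zero => exact ⟨0, by simp [maxTally]⟩
  | succ m ih =>
    obtain ⟨N, hN, h⟩ := ih
    rw [maxTally]
    rcases max_choice (maxTally c x m)
      (∑ t' ∈ Finset.range (m + 1), hit c ((x m).1 * c + (x m).2.1) (x t')) with h' | h'
    · exact ⟨N, by omega, h'.trans h⟩
    · refine ⟨((Finset.range (m + 1)).filter
        fun t' => (x t').1 * c + (x t').2.1 = (x m).1 * c + (x m).2.1).card, ?_, h'.trans ?_⟩
      · exact Nat.lt_succ_of_le ((Finset.card_filter_le _ _).trans (by simp))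
      · simp [hit, Finset.sum_boole]

theorem maxTally_congr {c : ℕ} {x x' : ℕ → ℕ × ℕ × ℝ} {m : ℕ} (h : ∀ t < m, x t = x' t) :
    maxTally c x m = maxTally c x' m := by
  induction m with
  | zero => rfl
  | succ m ih =>
    rw [maxTally, maxTally, ih fun t ht => h t (by omega), h m (by omega)]
    congr 1
    exact Finset.sum_congr rfl fun t ht => by rw [h t (by simpa using ht)]

theorem measurable_maxTally {Ω : Type*} [MeasurableSpace Ω] (c : ℕ) {x : ℕ → Ω → ℕ × ℕ × ℝ}
    (hx : ∀ t, Measurable (x t)) (m : ℕ) : Measurable fun ω => maxTally c (fun t => x t ω) m := by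
  induction m with
  | zero => exact measurable_const
  | succ m ih =>
    refine ih.max (Finset.measurable_sum _ fun t _ => ?_)
    unfold hit
    refine Measurable.ite (measurableSet_eq_fun ?_ ?_) measurable_const measurable_const
    · have := hx t
      fun_prop
    · have := hx m
      fun_prop

section Error

variable {n : ℕ → ℕ} {A : ∀ l : ℕ, Matrix (Fin (n l)) (Fin (n (l + 1))) ℝ} {k : ℕ}
  {W ε δ b : ℝ}

/-- The matrix of the averages of the samples number `c, …, c + m - 1`. -/
def estimateMatrix (n : ℕ → ℕ) (A : ∀ l : ℕ, Matrix (Fin (n l)) (Fin (n (l + 1))) ℝ) (k : ℕ)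
    (W : ℝ) (ω : ℕ → I) (c m : ℕ) : Matrix (Fin (n 0)) (Fin (n k)) ℝ :=
  Matrix.of fun i j => estimate n (entryFun n A) k W ω c m (i * n k + j)

theorem measurable_sample_mul (W : ℝ) :
    Measurable fun x : I => sample n (entryFun n A) k (x * W) :=
  (measurable_sample k).comp (measurable_subtype_coe.mul_const W)

/-- The set of the coins for which some entry of the estimate is wrong by more than `ε`. -/
def badCoins (n : ℕ → ℕ) (A : ∀ l : ℕ, Matrix (Fin (n l)) (Fin (n (l + 1))) ℝ) (k : ℕ)
    (W ε : ℝ) (c m : ℕ) : Set (ℕ → I) :=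
  {ω | ∃ i j, ε < |estimateMatrix n A k W ω c m i j - chainProd n A k i j|}

theorem measurableSet_badCoins (c m : ℕ) : MeasurableSet (badCoins n A k W ε c m) := by
  have hE : badCoins n A k W ε c m = ⋃ i, ⋃ j,
      {ω | ε < |estimateMatrix n A k W ω c m i j - chainProd n A k i j|} := by
    ext ω
    simp [badCoins]
  rw [hE]
  refine MeasurableSet.iUnion fun i => MeasurableSet.iUnion fun j =>
    measurableSet_lt measurable_const (continuous_abs.measurable.comp (Measurable.sub_const ?_ _))
  refine (Finset.measurable_sum _ fun t _ => ?_).const_mul _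
  exact measurable_comp_coin
    ((measurable_signedHit _ _).comp (measurable_sample_mul (A := A) (k := k) W)) (c + t)

/-- The error in the max-norm. -/
theorem measure_badCoins_le (hn : ∀ l ≤ k, 1 ≤ n l)
    (hW : W = startWeight n (entryFun n A) k (n 0)) (hW0 : 0 < W) (hε : 0 < ε) (hδ : 0 < δ)
    (hεb : ε ≤ b) (hb : ∀ i j, absChainProd n A k i j ≤ b) {L m : ℕ}
    (hL : L = Nat.clog 2 ⌈4 * (n 0 * n k : ℕ) / δ⌉₊) (hm0 : 1 ≤ m)
    (hm : 16 * b * W * L / (ε * ε) ≤ m) (c : ℕ) :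
    coinMeasure.real (badCoins n A k W ε c m) ≤ δ / 2 := by
  have hd : (0 : ℝ) < (n 0 * n k : ℕ) := by
    exact_mod_cast Nat.mul_pos (hn 0 (by omega)) (hn k le_rfl)
  have hb0 : 0 < b := hε.trans_le hεb
  have hm' : (0 : ℝ) < m := by exact_mod_cast hm0
  refine (measureReal_exists_exists_le coinMeasure (K := 2 * Real.exp (-L)) fun i j => ?_).trans ?_
  · refine (measureReal_mono ?_ (measure_ne_top _ _)).trans
      ((measure_abs_sum_sub_ge_le (s := ε / (2 * b)) (q := b / W)
        ((measurable_signedHit (n k) (i * n k + j)).comp (measurable_sample_mul (A := A) (k := k) W))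
        (fun x => abs_signedHit_le _ _ _) (by positivity) ?_ ?_ (m * ε / W) c m).trans ?_)
    · intro ω h
      simp only [Set.mem_ofPred_eq, estimateMatrix, Matrix.of_apply, estimate, Function.comp] at h ⊢
      rw [integral_signedHit hW hW0.ne']
      have h2 : W / m * ∑ t ∈ Finset.range m, signedHit (n k) (i * n k + j)
            (sample n (entryFun n A) k (ω (c + t) * W)) - chainProd n A k i j =
          W / m * (∑ t ∈ Finset.range m, signedHit (n k) (i * n k + j)
            (sample n (entryFun n A) k (ω (c + t) * W)) - m * (chainProd n A k i j / W)) := by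
        field_simp
      rw [h2, abs_mul, abs_of_pos (by positivity), div_mul_eq_mul_div, lt_div_iff₀ hm'] at h
      rw [div_le_iff₀ hW0]
      linarith
    · rw [div_le_one (by positivity)]
      linarith
    · simp only [Function.comp, signedHit_sq]
      rw [integral_hit hW hW0.ne']
      exact div_le_div_of_nonneg_right (hb i j) hW0.le
    · refine mul_le_mul_of_nonneg_left (Real.exp_le_exp.2 ?_) zero_le_two
      rw [div_le_iff₀ (by positivity)] at hm
      have h1 : -(ε / (2 * b) * (m * ε / W)) + m * ((ε / (2 * b)) ^ 2 * (b / W)) =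
          -(m * (ε * ε) / (4 * b * W)) := by
        field_simp
        ring
      rw [h1, neg_le_neg_iff, le_div_iff₀ (by positivity)]
      have : 0 ≤ b * W * L := by positivity
      linarith
  · calc ((n 0 * n k : ℕ) : ℝ) * (2 * Real.exp (-L))
        ≤ (n 0 * n k : ℕ) * (2 * (δ / (4 * (n 0 * n k : ℕ)))) := by
          rw [hL]
          gcongr
          exact exp_neg_clog_le hδ hd
      _ = δ / 2 := by
          field_simp
          norm_num

/-- The set of the coins for which the number of samples of some entry is far from its mean. -/
def miscounts (n : ℕ → ℕ) (A : ∀ l : ℕ, Matrix (Fin (n l)) (Fin (n (l + 1))) ℝ) (k : ℕ)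
    (W ε : ℝ) (m : ℕ) : Set (ℕ → I) :=
  {ω | ∃ (i : Fin (n 0)) (j : Fin (n k)), m * (absChainProd n A k i j / W) / 2 + m * ε / (2 * W) ≤
    |∑ t ∈ Finset.range m, hit (n k) (i * n k + j) (sample n (entryFun n A) k (ω (0 + t) * W)) -
      m * (absChainProd n A k i j / W)|}

theorem measure_miscounts_le (hn : ∀ l ≤ k, 1 ≤ n l)
    (hW : W = startWeight n (entryFun n A) k (n 0)) (hW0 : 0 < W) (hε : 0 < ε) (hδ : 0 < δ)
    {L m : ℕ} (hL : L = Nat.clog 2 ⌈4 * (n 0 * n k : ℕ) / δ⌉₊)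
    (hm : 16 * ε * W * L / (ε * ε) ≤ m) :
    coinMeasure.real (miscounts n A k W ε m) ≤ δ / 2 := by
  have hd : (0 : ℝ) < (n 0 * n k : ℕ) := by
    exact_mod_cast Nat.mul_pos (hn 0 (by omega)) (hn k le_rfl)
  refine (measureReal_exists_exists_le coinMeasure (K := 2 * Real.exp (-L)) fun i j => ?_).trans ?_
  · refine (measureReal_mono ?_ (measure_ne_top _ _)).trans
      ((measure_abs_sum_sub_ge_le (s := 1 / 2) (q := absChainProd n A k i j / W)
        ((measurable_hit (n k) (i * n k + j)).comp (measurable_sample_mul (A := A) (k := k) W))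
        (fun x => abs_hit_le _ _ _) (by norm_num) (by norm_num) ?_
        (m * (absChainProd n A k i j / W) / 2 + m * ε / (2 * W)) 0 m).trans ?_)
    · intro ω h
      simp only [Set.mem_ofPred_eq, Function.comp] at h ⊢
      rwa [integral_hit hW hW0.ne']
    · simp only [Function.comp, hit_sq]
      rw [integral_hit hW hW0.ne']
    · refine mul_le_mul_of_nonneg_left (Real.exp_le_exp.2 ?_) zero_le_two
      rw [div_le_iff₀ (by positivity)] at hm
      have h1 : -(1 / 2 * (m * (absChainProd n A k i j / W) / 2 + m * ε / (2 * W))) +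
          m * ((1 / 2) ^ 2 * (absChainProd n A k i j / W)) = -(m * ε / (4 * W)) := by
        field_simp
        ring
      rw [h1, neg_le_neg_iff, le_div_iff₀ (by positivity)]
      have h2 : 16 * W * L ≤ m * ε := by
        refine le_of_mul_le_mul_left ?_ hε
        linarith
      have : 0 ≤ W * L := by positivity
      linarith
  · calc ((n 0 * n k : ℕ) : ℝ) * (2 * Real.exp (-L))
        ≤ (n 0 * n k : ℕ) * (2 * (δ / (4 * (n 0 * n k : ℕ)))) := by
          rw [hL]
          gcongr
          exact exp_neg_clog_le hδ hd
      _ = δ / 2 := by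
          field_simp
          norm_num

/-- The bound that is computed from the first series of samples. -/
def empiricalBound (n : ℕ → ℕ) (A : ∀ l : ℕ, Matrix (Fin (n l)) (Fin (n (l + 1))) ℝ) (k : ℕ)
    (W ε : ℝ) (m : ℕ) (ω : ℕ → I) : ℝ :=
  2 * (maxTally (n k) (fun t => sample n (entryFun n A) k (ω (0 + t) * W)) m * W / m) + ε

theorem le_empiricalBound (hW0 : 0 < W) {m : ℕ} (hm : 1 ≤ m) {ω : ℕ → I}
    (hω : ω ∉ miscounts n A k W ε m) (i : Fin (n 0)) (j : Fin (n k)) :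
    absChainProd n A k i j ≤ empiricalBound n A k W ε m ω := by
  have hm' : (0 : ℝ) < m := by exact_mod_cast hm
  simp only [miscounts, Set.mem_ofPred_eq, not_exists, not_le] at hω
  have h1 := (abs_lt.1 (hω i j)).1
  have h2 := sum_hit_le_maxTally (n k) (fun t => sample n (entryFun n A) k (ω (0 + t) * W)) m
    (i * n k + j)
  have h3 : m * (absChainProd n A k i j / W) / 2 - m * ε / (2 * W) ≤
      maxTally (n k) (fun t => sample n (entryFun n A) k (ω (0 + t) * W)) m := by linarith
  have h4 := mul_le_mul_of_nonneg_right h3 (show 0 ≤ 2 * W / m by positivity)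
  have h5 : (m * (absChainProd n A k i j / W) / 2 - m * ε / (2 * W)) * (2 * W / m) =
      absChainProd n A k i j - ε := by
    field_simp
  rw [h5] at h4
  rw [empiricalBound]
  have h6 : maxTally (n k) (fun t => sample n (entryFun n A) k (ω (0 + t) * W)) m * (2 * W / m) =
    2 * (maxTally (n k) (fun t => sample n (entryFun n A) k (ω (0 + t) * W)) m * W / m) := by ring
  linarith

theorem empiricalBound_le (hn : ∀ l ≤ k, 1 ≤ n l) (hW0 : 0 < W) (hε : 0 < ε) {m : ℕ}
    (hm : 1 ≤ m) {ω : ℕ → I} (hω : ω ∉ miscounts n A k W ε m) {x : ℝ} (hx0 : 0 ≤ x)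
    (hx : ∀ i j, absChainProd n A k i j ≤ x) :
    empiricalBound n A k W ε m ω ≤ 3 * x + 2 * ε := by
  have hm' : (0 : ℝ) < m := by exact_mod_cast hm
  simp only [miscounts, Set.mem_ofPred_eq, not_exists, not_le] at hω
  have h : maxTally (n k) (fun t => sample n (entryFun n A) k (ω (0 + t) * W)) m ≤
      3 / 2 * (m * (x / W)) + m * ε / (2 * W) := by
    refine maxTally_le (by positivity) fun t _ => ?_
    have hb := sample_bounds (a := entryFun n A) hn (ω (0 + t) * W)
    have h1 := (abs_lt.1 (hω ⟨_, hb.1⟩ ⟨_, hb.2⟩)).2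
    have h2 := hx ⟨_, hb.1⟩ ⟨_, hb.2⟩
    have h3 : m * (absChainProd n A k ⟨_, hb.1⟩ ⟨_, hb.2⟩ / W) ≤ m * (x / W) := by gcongr
    simp only at h1
    linarith
  have h4 := mul_le_mul_of_nonneg_right h (show 0 ≤ 2 * W / m by positivity)
  have h5 : (3 / 2 * (m * (x / W)) + m * ε / (2 * W)) * (2 * W / m) = 3 * x + ε := by
    field_simp
  have h6 : maxTally (n k) (fun t => sample n (entryFun n A) k (ω (0 + t) * W)) m * (2 * W / m) =
    2 * (maxTally (n k) (fun t => sample n (entryFun n A) k (ω (0 + t) * W)) m * W / m) := by ring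
  rw [empiricalBound]
  linarith

theorem estimateMatrix_congr {ω ω' : ℕ → I} {c m : ℕ} (h : ∀ t < m, ω (c + t) = ω' (c + t)) :
    estimateMatrix n A k W ω c m = estimateMatrix n A k W ω' c m := by
  ext i j
  simp only [estimateMatrix, Matrix.of_apply, estimate]
  congr 1
  exact Finset.sum_congr rfl fun t ht => by rw [h t (Finset.mem_range.1 ht)]

/-- The error in the max-norm when the bound is computed from independent samples. -/
theorem measure_adaptive_le (hn : ∀ l ≤ k, 1 ≤ n l)
    (hW : W = startWeight n (entryFun n A) k (n 0)) (hW0 : 0 < W) (hε : 0 < ε) (hδ : 0 < δ)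
    (hδ1 : δ ≤ 1) {L m : ℕ} (hL : L = Nat.clog 2 ⌈4 * (n 0 * n k : ℕ) / δ⌉₊) (hm0 : 1 ≤ m)
    (hm : 16 * ε * W * L / (ε * ε) ≤ m) :
    coinMeasure.real (miscounts n A k W ε m ∪ {ω | ω ∈ badCoins n A k W ε m
      ⌈16 * empiricalBound n A k W ε m ω * W * L / (ε * ε)⌉₊}) ≤ δ := by
  classical
  have hL1 : 1 ≤ L := by
    rw [hL]
    exact clog_pos_of_le hδ (hδ1.trans
      (by exact_mod_cast Nat.mul_pos (hn 0 (by omega)) (hn k le_rfl)))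
  obtain ⟨β, hβ⟩ : ∃ β : ℕ → ℝ, β = fun N : ℕ => 2 * (N * W / m) + ε := ⟨_, rfl⟩
  obtain ⟨M, hM⟩ : ∃ M : ℕ → ℕ, M = fun N => ⌈16 * β N * W * L / (ε * ε)⌉₊ := ⟨_, rfl⟩
  obtain ⟨T, hT⟩ : ∃ T : (ℕ → I) → ℝ, T = fun ω => maxTally (n k)
    (fun t => sample n (entryFun n A) k (ω (0 + t) * W)) m := ⟨_, rfl⟩
  have hTm : Measurable T := by
    rw [hT]
    exact measurable_maxTally _ (fun t => measurable_comp_coin (measurable_sample_mul (k := k) W) _) _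
  have hβε : ∀ N, ε ≤ β N := fun N => by
    have : 0 ≤ 2 * (N * W / m) := by positivity
    rw [hβ]
    simp only
    linarith
  have hM1 : ∀ N, 1 ≤ M N := fun N => by
    have : 0 < β N := hε.trans_le (hβε N)
    rw [hM]
    refine Nat.one_le_iff_ne_zero.2 (Nat.ceil_pos.2 ?_).ne'
    positivity
  have hTE : ∀ N : ℕ, MeasurableSet {ω | T ω = N} := fun N =>
    measurableSet_eq_fun hTm measurable_const
  obtain ⟨G, hG⟩ : ∃ G : Finset ℕ, G = (Finset.range (m + 1)).filter
    fun N => ∀ i j, absChainProd n A k i j ≤ β N := ⟨_, rfl⟩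
  have hsub : miscounts n A k W ε m ∪ {ω | ω ∈ badCoins n A k W ε m
      ⌈16 * empiricalBound n A k W ε m ω * W * L / (ε * ε)⌉₊} ⊆
      miscounts n A k W ε m ∪ ⋃ N ∈ G, {ω | T ω = N} ∩ badCoins n A k W ε m (M N) := by
    intro ω hω
    by_cases hmis : ω ∈ miscounts n A k W ε m
    · exact Or.inl hmis
    refine Or.inr ?_
    have hbad := hω.resolve_left hmis
    obtain ⟨N, hN, hNeq⟩ := exists_maxTally_eq (n k)
      (fun t => sample n (entryFun n A) k (ω (0 + t) * W)) m
    have hβN : empiricalBound n A k W ε m ω = β N := by rw [hβ, empiricalBound, hNeq]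
    simp only [Set.mem_iUnion]
    refine ⟨N, ?_, ?_, ?_⟩
    · rw [hG, Finset.mem_filter, Finset.mem_range, ← hβN]
      exact ⟨hN, le_empiricalBound hW0 hm0 hmis⟩
    · rw [hT]
      exact hNeq
    · rw [Set.mem_ofPred_eq, hβN] at hbad
      rw [hM]
      exact hbad
  have hterm : ∀ N ∈ G, coinMeasure.real ({ω | T ω = N} ∩ badCoins n A k W ε m (M N)) ≤
      coinMeasure.real {ω | T ω = N} * (δ / 2) := by
    intro N hN
    rw [measure_inter_of_blocks (m := m) (m' := M N) (hTE N) (measurableSet_badCoins _ _)]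
    · refine mul_le_mul_of_nonneg_left (measure_badCoins_le hn hW hW0 hε hδ (hβε N) ?_ hL (hM1 N) ?_ m)
        measureReal_nonneg
      · rw [hG, Finset.mem_filter] at hN
        exact hN.2
      · rw [hM]
        exact Nat.le_ceil _
    · intro ω ω' h
      have : T ω = T ω' := by
        rw [hT]
        exact maxTally_congr fun t ht => by simp only [zero_add, h t ht]
      simp [this]
    · intro ω ω' h
      simp only [badCoins, Set.mem_ofPred_eq, estimateMatrix_congr h]
  have hone : ∑ N ∈ G, coinMeasure.real {ω | T ω = N} ≤ 1 := by
    rw [← measureReal_biUnion_finset (fun N _ N' _ hne => ?_) fun N _ => hTE N]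
    · exact measureReal_le_one
    · refine Set.disjoint_left.2 fun ω h h' => hne ?_
      have : (N : ℝ) = N' := h.symm.trans h'
      exact_mod_cast this
  calc _ ≤ _ := measureReal_mono hsub (measure_ne_top _ _)
    _ ≤ _ := measureReal_union_le _ _
    _ ≤ δ / 2 + ∑ N ∈ G, coinMeasure.real {ω | T ω = N} * (δ / 2) :=
      add_le_add (measure_miscounts_le hn hW hW0 hε hδ hL hm)
        ((measureReal_biUnion_finset_le _ _).trans (Finset.sum_le_sum hterm))
    _ ≤ δ := by
      rw [← Finset.sum_mul]
      have := mul_le_mul_of_nonneg_right hone (half_pos hδ).le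
      linarith

end Error

section Frobenius

variable {n : ℕ → ℕ} {A : ∀ l : ℕ, Matrix (Fin (n l)) (Fin (n (l + 1))) ℝ} {k : ℕ}
  {W ε δ : ℝ}

/-- The deviation of one sample from the scaled product, as a vector. -/
def sampleDeviation (n : ℕ → ℕ) (A : ∀ l : ℕ, Matrix (Fin (n l)) (Fin (n (l + 1))) ℝ) (k : ℕ)
    (W : ℝ) (x : I) : EuclideanSpace ℝ (Fin (n 0) × Fin (n k)) :=
  WithLp.toLp 2 (fun p => signedHit (n k) (p.1 * n k + p.2) (sample n (entryFun n A) k (x * W))) -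
    WithLp.toLp 2 (fun p => chainProd n A k p.1 p.2 / W)

theorem measurable_sampleDeviation : Measurable (sampleDeviation n A k W) := by
  refine Measurable.sub_const ((WithLp.measurable_toLp 2 _).comp (measurable_pi_lambda _ fun p => ?_)) _
  exact (measurable_signedHit _ _).comp (measurable_sample_mul W)

theorem norm_sampleDeviation_le (hn : ∀ l ≤ k, 1 ≤ n l)
    (hW : W = startWeight n (entryFun n A) k (n 0)) (hW0 : 0 < W) (x : I) :
    ‖sampleDeviation n A k W x‖ ≤ 2 := by
  have h1 : ‖(WithLp.toLp 2 fun p : Fin (n 0) × Fin (n k) => signedHit (n k) (p.1 * n k + p.2)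
      (sample n (entryFun n A) k (x * W)) : EuclideanSpace ℝ _)‖ ≤ 1 := by
    rw [← sq_le_one_iff₀ (norm_nonneg _), EuclideanSpace.norm_sq_eq]
    simp only [Real.norm_eq_abs, sq_abs, signedHit_sq]
    have hb := sample_bounds (a := entryFun n A) hn (x * W)
    rw [Fintype.sum_prod_type]
    refine le_of_eq ((sum_sum_index_eq (Matrix.of fun _ _ => 1) ⟨_, hb.1⟩ ⟨_, hb.2⟩).symm.trans ?_).symm
    simp [hit, eq_comm]
  have h2 : ‖(WithLp.toLp 2 fun p : Fin (n 0) × Fin (n k) => chainProd n A k p.1 p.2 / W :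
      EuclideanSpace ℝ _)‖ ≤ 1 := by
    rw [← sq_le_one_iff₀ (norm_nonneg _), EuclideanSpace.norm_sq_eq]
    simp only [Real.norm_eq_abs, sq_abs]
    rw [Fintype.sum_prod_type]
    have hsum : ∑ i, ∑ j, absChainProd n A k i j / W = 1 := by
      simp only [← Finset.sum_div, ← startWeight_eq, ← hW]
      exact div_self hW0.ne'
    rw [← hsum]
    refine Finset.sum_le_sum fun i _ => Finset.sum_le_sum fun j _ => ?_
    have hle : absChainProd n A k i j / W ≤ 1 := by
      rw [div_le_one hW0, hW, startWeight_eq]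
      exact (Finset.single_le_sum (f := fun j => absChainProd n A k i j)
        (fun _ _ => absChainProd_nonneg _ _ _) (Finset.mem_univ j)).trans
        (Finset.single_le_sum (f := fun i => ∑ j, absChainProd n A k i j)
          (fun _ _ => Finset.sum_nonneg fun _ _ => absChainProd_nonneg _ _ _) (Finset.mem_univ i))
    have h0 : 0 ≤ absChainProd n A k i j / W := div_nonneg (absChainProd_nonneg _ _ _) hW0.le
    have habs : |chainProd n A k i j / W| ≤ absChainProd n A k i j / W := by
      rw [abs_div, abs_of_pos hW0]
      exact div_le_div_of_nonneg_right (abs_chainProd_le _ _ _) hW0.le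
    calc (chainProd n A k i j / W) ^ 2 ≤ (absChainProd n A k i j / W) ^ 2 :=
          sq_le_sq' (by linarith [(abs_le.1 habs).1]) (abs_le.1 habs).2
      _ ≤ absChainProd n A k i j / W := by nlinarith
  exact (norm_sub_le _ _).trans (by linarith)

theorem integral_inner_sampleDeviation (hW : W = startWeight n (entryFun n A) k (n 0)) (hW0 : 0 < W)
    (s : EuclideanSpace ℝ (Fin (n 0) × Fin (n k))) :
    ∫ x, inner ℝ s (sampleDeviation n A k W x) = 0 := by
  have hint : ∀ p : Fin (n 0) × Fin (n k), Integrable (fun x : I => signedHit (n k)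
      (p.1 * n k + p.2) (sample n (entryFun n A) k (x * W))) volume := fun p =>
    Integrable.of_bound ((measurable_signedHit _ _).comp
      (measurable_sample_mul (A := A) (k := k) W)).aestronglyMeasurable 1
      (Filter.Eventually.of_forall fun x => abs_signedHit_le _ _ _)
  simp only [sampleDeviation, PiLp.inner_apply, PiLp.sub_apply, RCLike.inner_apply, conj_trivial]
  have hint' : ∀ p : Fin (n 0) × Fin (n k), Integrable (fun x : I => (signedHit (n k)
      (p.1 * n k + p.2) (sample n (entryFun n A) k (x * W)) - chainProd n A k p.1 p.2 / W) * s p)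
      volume := fun p => ((hint p).sub (integrable_const _)).mul_const _
  rw [integral_finsetSum _ fun p _ => hint' p]
  refine Finset.sum_eq_zero fun p _ => ?_
  rw [integral_mul_const, integral_sub (hint p) (integrable_const _), integral_signedHit hW hW0.ne']
  simp

/-- The error in the Frobenius norm. -/
theorem measure_frobenius_le (hn : ∀ l ≤ k, 1 ≤ n l)
    (hW : W = startWeight n (entryFun n A) k (n 0)) (hW0 : 0 < W) (hε : 0 < ε) (hδ : 0 < δ)
    {L m : ℕ} (hL : L = Nat.clog 2 ⌈4 * 1 / δ⌉₊) (hm0 : 1 ≤ m)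
    (hm : 16 * W * W * L / (ε * ε) ≤ m) :
    coinMeasure.real {ω | ε < elemNorm 2 2 (estimateMatrix n A k W ω 0 m - chainProd n A k)} ≤
      δ := by
  have hm' : (0 : ℝ) < m := by exact_mod_cast hm0
  have hnorm : ∀ ω : ℕ → I, ‖∑ t ∈ Finset.range m, sampleDeviation n A k W (ω (0 + t))‖ ^ 2 =
      (m / W * elemNorm 2 2 (estimateMatrix n A k W ω 0 m - chainProd n A k)) ^ 2 := by
    intro ω
    rw [mul_pow, elemNorm_two_sq, EuclideanSpace.norm_sq_eq, Fintype.sum_prod_type, Finset.mul_sum]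
    refine Finset.sum_congr rfl fun i _ => ?_
    rw [Finset.mul_sum]
    refine Finset.sum_congr rfl fun j _ => ?_
    rw [Real.norm_eq_abs, sq_abs, ← mul_pow]
    congr 1
    simp only [sampleDeviation, estimateMatrix, estimate, Finset.sum_sub_distrib, PiLp.sub_apply,
      WithLp.ofLp_sum, Finset.sum_apply, Matrix.sub_apply, Matrix.of_apply, Finset.sum_const,
      Finset.card_range, nsmul_eq_mul]
    simp only [PiLp.smul_apply, nsmul_eq_mul]
    have h1 : (m : ℝ) / W * (W / m) = 1 := by field_simp
    rw [mul_sub, ← mul_assoc, h1]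
    ring
  refine (measureReal_mono ?_ (measure_ne_top _ _)).trans ((measure_norm_sum_ge_le
    (X := sampleDeviation n A k W) measurable_sampleDeviation two_pos
    (norm_sampleDeviation_le hn hW hW0) (integral_inner_sampleDeviation hW hW0) hm0
    (τ := m * ε / W) (by positivity)).trans ?_)
  · intro ω h
    simp only [Set.mem_ofPred_eq] at h ⊢
    refine le_of_sq_le_sq ?_ (norm_nonneg _)
    rw [hnorm]
    refine pow_le_pow_left₀ (by positivity) ?_ 2
    rw [mul_div_right_comm]
    exact mul_le_mul_of_nonneg_left h.le (by positivity)
  · have h1 : (L : ℝ) ≤ (m * ε / W) ^ 2 / (4 * 2 ^ 2 * m) := by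
      rw [div_le_iff₀ (by positivity)] at hm
      rw [show (m * ε / W) ^ 2 / (4 * 2 ^ 2 * m) = m * (ε * ε) / (16 * W * W) by field_simp; ring,
        le_div_iff₀ (by positivity)]
      linarith
    have h2 : Real.exp (1 / 2) ≤ 2 := by
      have h3 := Real.add_one_le_exp (-(1 / 2) : ℝ)
      rw [Real.exp_neg, le_inv_comm₀ (by norm_num) (Real.exp_pos _)] at h3
      exact h3.trans (by norm_num)
    calc Real.exp (1 / 2 - (m * ε / W) ^ 2 / (4 * 2 ^ 2 * m)) ≤ Real.exp (1 / 2 + -L) :=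
          Real.exp_le_exp.2 (by linarith)
      _ = Real.exp (1 / 2) * Real.exp (-L) := Real.exp_add _ _
      _ ≤ 2 * (δ / (4 * 1)) := by
          rw [hL]
          gcongr
          exact exp_neg_clog_le hδ one_pos
      _ ≤ δ := by linarith

end Frobenius

/-! ### Running times -/

theorem clog_two_mul_log_le {y : ℝ} (hy : 1 < y) :
    (Nat.clog 2 ⌈y⌉₊ : ℝ) * Real.log 2 ≤ Real.log y + Real.log 2 := by
  have h2 : 2 ≤ ⌈y⌉₊ := Nat.lt_ceil.2 (by exact_mod_cast hy)
  obtain ⟨l, hl⟩ : ∃ l, Nat.clog 2 ⌈y⌉₊ = l + 1 :=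
    ⟨_, (Nat.succ_pred_eq_of_pos (Nat.clog_pos (by norm_num) h2)).symm⟩
  have h : 2 ^ l < ⌈y⌉₊ := by
    rw [← not_le, ← Nat.clog_le_iff_le_pow (by norm_num)]
    omega
  rw [Nat.lt_ceil] at h
  push_cast at h
  have h3 := Real.log_le_log (by positivity) h.le
  rw [Real.log_pow] at h3
  rw [hl]
  push_cast
  linarith

theorem softO_of_nonneg {C g : ℝ} {S : ℕ} (hS : 1 ≤ S) (hg : 0 ≤ g) (hC : 0 ≤ C) :
    C * (1 + g) ≤ softO C 1 S g := by
  have hS' : (1 : ℝ) ≤ S := by exact_mod_cast hS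
  rw [softO, pow_one]
  refine le_mul_of_one_le_right (by positivity) ?_
  rw [Real.le_log_iff_exp_le (by positivity)]
  linarith [Real.exp_one_lt_d9]

theorem time_le_softO {k S L m m' : ℕ} {M x δ g : ℝ} (hk : 1 ≤ k) (hS : 1 ≤ S) (hδ : 0 < δ)
    (hx : δ ≤ x) (hL : L = Nat.clog 2 ⌈4 * x / δ⌉₊) (hM : 1 ≤ M)
    (hg : g = k * M * Real.log (2 * x / δ)) (hm : (m : ℝ) ≤ 80 * M * L + 1)
    (hm' : (m' : ℝ) ≤ 80 * M * L + 1) :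
    ((40 + 3 * L + 60 * ((m + 1) * ((k + 1) * (Nat.clog 2 S + 1))) +
      60 * ((m' + 1) * ((k + 1) * (Nat.clog 2 S + 1))) : ℕ) : ℝ) ≤ softO 500000 1 S g := by
  have hlog2 := Real.log_two_gt_d9
  have hk' : (1 : ℝ) ≤ k := by exact_mod_cast hk
  have hS' : (1 : ℝ) ≤ S := by exact_mod_cast hS
  have hxδ : 1 ≤ x / δ := (one_le_div hδ).2 hx
  obtain ⟨l, hl⟩ : ∃ l, l = Real.log (2 * x / δ) := ⟨_, rfl⟩
  have hl2 : Real.log 2 ≤ l := by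
    rw [hl]
    exact Real.log_le_log two_pos (by rw [mul_div_assoc]; linarith)
  have hl0 : 0 < l := by linarith
  have hLl : (L : ℝ) ≤ 5 * l := by
    have h := clog_two_mul_log_le (y := 4 * x / δ) (by rw [mul_div_assoc]; linarith)
    have h4 : Real.log (4 * x / δ) = Real.log 2 + l := by
      rw [hl, ← Real.log_mul (by norm_num) (by rw [mul_div_assoc]; positivity)]
      congr 1
      ring
    rw [← hL, h4] at h
    have : (L : ℝ) * 0.6 ≤ L * Real.log 2 := by gcongr; linarith
    linarith
  rw [← hl] at hg
  have hgk : k * l ≤ g := by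
    rw [hg]
    have : 0 ≤ k * l := by positivity
    nlinarith
  have hg0 : 0 ≤ g := le_trans (by positivity) hgk
  have hlg : l ≤ g := le_trans (by nlinarith) hgk
  have hkg : (k : ℝ) ≤ 2 * g := by nlinarith
  obtain ⟨Λ, hΛ⟩ : ∃ Λ, Λ = Real.log (2 + S + g) := ⟨_, rfl⟩
  have hΛ1 : 1 ≤ Λ := by
    rw [hΛ, Real.le_log_iff_exp_le (by positivity)]
    linarith [Real.exp_one_lt_d9]
  have hB : (Nat.clog 2 S : ℝ) + 1 ≤ 4 * Λ := by
    rcases eq_or_lt_of_le hS with h | h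
    · rw [← h]
      norm_num
      linarith
    · have h1 := clog_two_mul_log_le (y := S) (by exact_mod_cast h)
      rw [Nat.ceil_natCast] at h1
      have h2 : Real.log S ≤ Λ := by
        rw [hΛ]
        exact Real.log_le_log (by positivity) (by linarith)
      have : (Nat.clog 2 S : ℝ) * 0.6 ≤ Nat.clog 2 S * Real.log 2 := by gcongr; linarith
      have := Real.log_two_lt_d9
      linarith
  have key : ∀ r : ℕ, (r : ℝ) ≤ 80 * M * L + 1 →
      60 * ((r + 1) * ((k + 1) * ((Nat.clog 2 S : ℝ) + 1))) ≤ 200000 * g * Λ := by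
    intro r hr
    have h1 : (r : ℝ) + 1 ≤ 400 * (M * l) + 2 := by
      have : 80 * M * (L : ℝ) ≤ 80 * M * (5 * l) := by gcongr
      linarith
    have h2 : ((r : ℝ) + 1) * (k + 1) ≤ 808 * g := by
      calc ((r : ℝ) + 1) * (k + 1) ≤ (400 * (M * l) + 2) * (2 * k) := by
            gcongr
            linarith
        _ = 800 * g + 4 * k := by rw [hg]; ring
        _ ≤ 808 * g := by linarith
    calc 60 * (((r : ℝ) + 1) * ((k + 1) * ((Nat.clog 2 S : ℝ) + 1)))
        = 60 * ((((r : ℝ) + 1) * (k + 1)) * ((Nat.clog 2 S : ℝ) + 1)) := by ring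
      _ ≤ 60 * (808 * g * (4 * Λ)) := by gcongr
      _ ≤ 200000 * g * Λ := by
        have : 0 ≤ g * Λ := by positivity
        linarith
  have h1 := key m hm
  have h2 := key m' hm'
  rw [softO, pow_one, ← hΛ]
  push_cast
  have h3 : 1 + g ≤ (1 + g) * Λ := le_mul_of_one_le_right (by positivity) hΛ1
  have h4 : 0 ≤ g * Λ := by positivity
  nlinarith

theorem dim_le_inputSize {n : ℕ → ℕ} {k l : ℕ} (hk : 1 ≤ k) (hn : ∀ l ≤ k, 1 ≤ n l) (hl : l ≤ k) :
    n l ≤ inputSize n k := by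
  have hle : ∀ q < k, n q * n (q + 1) ≤ inputSize n k := fun q hq =>
    Finset.single_le_sum (f := fun q => n q * n (q + 1)) (fun _ _ => Nat.zero_le _)
      (Finset.mem_range.2 hq)
  rcases hl.lt_or_eq with h | h
  · exact (Nat.le_mul_of_pos_right _ (hn (l + 1) h)).trans (hle l h)
  · obtain ⟨q, rfl⟩ : ∃ q, k = q + 1 := ⟨k - 1, by omega⟩
    subst h
    exact (Nat.le_mul_of_pos_left _ (hn q (by omega))).trans (hle q (by omega))

theorem RamProg.Wp.haltsIn {ω : ℕ → I} {P : RamProg} {s : RamState} {T : ℝ} {Q : RamState → Prop}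
    (h : P.Wp ω (fun s' c => (c : ℝ) ≤ T ∧ Q s') s 0) : P.HaltsIn ω s T Q := by
  obtain ⟨s', t, h1, h2, h3⟩ := h
  rw [zero_add] at h2
  exact ⟨s', t, h1, h2, h3⟩

theorem measure_le_ofReal {Ω : Type*} [MeasurableSpace Ω] {μ : Measure Ω} [IsFiniteMeasure μ]
    {E F : Set Ω} {δ : ℝ} (h : E ⊆ F) (hF : μ.real F ≤ δ) : μ E ≤ ENNReal.ofReal δ := by
  refine (measure_mono h).trans ?_
  rw [← ofReal_measureReal]
  exact ENNReal.ofReal_le_ofReal hF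

section Main

variable {n : ℕ → ℕ} {A : ∀ l : ℕ, Matrix (Fin (n l)) (Fin (n (l + 1))) ℝ} {k F : ℕ}
  {mem : ℕ → ℝ} {ε δ : ℝ}

theorem returns_estimateMatrix {s : RamState} {Z c m : ℕ} {W : ℝ} {ω : ℕ → I}
    (h0 : s.reg 0 = (Z : ℕ))
    (h : ∀ y < n 0 * n k, s.mem (Z + y) = estimate n (entryFun n A) k W ω c m y) :
    s.Returns (estimateMatrix n A k W ω c m) := by
  refine ⟨Z, h0, ?_⟩
  ext i j
  rw [RamState.matrixAt, estimateMatrix, Matrix.of_apply, Matrix.of_apply, add_assoc,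
    h _ (index_lt i.2 j.2)]

theorem returns_zero {s : RamState} {Z r c : ℕ} (h0 : s.reg 0 = (Z : ℕ))
    (h : ∀ y, s.mem (Z + y) = 0) : s.Returns (0 : Matrix (Fin r) (Fin c) ℝ) := by
  refine ⟨Z, h0, ?_⟩
  ext i j
  rw [RamState.matrixAt, Matrix.of_apply, add_assoc, h, Matrix.zero_apply]

theorem elemNorm_one_absChainProd :
    elemNorm 1 1 (absChainProd n A k) = startWeight n (entryFun n A) k (n 0) := by
  rw [elemNorm_one, startWeight_eq]
  simp only [abs_of_nonneg (absChainProd_nonneg _ _ _)]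

theorem absChainProd_le_elemNorm_top (i : Fin (n 0)) (j : Fin (n k)) :
    absChainProd n A k i j ≤ elemNorm ∞ ∞ (absChainProd n A k) :=
  (le_abs_self _).trans ((elemNorm_top_le_iff (elemNorm_top_nonneg _)).1 le_rfl i j)

theorem elemNorm_top_zero_sub_le {x : ℝ} (h : elemNorm ∞ ∞ (absChainProd n A k) ≤ x) :
    elemNorm ∞ ∞ (0 - chainProd n A k) ≤ x := by
  refine (elemNorm_top_le_iff ((elemNorm_top_nonneg _).trans h)).2 fun i j => ?_
  rw [zero_sub, Matrix.neg_apply, abs_neg]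
  exact (abs_chainProd_le _ _ _).trans ((absChainProd_le_elemNorm_top i j).trans h)

theorem elemNorm_top_le_elemNorm_one :
    elemNorm ∞ ∞ (absChainProd n A k) ≤ elemNorm 1 1 (absChainProd n A k) := by
  rw [elemNorm_one]
  refine (elemNorm_top_le_iff (Finset.sum_nonneg fun _ _ => Finset.sum_nonneg fun _ _ =>
    abs_nonneg _)).2 fun i j => ?_
  exact (Finset.single_le_sum (f := fun j => |absChainProd n A k i j|)
    (fun _ _ => abs_nonneg _) (Finset.mem_univ j)).trans
    (Finset.single_le_sum (f := fun i => ∑ j, |absChainProd n A k i j|)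
      (fun _ _ => Finset.sum_nonneg fun _ _ => abs_nonneg _) (Finset.mem_univ i))

theorem elemNorm_two_zero_sub_le :
    elemNorm 2 2 (0 - chainProd n A k) ≤ elemNorm 1 1 (absChainProd n A k) := by
  have h0 : 0 ≤ elemNorm 1 1 (absChainProd n A k) :=
    (elemNorm_top_nonneg _).trans elemNorm_top_le_elemNorm_one
  refine le_of_sq_le_sq ?_ h0
  rw [elemNorm_two_sq, sq (elemNorm 1 1 _)]
  nth_rewrite 1 [elemNorm_one]
  rw [Finset.sum_mul]
  refine Finset.sum_le_sum fun i _ => ?_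
  rw [Finset.sum_mul]
  refine Finset.sum_le_sum fun j _ => ?_
  have h1 := abs_chainProd_le (A := A) k i j
  have h2 := (absChainProd_le_elemNorm_top (A := A) i j).trans elemNorm_top_le_elemNorm_one
  rw [zero_sub, Matrix.neg_apply, neg_sq, ← sq_abs, sq, abs_of_nonneg (absChainProd_nonneg _ _ _)]
  exact mul_le_mul h1 (h1.trans h2) (abs_nonneg _) (absChainProd_nonneg _ _ _)

theorem ceil_div_le {b W M : ℝ} {L : ℕ} (hb : 0 ≤ b * W) (hM : b * W / (ε * ε) ≤ 5 * M) :
    (⌈16 * b * W * L / (ε * ε)⌉₊ : ℝ) ≤ 80 * M * L + 1 := by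
  have h0 : 16 * b * W * L / (ε * ε) = 16 * L * (b * W / (ε * ε)) := by ring
  have h1 : 0 ≤ ε * ε := mul_self_nonneg ε
  rw [h0]
  refine (Nat.ceil_lt_add_one (by positivity)).le.trans ?_
  have : 16 * (L : ℝ) * (b * W / (ε * ε)) ≤ 16 * L * (5 * M) := by gcongr
  linarith

theorem one_le_inputSize (hk : 1 ≤ k) (hn : ∀ l ≤ k, 1 ≤ n l) : 1 ≤ inputSize n k :=
  (hn 0 (by omega)).trans (dim_le_inputSize hk hn (by omega))

end Main

/-! ### Correctness of the query programs -/

section Main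

variable {n : ℕ → ℕ} {A : ∀ l : ℕ, Matrix (Fin (n l)) (Fin (n (l + 1))) ℝ} {k F : ℕ}
  {mem : ℕ → ℝ} {ε δ b g : ℝ}

theorem cast_le_softO {t S : ℕ} (ht : t ≤ 26) (hS : 1 ≤ S) (hg : 0 ≤ g) :
    (t : ℝ) ≤ softO 500000 1 S g := by
  have h : (t : ℝ) ≤ 26 := by exact_mod_cast ht
  have := softO_of_nonneg (C := 500000) hS hg (by norm_num)
  linarith

theorem startWeight_nonneg : 0 ≤ startWeight n (entryFun n A) k (n 0) := by
  rw [startWeight]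
  exact Finset.sum_nonneg fun _ _ => pathWeight_nonneg _ _ _

theorem log_dim_nonneg (hn : ∀ l ≤ k, 1 ≤ n l) (hδ : 0 < δ) (hδ1 : δ < 1) :
    0 ≤ Real.log (2 * (n 0 * n k) / δ) ∧ δ ≤ (n 0 * n k : ℕ) := by
  have h : (1 : ℝ) ≤ (n 0 * n k : ℕ) := by
    exact_mod_cast Nat.mul_pos (hn 0 (by omega)) (hn k le_rfl)
  refine ⟨Real.log_nonneg ?_, by linarith⟩
  push_cast at h
  rw [le_div_iff₀ hδ]
  linarith

theorem givenBoundProg_spec (hk : 1 ≤ k) (hn : ∀ l ≤ k, 1 ≤ n l)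
    (hs : Prepared n (entryFun n A) k F mem) (hε : 0 < ε) (hδ : 0 < δ) (hδ1 : δ < 1)
    (hb : elemNorm ∞ ∞ (absChainProd n A k) ≤ b) :
    (∀ ω : ℕ → I, givenBoundProg.HaltsIn ω (queryState [ε, δ, b] mem)
      (softO 500000 1 (inputSize n k)
        (k * (b * elemNorm 1 1 (absChainProd n A k) / ε ^ 2) * Real.log (2 * (n 0 * n k) / δ)))
      fun s => ∃ B : Matrix (Fin (n 0)) (Fin (n k)) ℝ, s.Returns B) ∧
    coinMeasure {ω | ¬ ∃ T : ℝ, givenBoundProg.HaltsIn ω (queryState [ε, δ, b] mem) T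
        fun s => ∃ B : Matrix (Fin (n 0)) (Fin (n k)) ℝ,
          s.Returns B ∧ elemNorm ∞ ∞ (B - chainProd n A k) ≤ ε} ≤ ENNReal.ofReal δ := by
  have hS := one_le_inputSize hk hn
  obtain ⟨hlog, hd⟩ := log_dim_nonneg hn hδ hδ1
  obtain ⟨W, hW⟩ : ∃ W, W = startWeight n (entryFun n A) k (n 0) := ⟨_, rfl⟩
  have hW0 : 0 ≤ W := hW ▸ startWeight_nonneg
  have hx0 := elemNorm_top_nonneg (absChainProd n A k)
  have hb0 := hx0.trans hb
  have hxW := elemNorm_top_le_elemNorm_one (n := n) (A := A) (k := k)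
  rw [elemNorm_one_absChainProd, ← hW] at hxW ⊢
  obtain ⟨L, hL⟩ : ∃ L, L = Nat.clog 2 ⌈4 * (n 0 * n k : ℕ) / δ⌉₊ := ⟨_, rfl⟩
  obtain ⟨m, hm⟩ : ∃ m, m = ⌈16 * b * W * L / (ε * ε)⌉₊ := ⟨_, rfl⟩
  have hB : ∀ l ≤ k, Nat.clog 2 (n l) ≤ Nat.clog 2 (inputSize n k) := fun l hl =>
    Nat.clog_mono_right 2 (dim_le_inputSize hk hn hl)
  have hg0 : 0 ≤ k * (b * W / ε ^ 2) * Real.log (2 * (n 0 * n k) / δ) := by positivity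
  have hsmall : b ≤ ε ∨ b * W ≤ ε * ε → elemNorm ∞ ∞ (0 - chainProd n A k) ≤ ε := by
    refine fun h => elemNorm_top_zero_sub_le (h.elim hb.trans fun h => ?_)
    exact abs_le_of_sq_le_sq' (by rw [sq, sq]; exact (mul_le_mul hb hxW hx0 hb0).trans h) hε.le |>.2
  constructor
  · intro ω
    refine RamProg.Wp.haltsIn (wp_givenBoundProg hk hn hB hs hε hδ hδ1.le hW hL hm ?_ ?_)
    · intro _ s' c' h0 hmem hc'
      exact ⟨cast_le_softO hc' hS hg0, 0, returns_zero h0 fun y => by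
        rw [hmem]; exact hs.zero _ (by omega)⟩
    · intro hεb hbW s' c' h0 hres hc'
      refine ⟨?_, _, returns_estimateMatrix h0 hres⟩
      have hM : 1 ≤ b * W / (ε * ε) := (one_le_div (by positivity)).2 hbW.le
      have hmM : (m : ℝ) ≤ 80 * (b * W / (ε * ε)) * L + 1 := by
        rw [hm]
        exact ceil_div_le (by positivity) (by linarith)
      refine le_trans ?_ (time_le_softO (m' := m) hk hS hδ hd hL hM ?_ hmM hmM)
      · exact_mod_cast hc'.trans (by omega)
      · rw [← sq]
        push_cast
        rfl
  · by_cases h : ε < b ∧ ε * ε < b * W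
    · obtain ⟨hεb, hbW⟩ := h
      have hWpos : 0 < W := hW0.lt_of_ne' fun h0 => by
        rw [h0, mul_zero] at hbW
        nlinarith
      have hL1 : 1 ≤ L := hL ▸ clog_pos_of_le hδ hd
      have hbpos : 0 < b := hε.trans hεb
      have hm0 : 1 ≤ m := by
        rw [hm]
        exact Nat.one_le_iff_ne_zero.2 (Nat.ceil_pos.2 (by positivity)).ne'
      refine measure_le_ofReal (F := badCoins n A k W ε 0 m) (fun ω hω => ?_)
        ((measure_badCoins_le hn hW hWpos hε hδ hεb.le
          (fun i j => (absChainProd_le_elemNorm_top i j).trans hb) hL hm0 (hm ▸ Nat.le_ceil _)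
          0).trans (by linarith))
      by_contra hbad
      refine hω ?_
      obtain ⟨s', t, hex, hQ⟩ := wp_givenBoundProg (ω := ω) (Q := fun s' _ =>
        s'.Returns (estimateMatrix n A k W ω 0 m)) hk hn hB hs hε hδ hδ1.le hW hL hm
        (fun h' => by rcases h' with h' | h' <;> linarith)
        (fun _ _ s' c' h0 hres _ => returns_estimateMatrix h0 hres)
      refine ⟨t, s', t, hex, le_rfl, _, hQ, (elemNorm_top_le_iff hε.le).2 fun i j => ?_⟩
      by_contra hlt
      exact hbad ⟨i, j, not_le.1 hlt⟩
    · refine measure_le_ofReal (F := ∅) (fun ω hω => hω ?_) (by simpa using hδ.le)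
      have h' : b ≤ ε ∨ b * W ≤ ε * ε := by
        rw [not_and_or, not_lt, not_lt] at h
        exact h
      obtain ⟨s', t, hex, hQ⟩ := wp_givenBoundProg (ω := ω) (Q := fun s' _ =>
        s'.Returns (0 : Matrix (Fin (n 0)) (Fin (n k)) ℝ)) hk hn hB hs hε hδ hδ1.le hW hL hm
        (fun _ s' c' h0 hmem _ => returns_zero h0 fun y => by
          rw [hmem]; exact hs.zero _ (by omega))
        (fun h1 h2 => absurd ⟨h1, h2⟩ h)
      exact ⟨t, s', t, hex, le_rfl, 0, hQ, hsmall h'⟩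

theorem frobeniusProg_spec (hk : 1 ≤ k) (hn : ∀ l ≤ k, 1 ≤ n l)
    (hs : Prepared n (entryFun n A) k F mem) (hε : 0 < ε) (hδ : 0 < δ) (hδ1 : δ < 1) :
    (∀ ω : ℕ → I, frobeniusProg.HaltsIn ω (queryState [ε, δ] mem)
      (softO 500000 1 (inputSize n k)
        (k * (elemNorm 1 1 (absChainProd n A k) ^ 2 / ε ^ 2) * Real.log (2 / δ)))
      fun s => ∃ B : Matrix (Fin (n 0)) (Fin (n k)) ℝ, s.Returns B) ∧
    coinMeasure {ω | ¬ ∃ T : ℝ, frobeniusProg.HaltsIn ω (queryState [ε, δ] mem) T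
        fun s => ∃ B : Matrix (Fin (n 0)) (Fin (n k)) ℝ,
          s.Returns B ∧ elemNorm 2 2 (B - chainProd n A k) ≤ ε} ≤ ENNReal.ofReal δ := by
  have hS := one_le_inputSize hk hn
  obtain ⟨W, hW⟩ : ∃ W, W = startWeight n (entryFun n A) k (n 0) := ⟨_, rfl⟩
  have hW0 : 0 ≤ W := hW ▸ startWeight_nonneg
  have hxW := elemNorm_two_zero_sub_le (n := n) (A := A) (k := k)
  rw [elemNorm_one_absChainProd, ← hW] at hxW ⊢
  obtain ⟨L, hL⟩ : ∃ L, L = Nat.clog 2 ⌈4 * 1 / δ⌉₊ := ⟨_, rfl⟩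
  obtain ⟨m, hm⟩ : ∃ m, m = ⌈16 * W * W * L / (ε * ε)⌉₊ := ⟨_, rfl⟩
  have hB : ∀ l ≤ k, Nat.clog 2 (n l) ≤ Nat.clog 2 (inputSize n k) := fun l hl =>
    Nat.clog_mono_right 2 (dim_le_inputSize hk hn hl)
  have hlog : 0 ≤ Real.log (2 / δ) := Real.log_nonneg (by rw [le_div_iff₀ hδ]; linarith)
  have hg0 : 0 ≤ k * (W ^ 2 / ε ^ 2) * Real.log (2 / δ) := by positivity
  have hsmall : W * W ≤ ε * ε → elemNorm 2 2 (0 - chainProd n A k) ≤ ε := fun h =>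
    hxW.trans (abs_le_of_sq_le_sq' (by rw [sq, sq]; exact h) hε.le).2
  constructor
  · intro ω
    refine RamProg.Wp.haltsIn (wp_frobeniusProg hk hn hB hs hε hδ hδ1.le hW hL hm ?_ ?_)
    · intro _ s' h0 hmem
      exact ⟨cast_le_softO (by norm_num) hS hg0, 0, returns_zero h0 fun y => by
        rw [hmem]; exact hs.zero _ (by omega)⟩
    · intro hWW s' c' h0 hres hc'
      refine ⟨?_, _, returns_estimateMatrix h0 hres⟩
      have hM : 1 ≤ W * W / (ε * ε) := (one_le_div (by positivity)).2 hWW.le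
      have hmM : (m : ℝ) ≤ 80 * (W * W / (ε * ε)) * L + 1 := by
        rw [hm]
        exact ceil_div_le (by positivity) (by linarith)
      refine le_trans ?_ (time_le_softO (m' := m) (x := 1) hk hS hδ hδ1.le hL hM ?_ hmM hmM)
      · exact_mod_cast hc'.trans (by omega)
      · rw [← sq, ← sq, mul_one]
  · by_cases h : ε * ε < W * W
    · have hWpos : 0 < W := hW0.lt_of_ne' fun h0 => by
        rw [h0, mul_zero] at h
        nlinarith
      have hL1 : 1 ≤ L := hL ▸ clog_pos_of_le hδ hδ1.le
      have hm0 : 1 ≤ m := by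
        rw [hm]
        exact Nat.one_le_iff_ne_zero.2 (Nat.ceil_pos.2 (by positivity)).ne'
      refine measure_le_ofReal (fun ω hω => ?_)
        (measure_frobenius_le hn hW hWpos hε hδ hL hm0 (hm ▸ Nat.le_ceil _))
      by_contra hbad
      refine hω ?_
      obtain ⟨s', t, hex, hQ⟩ := wp_frobeniusProg (ω := ω) (Q := fun s' _ =>
        s'.Returns (estimateMatrix n A k W ω 0 m)) hk hn hB hs hε hδ hδ1.le hW hL hm
        (fun h' => absurd h (not_lt.2 h'))
        (fun _ s' c' h0 hres _ => returns_estimateMatrix h0 hres)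
      exact ⟨t, s', t, hex, le_rfl, _, hQ, not_lt.1 hbad⟩
    · refine measure_le_ofReal (F := ∅) (fun ω hω => hω ?_) (by simpa using hδ.le)
      obtain ⟨s', t, hex, hQ⟩ := wp_frobeniusProg (ω := ω) (Q := fun s' _ =>
        s'.Returns (0 : Matrix (Fin (n 0)) (Fin (n k)) ℝ)) hk hn hB hs hε hδ hδ1.le hW hL hm
        (fun _ s' h0 hmem => returns_zero h0 fun y => by
          rw [hmem]; exact hs.zero _ (by omega))
        (fun h1 => absurd h1 h)
      exact ⟨t, s', t, hex, le_rfl, 0, hQ, hsmall (not_lt.1 h)⟩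

theorem adaptiveProg_spec (hk : 1 ≤ k) (hn : ∀ l ≤ k, 1 ≤ n l)
    (hs : Prepared n (entryFun n A) k F mem) (hε : 0 < ε) (hδ : 0 < δ) (hδ1 : δ < 1) :
    (∀ ω : ℕ → I, ∃ T : ℝ, adaptiveProg.HaltsIn ω (queryState [ε, δ] mem) T fun _ => True) ∧
    coinMeasure {ω | ¬ adaptiveProg.HaltsIn ω (queryState [ε, δ] mem)
        (softO 500000 1 (inputSize n k)
          (k * (max (elemNorm ∞ ∞ (absChainProd n A k)) ε *
            elemNorm 1 1 (absChainProd n A k) / ε ^ 2) * Real.log (2 * (n 0 * n k) / δ)))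
        fun s => ∃ B : Matrix (Fin (n 0)) (Fin (n k)) ℝ,
          s.Returns B ∧ elemNorm ∞ ∞ (B - chainProd n A k) ≤ ε} ≤ ENNReal.ofReal δ := by
  have hS := one_le_inputSize hk hn
  obtain ⟨hlog, hd⟩ := log_dim_nonneg hn hδ hδ1
  obtain ⟨W, hW⟩ : ∃ W, W = startWeight n (entryFun n A) k (n 0) := ⟨_, rfl⟩
  have hW0 : 0 ≤ W := hW ▸ startWeight_nonneg
  have hx := absChainProd_le_elemNorm_top (n := n) (A := A) (k := k)
  have hx0 := elemNorm_top_nonneg (absChainProd n A k)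
  have hxW := elemNorm_top_le_elemNorm_one (n := n) (A := A) (k := k)
  have hxP := elemNorm_top_zero_sub_le (n := n) (A := A) (k := k) hxW
  rw [elemNorm_one_absChainProd, ← hW] at hxW hxP ⊢
  obtain ⟨x, hxx⟩ : ∃ x, x = elemNorm ∞ ∞ (absChainProd n A k) := ⟨_, rfl⟩
  rw [← hxx] at hx0 hxW hx ⊢
  obtain ⟨L, hL⟩ : ∃ L, L = Nat.clog 2 ⌈4 * (n 0 * n k : ℕ) / δ⌉₊ := ⟨_, rfl⟩
  obtain ⟨m, hm⟩ : ∃ m, m = ⌈16 * ε * W * L / (ε * ε)⌉₊ := ⟨_, rfl⟩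
  have hB : ∀ l ≤ k, Nat.clog 2 (n l) ≤ Nat.clog 2 (inputSize n k) := fun l hl =>
    Nat.clog_mono_right 2 (dim_le_inputSize hk hn hl)
  have hmax : 0 < max x ε := lt_max_of_lt_right hε
  have hg0 : 0 ≤ k * (max x ε * W / ε ^ 2) * Real.log (2 * (n 0 * n k) / δ) := by positivity
  constructor
  · intro ω
    obtain ⟨s', t, hex, -⟩ := wp_adaptiveProg (ω := ω) (Q := fun _ _ => True) hk hn hB hs hε hδ
      hδ1.le hW hL hm (b := empiricalBound n A k W ε m ω) rfl rfl
      (fun _ _ _ _ => trivial) (fun _ _ _ _ _ _ _ _ => trivial)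
    exact ⟨t, s', t, hex, le_rfl, trivial⟩
  by_cases h : ε * ε < ε * W
  · have hεW : ε < W := lt_of_mul_lt_mul_left h hε.le
    have hWpos : 0 < W := hε.trans hεW
    have hL1 : 1 ≤ L := hL ▸ clog_pos_of_le hδ hd
    have hm0 : 1 ≤ m := by
      rw [hm]
      exact Nat.one_le_iff_ne_zero.2 (Nat.ceil_pos.2 (by positivity)).ne'
    refine measure_le_ofReal (fun ω hω => ?_)
      (measure_adaptive_le hn hW hWpos hε hδ hδ1.le hL hm0 (hm ▸ Nat.le_ceil _))
    by_contra hbad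
    rw [Set.mem_union, not_or, Set.mem_ofPred_eq] at hbad
    obtain ⟨hmis, hbad⟩ := hbad
    refine hω (RamProg.Wp.haltsIn (wp_adaptiveProg hk hn hB hs hε hδ hδ1.le hW hL hm
      (b := empiricalBound n A k W ε m ω) rfl rfl (fun h' => absurd h (not_lt.2 h')) ?_))
    intro _ _ _ s' c' h0 hres hc'
    refine ⟨?_, _, returns_estimateMatrix h0 hres, (elemNorm_top_le_iff hε.le).2 fun i j => ?_⟩
    · have hM : 1 ≤ max x ε * W / (ε * ε) := (one_le_div (by positivity)).2
        (h.le.trans (by gcongr; exact le_max_right _ _))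
      have hb1 : empiricalBound n A k W ε m ω ≤ 5 * max x ε := by
        have := empiricalBound_le hn hWpos hε hm0 hmis hx0 hx
        linarith [le_max_left x ε, le_max_right x ε]
      have hb0 : 0 ≤ empiricalBound n A k W ε m ω :=
        (absChainProd_nonneg k ⟨0, hn 0 (by omega)⟩ ⟨0, hn k le_rfl⟩).trans
          (le_empiricalBound hWpos hm0 hmis _ _)
      refine le_trans ?_ (time_le_softO hk hS hδ hd hL hM ?_
        (m := m) (m' := ⌈16 * empiricalBound n A k W ε m ω * W * L / (ε * ε)⌉₊) ?_ ?_)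
      · exact_mod_cast hc'
      · rw [← sq]
        push_cast
        rfl
      · rw [hm]
        refine ceil_div_le (by positivity) ?_
        have : ε * W / (ε * ε) ≤ max x ε * W / (ε * ε) := by
          gcongr
          exact le_max_right _ _
        linarith
      · refine ceil_div_le (by positivity) ?_
        rw [← mul_div_assoc, ← mul_assoc]
        gcongr
    · by_contra hlt
      exact hbad ⟨i, j, not_le.1 hlt⟩
  · refine measure_le_ofReal (F := ∅) (fun ω hω => hω ?_) (by simpa using hδ.le)
    refine RamProg.Wp.haltsIn (wp_adaptiveProg hk hn hB hs hε hδ hδ1.le hW hL hm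
      (b := empiricalBound n A k W ε m ω) rfl rfl ?_ (fun h' => absurd h' h))
    intro h' s' h0 hmem
    refine ⟨cast_le_softO (by norm_num) hS hg0, 0, returns_zero h0 fun y => by
        rw [hmem]; exact hs.zero _ (by omega), hxP.trans (le_of_mul_le_mul_left h' hε)⟩

end Main

end

theorem theorem3p4 :
    ∃ (pre maxProg maxProg' frobProg : RamProg) (C : ℝ) (c : ℕ),
      ∀ (k : ℕ) (n : ℕ → ℕ) (A : ∀ l : ℕ, Matrix (Fin (n l)) (Fin (n (l + 1))) ℝ),
        1 ≤ k → (∀ l ≤ k, 1 ≤ n l) →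
        -- preprocessing, deterministic, without access to `ε` and `δ`
        ∃ mem : ℕ → ℝ,
          (∀ ω : ℕ → I, pre.HaltsIn ω (inputState n A k)
            (C * inputSize n k * Real.log (2 + inputSize n k) ^ c) fun s => s.mem = mem) ∧
          ∀ ε δ : ℝ, 0 < ε → 0 < δ → δ < 1 →
            -- max-norm
            ((∀ ω : ℕ → I, ∃ T : ℝ,
                maxProg.HaltsIn ω (queryState [ε, δ] mem) T fun _ => True) ∧
              coinMeasure {ω | ¬ maxProg.HaltsIn ω (queryState [ε, δ] mem)
                  (softO C c (inputSize n k)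
                    (k * (max (elemNorm ∞ ∞ (absChainProd n A k)) ε *
                      elemNorm 1 1 (absChainProd n A k) / ε ^ 2) *
                      Real.log (2 * (n 0 * n k) / δ)))
                  fun s => ∃ B : Matrix (Fin (n 0)) (Fin (n k)) ℝ,
                    s.Returns B ∧ elemNorm ∞ ∞ (B - chainProd n A k) ≤ ε} ≤
                ENNReal.ofReal δ) ∧
            -- max-norm, with an upper bound `b` on the max-norm of the product of absolute values
            -- as a further parameter
            (∀ b : ℝ, elemNorm ∞ ∞ (absChainProd n A k) ≤ b →
              (∀ ω : ℕ → I, maxProg'.HaltsIn ω (queryState [ε, δ, b] mem)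
                (softO C c (inputSize n k)
                  (k * (b * elemNorm 1 1 (absChainProd n A k) / ε ^ 2) *
                    Real.log (2 * (n 0 * n k) / δ)))
                fun s => ∃ B : Matrix (Fin (n 0)) (Fin (n k)) ℝ, s.Returns B) ∧
              coinMeasure {ω | ¬ ∃ T : ℝ, maxProg'.HaltsIn ω (queryState [ε, δ, b] mem) T
                  fun s => ∃ B : Matrix (Fin (n 0)) (Fin (n k)) ℝ,
                    s.Returns B ∧ elemNorm ∞ ∞ (B - chainProd n A k) ≤ ε} ≤
                ENNReal.ofReal δ) ∧
            -- Frobenius norm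
            ((∀ ω : ℕ → I, frobProg.HaltsIn ω (queryState [ε, δ] mem)
                (softO C c (inputSize n k)
                  (k * (elemNorm 1 1 (absChainProd n A k) ^ 2 / ε ^ 2) * Real.log (2 / δ)))
                fun s => ∃ B : Matrix (Fin (n 0)) (Fin (n k)) ℝ, s.Returns B) ∧
              coinMeasure {ω | ¬ ∃ T : ℝ, frobProg.HaltsIn ω (queryState [ε, δ] mem) T
                  fun s => ∃ B : Matrix (Fin (n 0)) (Fin (n k)) ℝ,
                    s.Returns B ∧ elemNorm 2 2 (B - chainProd n A k) ≤ ε} ≤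
                ENNReal.ofReal δ) := by
  refine ⟨preProg, adaptiveProg, givenBoundProg, frobeniusProg, 500000, 1, ?_⟩
  intro k n A hk hn
  obtain ⟨s, t, hex, hs, ht⟩ := wp_preProg (ω := fun _ => 0) A hk hn
  refine ⟨s.mem, fun ω => ⟨s, t, hex.of_randFree preProg_randFree, ?_, rfl⟩, ?_⟩
  · have hS : (1 : ℝ) ≤ inputSize n k := by exact_mod_cast one_le_inputSize hk hn
    have hlog : 1 ≤ Real.log (2 + inputSize n k) := by
      rw [Real.le_log_iff_exp_le (by positivity)]
      linarith [Real.exp_one_lt_d9]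
    have ht' : (t : ℝ) ≤ 100 * inputSize n k := by
      rw [Nat.zero_add] at ht
      exact_mod_cast ht
    rw [pow_one]
    nlinarith
  · intro ε δ hε hδ hδ1
    exact ⟨adaptiveProg_spec hk hn hs hε hδ hδ1, fun b hb => givenBoundProg_spec hk hn hs hε hδ hδ1 hb,
      frobeniusProg_spec hk hn hs hε hδ hδ1⟩
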